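/- **Proposition (dimension of $\mathcal C_+$ modulo scaling).** Let $n\ge 1$ and let $P\in\mathbb C[x]$ be a monic polynomial of degree $n$ such that $\overline P(-x)=(-1)^nP(x)$ (where $\overline P$ is obtained from $P$ by conjugating the coefficients) and such that every root $\alpha$ of $P$ satisfies $|\operatorname{Re}\alpha|<\tfrac12$. Let $\mathcal A=\mathcal A_P$ be the $\mathbb C$-algebra generated by $u,v,z$ with defining relations $$[z,u]=-u,\qquad [z,v]=v,\qquad vu=P\bigl(z-\tfrac12\bigr),\qquad uv=P\bigl(z+\tfrac12\bigr).$$ Let $c\in[0,1)$, and for $\varepsilon=\pm1$ let $\lambda=\varepsilon\, i^{-n}e^{-\pi i c}$ and let $\rho=\rho_\varepsilon$ (written $\rho_\pm$) be the antilinear ring automorphism of $\mathcal A$ with $$\rho(v)=\lambda u,\qquad \rho(u)=(-1)^n\lambda^{-1}v,\qquad \rho(z)=-z .$$ Let $\mathcal C_+$ be the convex cone, in the real vector space of sesquilinear forms on $\mathcal A$ (linear in the first and antilinear in the second variable), of all positive definite Hermitian forms $(\cdot,\cdot)$ on $\mathcal A$ that are $\rho$-invariant, i.e. $(a\rho(y),b)=(a,yb)$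 for all $a,b,y\in\mathcal A$. By the dimension of $\mathcal C_+$ modulo scaling we mean $\dim_{\mathbb R}\operatorname{span}_{\mathbb R}(\mathcal C_+)-1$. Then the dimension of $\mathcal C_+$ modulo scaling is * $n-2$ for even $n$ and $n-3$ for odd $n$, if $\rho=\rho_-$; * $n-2$ for even $n$ and $n-1$ for odd $n$, if $c\neq0$ and $\rho=\rho_+$; * $n-4$ for even $n$ and $n-3$ for odd $n$, if $c=0$ and $\rho=\rho_+$. Here, if the number listed is $\ge 0$, the cone $\mathcal C_+$ is nonempty and its linear span is finite-dimensional; if the number listed is negative, the statement means that $\mathcal C_+$ is empty. -/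

import Mathlib

open scoped Polynomial

noncomputable section

namespace Kleinian

/-- The three generators `u`, `v`, `z`. -/
inductive Gen : Type
  | u | v | z

/-- The free algebra `ℂ⟨u, v, z⟩`. -/
abbrev Free : Type := FreeAlgebra ℂ Gen

/-- The defining relations
`[z,u] = -u`, `[z,v] = v`, `vu = P(z - 1/2)`, `uv = P(z + 1/2)`. -/
inductive Rel (P : ℂ[X]) : Free → Free → Prop
  | zu : Rel P (FreeAlgebra.ι ℂ Gen.z * FreeAlgebra.ι ℂ Gen.u
      - FreeAlgebra.ι ℂ Gen.u * FreeAlgebra.ι ℂ Gen.z) (-FreeAlgebra.ι ℂ Gen.u)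
  | zv : Rel P (FreeAlgebra.ι ℂ Gen.z * FreeAlgebra.ι ℂ Gen.v
      - FreeAlgebra.ι ℂ Gen.v * FreeAlgebra.ι ℂ Gen.z) (FreeAlgebra.ι ℂ Gen.v)
  | vu : Rel P (FreeAlgebra.ι ℂ Gen.v * FreeAlgebra.ι ℂ Gen.u)
      (Polynomial.aeval (FreeAlgebra.ι ℂ Gen.z - algebraMap ℂ Free (1 / 2)) P)
  | uv : Rel P (FreeAlgebra.ι ℂ Gen.u * FreeAlgebra.ι ℂ Gen.v)
      (Polynomial.aeval (FreeAlgebra.ι ℂ Gen.z + algebraMap ℂ Free (1 / 2)) P)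

/-- The algebra `𝒜_P`, generated by `u`, `v`, `z` with the defining relations `Rel P`. -/
def Alg (P : ℂ[X]) : Type := RingQuot (Rel P)

instance instRingAlg (P : ℂ[X]) : Ring (Alg P) := RingQuot.instRing (Rel P)

instance instAlgebraAlg (P : ℂ[X]) : Algebra ℂ (Alg P) := RingQuot.instAlgebra (Rel P)

/-- The quotient map `ℂ⟨u, v, z⟩ → 𝒜_P`. -/
def mk (P : ℂ[X]) : Free →ₐ[ℂ] Alg P := RingQuot.mkAlgHom ℂ (Rel P)

theorem mk_rel {P : ℂ[X]} {x y : Free} (h : Rel P x y) : mk P x = mk P y :=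
  RingQuot.mkAlgHom_rel ℂ h

/-- The image of a generator in `𝒜_P`. -/
def gen (P : ℂ[X]) (g : Gen) : Alg P :=
  mk P (FreeAlgebra.ι ℂ g)

theorem gen_zu (P : ℂ[X]) :
    gen P Gen.z * gen P Gen.u - gen P Gen.u * gen P Gen.z = -gen P Gen.u := by
  simpa [gen] using mk_rel (Rel.zu (P := P))

theorem gen_zv (P : ℂ[X]) :
    gen P Gen.z * gen P Gen.v - gen P Gen.v * gen P Gen.z = gen P Gen.v := by
  simpa [gen] using mk_rel (Rel.zv (P := P))

theorem gen_vu (P : ℂ[X]) :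
    gen P Gen.v * gen P Gen.u
      = Polynomial.aeval (gen P Gen.z - algebraMap ℂ (Alg P) (1 / 2)) P := by
  have h := mk_rel (Rel.vu (P := P))
  rw [← Polynomial.aeval_algHom_apply, map_mul, map_sub, AlgHom.commutes] at h
  exact h

theorem gen_uv (P : ℂ[X]) :
    gen P Gen.u * gen P Gen.v
      = Polynomial.aeval (gen P Gen.z + algebraMap ℂ (Alg P) (1 / 2)) P := by
  have h := mk_rel (Rel.uv (P := P))
  rw [← Polynomial.aeval_algHom_apply, map_mul, map_add, AlgHom.commutes] at h
  exact h

/-- The images of the generators under the conjugation with parameters `lam`, `lam'`: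
`v ↦ lam • u`, `u ↦ lam' • v`, `z ↦ -z`. -/
def conjGen (P : ℂ[X]) (lam lam' : ℂ) : Gen → Alg P
  | Gen.u => lam' • gen P Gen.v
  | Gen.v => lam • gen P Gen.u
  | Gen.z => -gen P Gen.z

/-- The ring `𝒜_P` regarded as a `ℂ`-algebra through complex conjugation. -/
def ConjAlg (P : ℂ[X]) : Type := Alg P

instance instRingConjAlg (P : ℂ[X]) : Ring (ConjAlg P) := instRingAlg P

instance instAlgebraConjAlg (P : ℂ[X]) : Algebra ℂ (ConjAlg P) :=
  Algebra.compHom (Alg P) (starRingEnd ℂ)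

/-- The antilinear multiplicative extension of `conjGen` to the free algebra. -/
def conjFree (P : ℂ[X]) (lam lam' : ℂ) : Free →+* Alg P :=
  (FreeAlgebra.lift ℂ (A := ConjAlg P) (conjGen P lam lam')).toRingHom

theorem conjFree_gen (P : ℂ[X]) (lam lam' : ℂ) (g : Gen) :
    conjFree P lam lam' (FreeAlgebra.ι ℂ g) = conjGen P lam lam' g :=
  FreeAlgebra.lift_ι_apply (A := ConjAlg P) (conjGen P lam lam') g

theorem conjFree_algebraMap (P : ℂ[X]) (lam lam' r : ℂ) :
    conjFree P lam lam' (algebraMap ℂ Free r)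
      = algebraMap ℂ (Alg P) ((starRingEnd ℂ) r) :=
  AlgHom.commutes (FreeAlgebra.lift ℂ (A := ConjAlg P) (conjGen P lam lam')) r

theorem conjFree_aeval (P Q : ℂ[X]) (lam lam' : ℂ) (x : Free) :
    conjFree P lam lam' (Polynomial.aeval x Q)
      = Polynomial.aeval (conjFree P lam lam' x) (Q.map (starRingEnd ℂ)) := by
  rw [Polynomial.aeval_def, Polynomial.hom_eval₂, Polynomial.aeval_def, Polynomial.eval₂_map]
  congr 1
  ext r
  exact conjFree_algebraMap P lam lam' r

theorem conjFree_rel (P : ℂ[X]) (lam lam' : ℂ)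
    (h : (P.map (starRingEnd ℂ)).comp (-Polynomial.X) = Polynomial.C (lam * lam') * P)
    ⦃x y : Free⦄ (hxy : Rel P x y) : conjFree P lam lam' x = conjFree P lam lam' y := by
  have key : ∀ w : Alg P, Polynomial.aeval (-w) (P.map (starRingEnd ℂ))
      = (lam * lam') • Polynomial.aeval w P := by
    intro w
    have := congrArg (Polynomial.aeval w) h
    rw [Polynomial.aeval_comp] at this
    simpa [Algebra.smul_def] using this
  have hhalf : (starRingEnd ℂ) (1 / 2 : ℂ) = 1 / 2 := by
    simpa using Complex.conj_ofReal 2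
  cases hxy with
  | zu =>
    simp only [map_sub, map_mul, map_neg, conjFree_gen, conjGen]
    rw [neg_mul, mul_neg, mul_smul_comm, smul_mul_assoc, sub_neg_eq_add, neg_add_eq_sub,
      ← smul_sub, ← neg_sub, gen_zv P, smul_neg]
  | zv =>
    simp only [map_sub, map_mul, conjFree_gen, conjGen]
    rw [neg_mul, mul_neg, mul_smul_comm, smul_mul_assoc, sub_neg_eq_add, neg_add_eq_sub,
      ← smul_sub, ← neg_sub, gen_zu P, neg_neg]
  | vu =>
    rw [conjFree_aeval, map_mul, map_sub, conjFree_algebraMap, hhalf]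
    simp only [conjFree_gen, conjGen]
    rw [← neg_add', key, ← gen_uv, smul_mul_smul_comm]
  | uv =>
    rw [conjFree_aeval, map_mul, map_add, conjFree_algebraMap, hhalf]
    simp only [conjFree_gen, conjGen]
    rw [← sub_eq_neg_add, ← neg_sub, key, ← gen_vu, smul_mul_smul_comm, mul_comm lam' lam]

/-- The antilinear ring endomorphism `ρ` of `𝒜_P` with `ρ(v) = lam u`, `ρ(u) = lam' v`,
`ρ(z) = -z`; it exists when `P̄(-x) = lam lam' P(x)`. -/
def conjugation (P : ℂ[X]) (lam lam' : ℂ)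
    (h : (P.map (starRingEnd ℂ)).comp (-Polynomial.X) = Polynomial.C (lam * lam') * P) :
    Alg P →+* Alg P :=
  RingQuot.lift ⟨conjFree P lam lam', conjFree_rel P lam lam' h⟩

section
variable (P : ℂ[X]) (lam lam' : ℂ)
    (h : (P.map (starRingEnd ℂ)).comp (-Polynomial.X) = Polynomial.C (lam * lam') * P)

theorem conjugation_mk (x : Free) :
    conjugation P lam lam' h (mk P x) = conjFree P lam lam' x := by
  have := RingQuot.lift_mkRingHom_apply (conjFree P lam lam') (conjFree_rel P lam lam' h) x
  rw [← RingQuot.mkAlgHom_coe ℂ] at this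
  exact this

theorem conjugation_v :
    conjugation P lam lam' h (gen P Gen.v) = lam • gen P Gen.u :=
  (conjugation_mk P lam lam' h _).trans (conjFree_gen P lam lam' _)

theorem conjugation_u :
    conjugation P lam lam' h (gen P Gen.u) = lam' • gen P Gen.v :=
  (conjugation_mk P lam lam' h _).trans (conjFree_gen P lam lam' _)

theorem conjugation_z :
    conjugation P lam lam' h (gen P Gen.z) = -gen P Gen.z :=
  (conjugation_mk P lam lam' h _).trans (conjFree_gen P lam lam' _)

theorem conjugation_smul (r : ℂ) (a : Alg P) :
    conjugation P lam lam' h (r • a) = (starRingEnd ℂ) r • conjugation P lam lam' h a := by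
  rw [Algebra.smul_def, Algebra.smul_def, map_mul,
    ← AlgHom.commutes (mk P) r, conjugation_mk, conjFree_algebraMap]

end

/-- `λ = ε i⁻ⁿ e^{-π i c}` for a sign `ε = ±1`. -/
def lam (n : ℕ) (c : ℝ) (ε : ℤˣ) : ℂ :=
  ((ε : ℤ) : ℂ) * Complex.I ^ (-(n : ℤ)) * Complex.exp (-(Real.pi * Complex.I * c))

/-- `λ_* = (-1)ⁿ λ⁻¹`. -/
def lamStar (n : ℕ) (c : ℝ) (ε : ℤˣ) : ℂ := (-1) ^ n * (lam n c ε)⁻¹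

theorem lam_mul_lamStar (n : ℕ) (c : ℝ) (ε : ℤˣ) : lam n c ε * lamStar n c ε = (-1) ^ n := by
  have h : lam n c ε ≠ 0 := by
    have : ((ε : ℤ) : ℂ) ≠ 0 := by exact_mod_cast ε.ne_zero
    exact mul_ne_zero (mul_ne_zero this (zpow_ne_zero _ Complex.I_ne_zero)) (Complex.exp_ne_zero _)
  rw [lamStar]
  field_simp

/-- The conjugation `ρ_ε` (`ρ₊` for `ε = 1`, `ρ₋` for `ε = -1`) on `𝒜_P`, `n = deg P`,
with `ρ_ε² = g_t`, `t = e^{2π i c}`; it exists when `P̄(-x) = (-1)ⁿ P(x)`. -/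
def rho (P : ℂ[X]) (c : ℝ) (ε : ℤˣ)
    (hP : (P.map (starRingEnd ℂ)).comp (-Polynomial.X) = (-1) ^ P.natDegree * P) :
    Alg P →+* Alg P :=
  conjugation P (lam P.natDegree c ε) (lamStar P.natDegree c ε)
    (by rw [hP, lam_mul_lamStar]; simp)

/-- Sesquilinear forms on `𝒜_P`, linear in the first and antilinear in the second variable. -/
abbrev SesqForm (P : ℂ[X]) : Type := Alg P →ₗ[ℂ] Alg P →ₛₗ[starRingEnd ℂ] ℂ

/-- The cone `𝒞₊` of positive definite Hermitian forms on `𝒜_P` which are `ρ`-invariant: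
`(a ρ(y), b) = (a, y b)`. -/
def posCone (P : ℂ[X]) (ρ : Alg P →+* Alg P) : ConvexCone ℝ (SesqForm P) where
  carrier := {B | (∀ a b, B b a = (starRingEnd ℂ) (B a b)) ∧
    (∀ a y b, B (a * ρ y) b = B a (y * b)) ∧
    (∀ a, a ≠ 0 → 0 < (B a a).re)}
  smul_mem' := by
    rintro r hr B ⟨h1, h2, h3⟩
    refine ⟨fun a b => ?_, fun a y b => ?_, fun a ha => ?_⟩
    · simp [h1 a b]
    · simp [h2 a y b]
    · simpa using mul_pos hr (h3 a ha)
  add_mem' := by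
    rintro B ⟨h1, h2, h3⟩ B' ⟨h1', h2', h3'⟩
    refine ⟨fun a b => ?_, fun a y b => ?_, fun a ha => ?_⟩
    · simp [h1 a b, h1' a b]
    · simp [h2 a y b, h2' a y b]
    · simpa using add_pos (h3 a ha) (h3' a ha)

/-- The convex cone `C` modulo scaling by positive reals has dimension `d`, where a negative `d`
means that `C` is empty. The dimension of a nonempty convex cone is that of its
linear span, and passing to the quotient by scaling lowers it by one. -/
def HasDimModScaling {V : Type*} [AddCommGroup V] [Module ℝ V] (C : ConvexCone ℝ V) (d : ℤ) :
    Prop :=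
  (d < 0 ∧ (C : Set V) = ∅) ∨
  (0 ≤ d ∧ (C : Set V).Nonempty ∧ FiniteDimensional ℝ (Submodule.span ℝ (C : Set V)) ∧
    (Module.finrank ℝ (Submodule.span ℝ (C : Set V)) : ℤ) = d + 1)

end Kleinian

end

noncomputable section

namespace Kleinian

open MeasureTheory ProbabilityTheory

/-! A `ρ`-invariant form is `(a, b) = T(a ρ(b))` with `T = (·, 1)`. Hermitian symmetry makes `T` a
trace twisted by `ρ²`, which fixes `z` and scales `v` by `t = e^{2πic}`. Such a `T` kills every
nonzero weight of `ad z`, so it is a functional `τ` on `ℂ[z]` with `τ(Q(z-1/2)) = t τ(Q(z+1/2))` for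
all multiples `Q` of `P` (`exists_eq_formOf`, `trace_mul_comm`). Positivity on all of `𝒜` reduces to
weights `0` and `1`: a vector of higher weight is written as a palindrome `w x w`, and
`formOf_palindrome` moves the outer factors to one side, where they become a polynomial in `z`.

The functionals `τ` are integrals `R ↦ ∫ R(ix) w(x) dx` with `w = e^{2πiκz} g(e^{2πiz}) / ∏
(e^{2πiz} + e^{2πiα})` at `z = ix`, where `e^{2πiκ} = t`, `0 < κ ≤ 1` and `deg g < m`; here `m = n`
if `t ≠ 1` and `m = n - 1` if `t = 1`. The function `P(z) w(z ± 1/2)` is holomorphic on the strip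
`|Re z| ≤ 1/2` and decays exponentially, so shifting the contour gives the trace identity
(`traceForm_shift`). A trace is determined by its values on `1, z, …, z^{m-1}`, hence by dimension
every trace arises this way (`exists_traceForm_eq`).

Polynomials are dense in `L²` of a measure with an exponential moment, so positivity of the
integrals of `|R|² w` means `w ≥ 0`, that is, `g ≥ 0` on the positive half-line. In weight `1` the
shifted weight appears, where `e^{2πiz}` has changed sign, and the condition is `σ g ≥ 0` on the
negative half-line with `σ = ±1` (`mem_posCone_iff`). If `σ = 1`, then `g` is any nonzero
nonnegative real polynomial of degree less than `m`; if `σ = -1`, then `g = x f` with `f`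
nonnegative and of degree less than `m - 1`. Nonnegative polynomials have even degree and span all
polynomials up to the largest even degree allowed (`finrank_span_nonnegPoly`), which explains the
dependence on parity. -/

/-! ### Moments, density of polynomials and nonnegativity of weights -/

theorem zero_mem_interior_integrableExpSet {μ : Measure ℝ} {b : ℝ} (hb : 0 < b)
    (hμ : Integrable (fun x => Real.exp (b * |x|)) μ) :
    (0 : ℝ) ∈ interior (integrableExpSet id μ) := by
  rw [mem_interior_iff_mem_nhds]
  refine Filter.mem_of_superset (Ioo_mem_nhds (neg_lt_zero.mpr hb) hb) fun t ht => ?_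
  refine hμ.mono' (by fun_prop) (Filter.Eventually.of_forall fun x => ?_)
  rw [Real.norm_eq_abs, Real.abs_exp]
  refine Real.exp_le_exp.mpr ((le_abs_self _).trans ?_)
  rw [abs_mul]
  exact mul_le_mul_of_nonneg_right (abs_lt.mpr ht).le (abs_nonneg _)

/-- A finite measure on the line with some finite exponential moment is determined by its
moments. -/
theorem measure_eq_of_moments_eq {μ ν : Measure ℝ} [IsFiniteMeasure μ] [IsFiniteMeasure ν] {b : ℝ}
    (hb : 0 < b) (hμ : Integrable (fun x => Real.exp (b * |x|)) μ)
    (hν : Integrable (fun x => Real.exp (b * |x|)) ν)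
    (h : ∀ n : ℕ, ∫ x, x ^ n ∂μ = ∫ x, x ^ n ∂ν) : μ = ν := by
  set U : Set ℂ := {z | z.re ∈ interior (integrableExpSet id μ) ∩ interior (integrableExpSet id ν)}
  have h0μ := zero_mem_interior_integrableExpSet hb hμ
  have h0ν := zero_mem_interior_integrableExpSet hb hν
  have hfμ : AnalyticOnNhd ℂ (complexMGF id μ) U := fun z hz => analyticAt_complexMGF hz.1
  have hfν : AnalyticOnNhd ℂ (complexMGF id ν) U := fun z hz => analyticAt_complexMGF hz.2
  have hU : IsPreconnected U := by
    refine Convex.isPreconnected ?_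
    exact ((convex_integrableExpSet.interior).inter (convex_integrableExpSet.interior)).linear_preimage
      Complex.reLm
  have h0U : (0 : ℂ) ∈ U := ⟨by simpa using h0μ, by simpa using h0ν⟩
  -- The derivatives at `0` are the moments, so the two analytic functions have the same Taylor
  -- series and agree on the connected strip `U`.
  have hder : ∀ n, iteratedDeriv n (complexMGF id μ) 0 = iteratedDeriv n (complexMGF id ν) 0 := by
    intro n
    rw [iteratedDeriv_complexMGF (by simpa using h0μ),
      iteratedDeriv_complexMGF (by simpa using h0ν)]
    simp only [id, zero_mul, Complex.exp_zero, mul_one]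
    exact_mod_cast congrArg (fun r : ℝ => (r : ℂ)) (h n)
  have hev : complexMGF id μ =ᶠ[nhds 0] complexMGF id ν := by
    have h1 := (hfμ 0 h0U).hasFPowerSeriesAt
    have h2 := (hfν 0 h0U).hasFPowerSeriesAt
    simp only [hder] at h1
    have h3 := h1.sub h2
    rw [sub_self] at h3
    filter_upwards [h3.eventually_eq_zero] with z hz
    simpa [sub_eq_zero] using hz
  have heq := hfμ.eqOn_of_preconnected_of_eventuallyEq hfν hU h0U hev
  -- The characteristic function is the restriction to the imaginary axis, which lies in `U`.
  refine Measure.ext_of_charFun ?_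
  ext t
  rw [← complexMGF_id_mul_I, ← complexMGF_id_mul_I]
  exact heq ⟨by simpa using h0μ, by simpa using h0ν⟩

theorem abs_eval_le_exp (p : ℝ[X]) {b : ℝ} (hb : 0 < b) :
    ∃ C, 0 ≤ C ∧ ∀ x : ℝ, |p.eval x| ≤ C * Real.exp (b * |x|) := by
  induction p using Polynomial.induction_on' with
  | add p q hp hq =>
    obtain ⟨C, hC, h1⟩ := hp
    obtain ⟨D, hD, h2⟩ := hq
    refine ⟨C + D, add_nonneg hC hD, fun x => ?_⟩
    rw [Polynomial.eval_add, add_mul]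
    exact (abs_add_le _ _).trans (add_le_add (h1 x) (h2 x))
  | monomial n a =>
    refine ⟨|a| * (n.factorial / b ^ n), by positivity, fun x => ?_⟩
    rw [Polynomial.eval_monomial, abs_mul, abs_pow, mul_assoc]
    refine mul_le_mul_of_nonneg_left ?_ (abs_nonneg a)
    have := Real.pow_div_factorial_le_exp (b * |x|) (by positivity) n
    rw [mul_pow, div_le_iff₀ (by positivity)] at this
    rw [div_mul_eq_mul_div, le_div_iff₀ (by positivity)]
    linarith

theorem memLp_eval {μ : Measure ℝ} {b : ℝ} (hb : 0 < b)
    (hμ : Integrable (fun x => Real.exp (b * |x|)) μ) (p : ℝ[X]) :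
    MemLp (fun x => p.eval x) 2 μ := by
  rw [memLp_two_iff_integrable_sq (by fun_prop)]
  obtain ⟨C, hC, h⟩ := abs_eval_le_exp (p ^ 2) hb
  refine (hμ.const_mul C).mono' (by fun_prop) (Filter.Eventually.of_forall fun x => ?_)
  simpa using h x

/-- The positive and negative parts of `g`, taken as densities with respect to `μ`, give two finite
measures with the same moments, and moments determine such measures. -/
theorem ae_eq_zero_of_integral_eval_mul_eq_zero {μ : Measure ℝ} [IsFiniteMeasure μ] {b : ℝ}
    (hb : 0 < b) (hμ : Integrable (fun x => Real.exp (b * |x|)) μ) {g : ℝ → ℝ} (hg : MemLp g 2 μ)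
    (h : ∀ p : ℝ[X], ∫ x, p.eval x * g x ∂μ = 0) : g =ᵐ[μ] 0 := by
  have hexp : MemLp (fun x => Real.exp (b / 2 * |x|)) 2 μ := by
    rw [memLp_two_iff_integrable_sq (by fun_prop)]
    refine hμ.congr (Filter.Eventually.of_forall fun x => ?_)
    simp only [← Real.exp_nat_mul]
    congr 1
    push_cast
    ring
  -- `ENNReal.ofReal` truncates at `0`, so the density is the positive part of `f`. It is only known
  -- to be in `L²`, so the exponential moment survives at rate `b / 2`, as a product of two `L²`
  -- functions.
  have key : ∀ f : ℝ → ℝ, MemLp f 2 μ → IsFiniteMeasure (μ.withDensity fun x => ENNReal.ofReal (f x)) ∧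
      Integrable (fun x => Real.exp (b / 2 * |x|)) (μ.withDensity fun x => ENNReal.ofReal (f x)) ∧
      ∀ q : ℝ → ℝ, ∫ x, q x ∂(μ.withDensity fun x => ENNReal.ofReal (f x))
        = ∫ x, max (f x) 0 * q x ∂μ := by
    intro f hf
    have hm : AEMeasurable (fun x => ENNReal.ofReal (f x)) μ :=
      hf.aestronglyMeasurable.aemeasurable.ennreal_ofReal
    have hfin : ∀ᵐ x ∂μ, ENNReal.ofReal (f x) < ⊤ := by simp
    refine ⟨isFiniteMeasure_withDensity_ofReal (hf.integrable (by norm_num)).2, ?_, fun q => ?_⟩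
    · rw [integrable_withDensity_iff_integrable_smul₀' hm hfin]
      have hf' : MemLp (fun x => max (f x) 0) 2 μ := hf.pos_part
      refine (hf'.integrable_mul hexp).congr (Filter.Eventually.of_forall fun x => ?_)
      simp [ENNReal.toReal_ofReal']
    · rw [integral_withDensity_eq_integral_toReal_smul₀ hm hfin]
      simp [ENNReal.toReal_ofReal']
  obtain ⟨i1, e1, k1⟩ := key g hg
  obtain ⟨i2, e2, k2⟩ := key (fun x => -g x) hg.neg
  have heq := measure_eq_of_moments_eq (half_pos hb) e1 e2 (fun n => by
    rw [k1, k2, ← sub_eq_zero, ← integral_sub]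
    · refine Eq.trans ?_ (h (Polynomial.X ^ n))
      congr 1
      ext x
      rw [← sub_mul, Polynomial.eval_pow, Polynomial.eval_X, mul_comm (_ ^ n)]
      congr 1
      rcases le_total (g x) 0 with hx | hx
      · rw [max_eq_right hx, max_eq_left (neg_nonneg.mpr hx), zero_sub, neg_neg]
      · rw [max_eq_left hx, max_eq_right (neg_nonpos.mpr hx), sub_zero]
    · refine (hg.pos_part.integrable_mul (memLp_eval hb hμ (Polynomial.X ^ n))).congr
        (Filter.Eventually.of_forall fun x => by simp)
    · refine (hg.neg.pos_part.integrable_mul (memLp_eval hb hμ (Polynomial.X ^ n))).congr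
        (Filter.Eventually.of_forall fun x => by simp))
  have heq' := (withDensity_eq_iff hg.aestronglyMeasurable.aemeasurable.ennreal_ofReal
    hg.neg.aestronglyMeasurable.aemeasurable.ennreal_ofReal
    (hg.integrable (by norm_num)).lintegral_lt_top.ne).mp heq
  filter_upwards [heq'] with x hx
  have hx' := congrArg ENNReal.toReal hx
  rw [ENNReal.toReal_ofReal', ENNReal.toReal_ofReal', Pi.neg_apply] at hx'
  rcases le_total (g x) 0 with h0 | h0 <;> simp [h0] at hx' ⊢ <;> linarith

/-- Polynomials are dense in `L²(μ)` when `μ` has an exponential moment. -/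
theorem exists_polynomial_integral_sq_sub_lt {μ : Measure ℝ} [IsFiniteMeasure μ] {b : ℝ}
    (hb : 0 < b) (hμ : Integrable (fun x => Real.exp (b * |x|)) μ) {f : ℝ → ℝ} (hf : MemLp f 2 μ)
    {η : ℝ} (hη : 0 < η) : ∃ p : ℝ[X], ∫ x, (p.eval x - f x) ^ 2 ∂μ < η := by
  let q : ℝ[X] →ₗ[ℝ] Lp ℝ 2 μ :=
    { toFun := fun p => (memLp_eval hb hμ p).toLp
      map_add' := fun p r => by
        rw [← MemLp.toLp_add]
        congr 1
        ext x
        simp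
      map_smul' := fun c p => by
        rw [RingHom.id_apply, ← MemLp.toLp_const_smul]
        congr 1
        ext x
        simp }
  -- In a Hilbert space, density amounts to a trivial orthogonal complement.
  have hdense : (LinearMap.range q).topologicalClosure = ⊤ := by
    rw [Submodule.topologicalClosure_eq_top_iff, Submodule.eq_bot_iff]
    intro g hg
    rw [Submodule.mem_orthogonal] at hg
    have hz : (g : ℝ → ℝ) =ᵐ[μ] 0 := by
      refine ae_eq_zero_of_integral_eval_mul_eq_zero hb hμ (Lp.memLp g) fun p => ?_
      have h1 := hg (q p) ⟨p, rfl⟩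
      rw [L2.inner_def] at h1
      rw [← h1]
      refine integral_congr_ae ?_
      filter_upwards [(memLp_eval hb hμ p).coeFn_toLp] with x hx
      have : (q p : ℝ → ℝ) x = p.eval x := hx
      simp [this, mul_comm]
    exact Lp.eq_zero_iff_ae_eq_zero.mpr hz
  have hmem : hf.toLp ∈ closure (LinearMap.range q : Set (Lp ℝ 2 μ)) := by
    rw [← Submodule.topologicalClosure_coe, hdense]
    trivial
  obtain ⟨_, ⟨p, rfl⟩, hp⟩ := Metric.mem_closure_iff.mp hmem (Real.sqrt η) (Real.sqrt_pos.mpr hη)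
  refine ⟨p, ?_⟩
  rw [dist_comm, dist_eq_norm] at hp
  have h2 : ‖q p - hf.toLp‖ ^ 2 < η := by
    have := pow_lt_pow_left₀ hp (norm_nonneg _) two_ne_zero
    rwa [Real.sq_sqrt hη.le] at this
  rw [← real_inner_self_eq_norm_sq, L2.inner_def] at h2
  refine lt_of_eq_of_lt (integral_congr_ae ?_) h2
  filter_upwards [(memLp_eval hb hμ p).coeFn_toLp, hf.coeFn_toLp,
    Lp.coeFn_sub (q p) (hf.toLp)] with x h1 h2 h3
  have h1' : (q p : ℝ → ℝ) x = p.eval x := h1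
  rw [h3]
  simp [h1', h2, sq]

theorem integrable_exp_neg_mul_abs {δ : ℝ} (hδ : 0 < δ) :
    Integrable (fun x : ℝ => Real.exp (-(δ * |x|))) := by
  have h1 : IntegrableOn (fun x : ℝ => Real.exp (-(δ * |x|))) (Set.Ioi 0) := by
    refine (integrableOn_exp_mul_Ioi (neg_lt_zero.mpr hδ) 0).congr_fun (fun x hx => ?_)
      measurableSet_Ioi
    simp [abs_of_pos (Set.mem_Ioi.mp hx)]
  have h2 : IntegrableOn (fun x : ℝ => Real.exp (-(δ * |x|))) (Set.Iic 0) := by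
    refine (integrableOn_exp_mul_Iic hδ 0).congr_fun (fun x hx => ?_) measurableSet_Iic
    simp [abs_of_nonpos (Set.mem_Iic.mp hx)]
  rw [← integrableOn_univ, ← Set.Iic_union_Ioi (a := (0 : ℝ))]
  exact h2.union h1

/-- A continuous exponentially decaying weight which is nonnegative against all squares of
polynomials is nonnegative. -/
theorem nonneg_of_integral_sq_mul_nonneg {h : ℝ → ℝ} (hc : Continuous h) {C δ : ℝ} (hδ : 0 < δ)
    (hb : ∀ x, |h x| ≤ C * Real.exp (-(δ * |x|)))
    (hpos : ∀ p : ℝ[X], 0 ≤ ∫ x, p.eval x ^ 2 * h x) (x : ℝ) : 0 ≤ h x := by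
  have hm : Measurable fun x => ENNReal.ofReal |h x| := by fun_prop
  set μ : Measure ℝ := volume.withDensity fun x => ENNReal.ofReal |h x| with hμdef
  have hfin : ∀ᵐ x : ℝ, ENNReal.ofReal |h x| < ⊤ := by simp
  have hint : ∀ q : ℝ → ℝ, Integrable q μ ↔ Integrable fun x => |h x| * q x := by
    intro q
    rw [integrable_withDensity_iff_integrable_smul₀' hm.aemeasurable hfin]
    simp
  have hinteg : ∀ q : ℝ → ℝ, ∫ x, q x ∂μ = ∫ x, |h x| * q x := by
    intro q
    rw [integral_withDensity_eq_integral_toReal_smul₀ hm.aemeasurable hfin]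
    simp
  have hexp : Integrable (fun x => Real.exp (δ / 2 * |x|)) μ := by
    rw [hint]
    refine ((integrable_exp_neg_mul_abs (half_pos hδ)).const_mul C).mono' (by fun_prop)
      (Filter.Eventually.of_forall fun x => ?_)
    rw [norm_mul, Real.norm_eq_abs, abs_abs, Real.norm_eq_abs, Real.abs_exp]
    refine (mul_le_mul_of_nonneg_right (hb x) (Real.exp_nonneg _)).trans_eq ?_
    rw [mul_assoc, ← Real.exp_add]
    congr 2
    ring
  have : IsFiniteMeasure μ := by
    refine isFiniteMeasure_withDensity_ofReal ?_
    have : Integrable fun x => |h x| := by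
      refine ((integrable_exp_neg_mul_abs hδ).const_mul C).mono' (by fun_prop)
        (Filter.Eventually.of_forall fun x => ?_)
      simpa using hb x
    exact this.2
  set A : Set ℝ := {x | h x < 0} with hA
  have hAm : MeasurableSet A := (isOpen_lt hc continuous_const).measurableSet
  -- Squares of polynomials that approximate the indicator of the bad set `A` detect its mass for
  -- `|h| dx`.
  set f : ℝ → ℝ := A.indicator 1 with hf
  have hfL : MemLp f 2 μ := (memLp_const (1 : ℝ)).indicator hAm
  have hμA : ∀ η : ℝ, 0 < η → ∫ x, f x ∂μ ≤ η := by
    intro η hη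
    obtain ⟨p, hp⟩ := exists_polynomial_integral_sq_sub_lt (half_pos hδ) hexp hfL
      (show (0 : ℝ) < η / 4 by positivity)
    have hL := (memLp_eval (half_pos hδ) hexp p).sub hfL
    have hi1 : Integrable (fun x => (p.eval x - f x) ^ 2) μ := hL.integrable_sq
    have hi2 : Integrable f μ := hfL.integrable (by norm_num)
    -- Relative to `|h| dx` the integrand is `p²` off `A` and `-p²` on `A`, and there `p² ≤ 2p²` and
    -- `-p² ≤ 2(p - 1)² - 1/2` respectively. An `L²` error below `η / 4` then yields `∫ f ≤ η`.
    have hle : ∫ x, p.eval x ^ 2 * h x ≤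
        ∫ x, (2 * (p.eval x - f x) ^ 2 - 1 / 2 * f x) ∂μ := by
      rw [hinteg]
      have hi3 := (memLp_eval (half_pos hδ) hexp p).integrable_sq
      rw [hint] at hi3
      refine integral_mono ?_ ((hint _).mp ((hi1.const_mul 2).sub (hi2.const_mul (1 / 2)))) ?_
      · refine hi3.mono (by fun_prop) (Filter.Eventually.of_forall fun x => ?_)
        simp [mul_comm]
      · intro x
        by_cases hx : x ∈ A
        · have hx' : h x < 0 := hx
          simp only [hf, Set.indicator_of_mem hx, Pi.one_apply, abs_of_neg hx']
          nlinarith [sq_nonneg (3 * p.eval x - 2)]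
        · have hx' : 0 ≤ h x := not_lt.mp hx
          simp only [hf, Set.indicator_of_notMem hx, abs_of_nonneg hx']
          nlinarith [sq_nonneg (p.eval x)]
    rw [integral_sub (hi1.const_mul 2) (hi2.const_mul _), integral_const_mul,
      integral_const_mul] at hle
    linarith [hpos p]
  have hzero : ∫ x, f x ∂μ ≤ 0 := le_of_forall_pos_le_add fun η hη => by
    simpa using hμA η hη
  have hcont : Continuous fun x => max (-h x) 0 := by fun_prop
  have hz : (fun x => max (-h x) 0) =ᵐ[volume] 0 := by
    have hfm : ∀ x, |h x| * f x = max (-h x) 0 := by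
      intro x
      by_cases hx : x ∈ A
      · have hx' : h x < 0 := hx
        simp [hf, Set.indicator_of_mem hx, abs_of_neg hx', hx'.le]
      · have hx' : 0 ≤ h x := not_lt.mp hx
        simp [hf, Set.indicator_of_notMem hx, hx']
    rw [hinteg] at hzero
    simp only [hfm] at hzero
    have hi := (hint f).mp (hfL.integrable (by norm_num))
    simp only [hfm] at hi
    refine (integral_eq_zero_iff_of_nonneg (fun x => le_max_right _ _) hi).mp ?_
    exact le_antisymm hzero (integral_nonneg fun x => le_max_right _ _)
  have := congrFun ((hcont.ae_eq_iff_eq volume continuous_const).mp hz) x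
  exact neg_nonpos.mp (max_eq_right_iff.mp this)

/-! ### Contour shift across a vertical strip -/

/-- Shifting the line of integration in a vertical strip for an exponentially decaying function. -/
theorem integral_vertical_line_eq {F : ℂ → ℂ} {l r : ℝ} {C δ : ℝ} (hδ : 0 < δ)
    (hF : DifferentiableOn ℂ F {z | z.re ∈ Set.Icc l r})
    (hb : ∀ z : ℂ, z.re ∈ Set.Icc l r → ‖F z‖ ≤ C * Real.exp (-(δ * |z.im|)))
    {a b : ℝ} (ha : a ∈ Set.Icc l r) (hb' : b ∈ Set.Icc l r) :
    ∫ y : ℝ, F (a + y * Complex.I) = ∫ y : ℝ, F (b + y * Complex.I) := by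
  have hint : ∀ a ∈ Set.Icc l r, Integrable fun y : ℝ => F (a + y * Complex.I) := by
    intro a ha
    refine ((integrable_exp_neg_mul_abs hδ).const_mul C).mono' ?_
      (Filter.Eventually.of_forall fun y => ?_)
    · refine (hF.continuousOn.comp_continuous (by fun_prop) fun y => ?_).aestronglyMeasurable
      simpa using ha
    · simpa using hb (a + y * Complex.I) (by simpa using ha)
  have hlim : ∀ a ∈ Set.Icc l r, Filter.Tendsto (fun T : ℝ => ∫ y in (-T)..T, F (a + y * Complex.I))
      Filter.atTop (nhds (∫ y : ℝ, F (a + y * Complex.I))) := fun a ha =>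
    intervalIntegral_tendsto_integral (hint a ha) Filter.tendsto_neg_atTop_atBot Filter.tendsto_id
  have hseg : ∀ x ∈ Set.uIcc a b, x ∈ Set.Icc l r := fun x hx =>
    Set.uIcc_subset_Icc ha hb' hx
  have hexp : Filter.Tendsto (fun T : ℝ => C * Real.exp (-(δ * |T|)) * |b - a|) Filter.atTop
      (nhds 0) := by
    have h1 : Filter.Tendsto (fun T : ℝ => Real.exp (-(δ * |T|))) Filter.atTop (nhds 0) :=
      Real.tendsto_exp_neg_atTop_nhds_zero.comp
        ((Filter.tendsto_abs_atTop_atTop).const_mul_atTop hδ)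
    simpa using (h1.const_mul C).mul_const |b - a|
  have hhor : ∀ s : ℝ, |s| = 1 → Filter.Tendsto
      (fun T : ℝ => ∫ x in a..b, F (x + (s * T : ℝ) * Complex.I)) Filter.atTop (nhds 0) := by
    intro s hs
    refine squeeze_zero_norm (fun T => ?_) hexp
    refine intervalIntegral.norm_integral_le_of_norm_le_const fun x hx => ?_
    have := hb (x + (s * T : ℝ) * Complex.I)
      (by simpa using hseg x (Set.uIoc_subset_uIcc hx))
    simpa [abs_mul, hs] using this
  -- Cauchy's theorem on the rectangle of height `2T`; its horizontal sides vanish in the limit by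
  -- `hhor`.
  have hrect : ∀ T : ℝ, Complex.I * (∫ y in (-T)..T, F (b + y * Complex.I))
      - Complex.I * (∫ y in (-T)..T, F (a + y * Complex.I))
      = (∫ x in a..b, F (x + ((1 : ℝ) * T : ℝ) * Complex.I))
        - ∫ x in a..b, F (x + ((-1 : ℝ) * T : ℝ) * Complex.I) := by
    intro T
    have h := Complex.integral_boundary_rect_eq_zero_of_differentiableOn F
      (⟨a, -T⟩ : ℂ) (⟨b, T⟩ : ℂ) (hF.mono fun z hz => by
        rw [Complex.mem_reProdIm] at hz
        exact hseg _ hz.1)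
    simp only [smul_eq_mul] at h
    simp only [one_mul, neg_one_mul]
    linear_combination h
  have h0 : Filter.Tendsto (fun T : ℝ => Complex.I * (∫ y in (-T)..T, F (b + y * Complex.I))
      - Complex.I * (∫ y in (-T)..T, F (a + y * Complex.I))) Filter.atTop (nhds 0) := by
    simp only [hrect]
    simpa using (hhor 1 (by simp)).sub (hhor (-1) (by simp))
  have h1 := ((hlim b hb').const_mul Complex.I).sub ((hlim a ha).const_mul Complex.I)
  have h2 := tendsto_nhds_unique h1 h0
  rw [← mul_sub, mul_eq_zero, sub_eq_zero] at h2
  exact (h2.resolve_left Complex.I_ne_zero).symm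

/-! ### The exponential `e^{2πiz}` and its difference quotients -/

/-- The function `z ↦ e^{2πiz}`. -/
def ex (z : ℂ) : ℂ := Complex.exp (2 * Real.pi * Complex.I * z)

theorem differentiable_ex : Differentiable ℂ ex := by
  unfold ex
  fun_prop

theorem ex_add (z w : ℂ) : ex (z + w) = ex z * ex w := by
  rw [ex, mul_add, Complex.exp_add, ex, ex]

theorem ex_ne_zero (z : ℂ) : ex z ≠ 0 := Complex.exp_ne_zero _

theorem norm_ex (z : ℂ) : ‖ex z‖ = Real.exp (-(2 * Real.pi * z.im)) := by
  rw [ex, Complex.norm_exp]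
  congr 1
  simp

theorem ex_mul_I (x : ℝ) : ex (x * Complex.I) = Real.exp (-(2 * Real.pi * x)) := by
  rw [ex, Complex.ofReal_exp]
  congr 1
  push_cast
  linear_combination (2 * Real.pi * x : ℂ) * Complex.I_mul_I

theorem ex_half : ex (1 / 2) = -1 := by
  rw [ex, ← Complex.exp_pi_mul_I]
  congr 1
  ring

theorem ex_neg_half : ex (-(1 / 2)) = -1 := by
  rw [ex, ← Complex.exp_neg_pi_mul_I]
  congr 1
  ring

theorem ex_sub_half (z : ℂ) : ex (z - 1 / 2) = -ex z := by
  rw [sub_eq_add_neg, ex_add, ex_neg_half, mul_neg_one]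

theorem ex_neg_conj (z : ℂ) : ex (-(starRingEnd ℂ) z) = (starRingEnd ℂ) (ex z) := by
  rw [ex, ex, ← Complex.exp_conj]
  congr 1
  simp [map_ofNat (starRingEnd ℂ) 2]

/-- The entire function `w ↦ (e^{2πiw} - 1) / w`. -/
def exSlope (w : ℂ) : ℂ := dslope ex 0 w

theorem differentiable_exSlope : Differentiable ℂ exSlope := by
  rw [← differentiableOn_univ]
  exact (Complex.differentiableOn_dslope Filter.univ_mem).mpr differentiable_ex.differentiableOn

theorem mul_exSlope (w : ℂ) : w * exSlope w = ex w - 1 := by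
  have h := sub_smul_dslope ex 0 w
  simpa [ex, exSlope] using h

theorem exSlope_zero : exSlope 0 = 2 * Real.pi * Complex.I := by
  rw [exSlope, dslope_same]
  have h : HasDerivAt ex (ex 0 * (2 * Real.pi * Complex.I * 1)) 0 :=
    ((hasDerivAt_id (0 : ℂ)).const_mul _).cexp
  rw [h.deriv]
  simp [ex]

/-- `e^{2πiw} = 1` only at integers, and the only integer in the strip is `0`, where the value is
`2πi`. -/
theorem exSlope_ne_zero {w : ℂ} (hw : |w.re| < 1) : exSlope w ≠ 0 := by
  intro h
  by_cases h0 : w = 0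
  · rw [h0, exSlope_zero] at h
    exact Complex.two_pi_I_ne_zero h
  · have h1 := mul_exSlope w
    rw [h, mul_zero] at h1
    obtain ⟨k, hk⟩ := Complex.exp_eq_one_iff.mp (sub_eq_zero.mp h1.symm)
    rw [mul_comm] at hk
    have hk' : w = k := mul_right_cancel₀ Complex.two_pi_I_ne_zero hk
    rw [hk', Complex.intCast_re] at hw
    have : |k| < 1 := by exact_mod_cast hw
    rw [Int.abs_lt_one_iff] at this
    exact h0 (by simp [hk', this])

theorem exSlope_neg_conj (w : ℂ) :
    exSlope (-(starRingEnd ℂ) w) = -(starRingEnd ℂ) (exSlope w) := by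
  by_cases h0 : w = 0
  · simp [h0, exSlope_zero, map_ofNat (starRingEnd ℂ) 2]
  · have h1 := mul_exSlope (-(starRingEnd ℂ) w)
    have h2 := congrArg (starRingEnd ℂ) (mul_exSlope w)
    rw [map_mul, map_sub, map_one, ← ex_neg_conj, ← h1] at h2
    have h3 : (starRingEnd ℂ) w ≠ 0 := by simpa using h0
    apply mul_left_cancel₀ h3
    linear_combination h2

/-- The positive number is `(1 - e^{-2πy}) / y`, or `2π` at `y = 0`. The factor `i`, one for each
root, is the origin of the power `iⁿ` in the weight-one condition. -/
theorem exSlope_mul_I (y : ℝ) : ∃ r : ℝ, 0 < r ∧ exSlope (y * Complex.I) = r * Complex.I := by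
  rcases eq_or_ne y 0 with rfl | hy
  · exact ⟨2 * Real.pi, by positivity, by simp [exSlope_zero]⟩
  · refine ⟨(1 - Real.exp (-(2 * Real.pi * y))) / y, ?_, ?_⟩
    · rcases lt_or_gt_of_ne hy with h | h
      · refine div_pos_of_neg_of_neg (sub_neg.mpr (Real.one_lt_exp_iff.mpr ?_)) h
        nlinarith [Real.pi_pos]
      · refine div_pos (sub_pos.mpr (Real.exp_lt_one_iff.mpr ?_)) h
        nlinarith [Real.pi_pos]
    · have h1 := mul_exSlope (y * Complex.I)
      rw [ex_mul_I] at h1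
      have h2 : (y : ℂ) ≠ 0 := by exact_mod_cast hy
      apply mul_left_cancel₀ (mul_ne_zero h2 Complex.I_ne_zero)
      rw [h1]
      push_cast
      field_simp
      rw [Complex.I_sq]
      ring

/-- Compactness gives the bound for `|Im w| ≤ 1`. Elsewhere `|e^{2πiw} - 1|` is at least half of `1
+ |e^{2πiw}|`, and dividing by `|w|` costs the factor `1 + |Im w|`. -/
theorem exists_le_norm_exSlope {r : ℝ} (hr : r < 1) : ∃ c, 0 < c ∧ ∀ w : ℂ, |w.re| ≤ r →
    c * (1 + Real.exp (-(2 * Real.pi * w.im))) ≤ ‖exSlope w‖ * (1 + |w.im|) := by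
  have hK : IsCompact (Set.Icc (-r) r ×ℂ Set.Icc (-1 : ℝ) 1) := isCompact_Icc.reProdIm isCompact_Icc
  have hcont : ContinuousOn (fun w => ‖exSlope w‖) (Set.Icc (-r) r ×ℂ Set.Icc (-1 : ℝ) 1) :=
    differentiable_exSlope.continuous.norm.continuousOn
  obtain ⟨c₀, hc₀, hc⟩ : ∃ c₀, 0 < c₀ ∧
      ∀ w ∈ Set.Icc (-r) r ×ℂ Set.Icc (-1 : ℝ) 1, c₀ ≤ ‖exSlope w‖ := by
    rcases (Set.Icc (-r) r ×ℂ Set.Icc (-1 : ℝ) 1).eq_empty_or_nonempty with he | hne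
    · exact ⟨1, one_pos, by simp [he]⟩
    · obtain ⟨w₀, hw₀, hmin⟩ := hK.exists_isMinOn hne hcont
      refine ⟨‖exSlope w₀‖, norm_pos_iff.mpr (exSlope_ne_zero ?_), fun w hw => hmin hw⟩
      rw [Complex.mem_reProdIm] at hw₀
      exact (abs_le.mpr hw₀.1).trans_lt hr
  set M := 1 + Real.exp (2 * Real.pi) with hM
  have hMpos : 0 < M := by positivity
  refine ⟨min (c₀ / M) (1 / 2), by positivity, fun w hw => ?_⟩
  have hY := Real.exp_pos (-(2 * Real.pi * w.im))
  set Y := Real.exp (-(2 * Real.pi * w.im)) with hYdef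
  have hpi := Real.pi_gt_three
  by_cases h1 : |w.im| ≤ 1
  · have h2 : Y ≤ Real.exp (2 * Real.pi) := Real.exp_le_exp.mpr (by nlinarith [(abs_le.mp h1).1])
    have h3 := hc w (by rw [Complex.mem_reProdIm]; exact ⟨abs_le.mp hw, abs_le.mp h1⟩)
    calc min (c₀ / M) (1 / 2) * (1 + Y) ≤ c₀ / M * M := by
          refine mul_le_mul (min_le_left _ _) (by linarith) (by positivity) (by positivity)
      _ = c₀ := by field_simp
      _ ≤ ‖exSlope w‖ := h3
      _ ≤ ‖exSlope w‖ * (1 + |w.im|) := by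
          nlinarith [norm_nonneg (exSlope w), abs_nonneg w.im]
  · push Not at h1
    have h4 : (1 + Y) / 2 ≤ ‖ex w - 1‖ := by
      have h5 : |Y - 1| ≤ ‖ex w - 1‖ := by
        have := abs_norm_sub_norm_le (ex w) 1
        rwa [norm_ex, norm_one] at this
      refine le_trans ?_ h5
      rcases lt_abs.mp h1 with h | h
      · have h6 : Y ≤ 1 / 3 := by
          have h7 := Real.add_one_le_exp (2 * Real.pi * w.im)
          have h8 : Y * Real.exp (2 * Real.pi * w.im) = 1 := by
            rw [hYdef, ← Real.exp_add, neg_add_cancel, Real.exp_zero]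
          have h9 : 3 ≤ Real.exp (2 * Real.pi * w.im) := by nlinarith
          nlinarith [mul_le_mul_of_nonneg_left h9 hY.le]
        rw [abs_of_nonpos (by linarith)]
        linarith
      · have h6 : 3 ≤ Y := by
          have h7 := Real.add_one_le_exp (-(2 * Real.pi * w.im))
          nlinarith
        rw [abs_of_nonneg (by linarith)]
        linarith
    have h9 : ‖w‖ ≤ 1 + |w.im| := by
      have := Complex.norm_le_abs_re_add_abs_im w
      linarith
    rw [← mul_exSlope, norm_mul] at h4
    calc min (c₀ / M) (1 / 2) * (1 + Y) ≤ 1 / 2 * (1 + Y) := by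
          exact mul_le_mul_of_nonneg_right (min_le_right _ _) (by positivity)
      _ ≤ ‖w‖ * ‖exSlope w‖ := by linarith
      _ ≤ ‖exSlope w‖ * (1 + |w.im|) := by
          rw [mul_comm]
          exact mul_le_mul_of_nonneg_left h9 (norm_nonneg _)

/-- The function `z ↦ (z - α) / (e^{2πiz} - e^{2πiα})`, holomorphic on `|Re (z - α)| < 1`. -/
def exQuot (α z : ℂ) : ℂ := (ex α * exSlope (z - α))⁻¹

theorem exQuot_ne_zero {α z : ℂ} (h : |(z - α).re| < 1) : exQuot α z ≠ 0 :=
  inv_ne_zero (mul_ne_zero (ex_ne_zero _) (exSlope_ne_zero h))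

theorem sub_mul_exQuot {α z : ℂ} (h : |(z - α).re| < 1) :
    (ex z - ex α) * exQuot α z = z - α := by
  have h1 : ex z = ex α * ex (z - α) := by rw [← ex_add]; congr 1; ring
  have h2 := mul_exSlope (z - α)
  have h3 := exSlope_ne_zero h
  have h4 := ex_ne_zero α
  rw [exQuot, ← div_eq_mul_inv, div_eq_iff (mul_ne_zero h4 h3), h1]
  linear_combination -ex α * h2

theorem abs_re_sub_lt {α z : ℂ} (hα : |α.re| < 1 / 2) (hz : |z.re| ≤ 1 / 2) :
    |(z - α).re| < 1 := by
  rw [Complex.sub_re]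
  have := abs_sub z.re α.re
  linarith

theorem differentiableAt_exQuot {α z : ℂ} (h : |(z - α).re| < 1) :
    DifferentiableAt ℂ (exQuot α) z := by
  refine DifferentiableAt.inv ?_ (mul_ne_zero (ex_ne_zero _) (exSlope_ne_zero h))
  exact (differentiable_exSlope.comp (differentiable_id.sub_const α)).differentiableAt.const_mul _

theorem exists_norm_exQuot_le {α : ℂ} (hα : |α.re| < 1 / 2) : ∃ C, 0 ≤ C ∧ ∀ z : ℂ, |z.re| ≤ 1 / 2 →
    ‖exQuot α z‖ ≤ C * ((1 + |z.im|) / (1 + Real.exp (-(2 * Real.pi * z.im)))) := by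
  obtain ⟨c, hc, h⟩ := exists_le_norm_exSlope (r := 1 / 2 + |α.re|) (by linarith)
  set a := ‖ex α‖ with ha
  have hapos : 0 < a := norm_pos_iff.mpr (ex_ne_zero α)
  refine ⟨(1 + |α.im|) * max 1 a / (a * c), by positivity, fun z hz => ?_⟩
  have h1 : |(z - α).re| < 1 := abs_re_sub_lt hα hz
  have h2 := h (z - α) (by
    rw [Complex.sub_re]
    have := abs_sub z.re α.re
    linarith)
  have hs : 0 < ‖exSlope (z - α)‖ := norm_pos_iff.mpr (exSlope_ne_zero h1)
  set Y := Real.exp (-(2 * Real.pi * z.im)) with hY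
  have hYpos : 0 < Y := Real.exp_pos _
  have h3 : Real.exp (-(2 * Real.pi * (z - α).im)) = Y / a := by
    rw [ha, norm_ex, hY, ← Real.exp_sub]
    congr 1
    rw [Complex.sub_im]
    ring
  rw [h3] at h2
  have h4 : 1 + |(z - α).im| ≤ (1 + |α.im|) * (1 + |z.im|) := by
    rw [Complex.sub_im]
    have := abs_sub z.im α.im
    nlinarith [abs_nonneg z.im, abs_nonneg α.im]
  -- Replacing `z - α` by `z` rescales the exponential by the constant `a = |e^{2πiα}|`.
  have h5 : 1 + Y ≤ max 1 a * (1 + Y / a) := by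
    have h6 : max 1 a * (Y / a) ≥ Y := by
      have : a * (Y / a) = Y := by field_simp
      calc Y = a * (Y / a) := this.symm
        _ ≤ _ := mul_le_mul_of_nonneg_right (le_max_right _ _) (by positivity)
    have := le_max_left 1 a
    linarith
  rw [exQuot, norm_inv, norm_mul, ← ha, inv_eq_one_div, div_le_iff₀ (by positivity)]
  have key : c * (1 + Y) ≤ max 1 a * (‖exSlope (z - α)‖ * ((1 + |α.im|) * (1 + |z.im|))) := by
    calc c * (1 + Y) ≤ c * (max 1 a * (1 + Y / a)) := mul_le_mul_of_nonneg_left h5 hc.le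
      _ = max 1 a * (c * (1 + Y / a)) := by ring
      _ ≤ max 1 a * (‖exSlope (z - α)‖ * (1 + |(z - α).im|)) :=
          mul_le_mul_of_nonneg_left h2 (by positivity)
      _ ≤ _ := by gcongr
  have h7 : 0 < c * (1 + Y) := by positivity
  calc (1 : ℝ) = c * (1 + Y) / (c * (1 + Y)) := (div_self h7.ne').symm
    _ ≤ max 1 a * (‖exSlope (z - α)‖ * ((1 + |α.im|) * (1 + |z.im|))) / (c * (1 + Y)) := by
        gcongr
    _ = _ := by field_simp

/-- The factor `i` absorbs the sign in `exSlope_neg_conj`; with it, mirror-image roots contribute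
conjugate factors on the imaginary axis. -/
theorem exQuot_neg_conj (α : ℂ) (x : ℝ) :
    Complex.I * exQuot (-(starRingEnd ℂ) α) (x * Complex.I)
      = (starRingEnd ℂ) (Complex.I * exQuot α (x * Complex.I)) := by
  have h : (x : ℂ) * Complex.I - -(starRingEnd ℂ) α = -(starRingEnd ℂ) (x * Complex.I - α) := by
    simp
    ring
  rw [exQuot, h, exSlope_neg_conj, ex_neg_conj, exQuot, map_mul, map_inv₀, map_mul, Complex.conj_I,
    mul_neg, inv_neg]
  ring

theorem exQuot_pos {α : ℂ} (hα : α.re = 0) (x : ℝ) :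
    ∃ r : ℝ, 0 < r ∧ Complex.I * exQuot α (x * Complex.I) = r := by
  have h : α = α.im * Complex.I := by
    apply Complex.ext <;> simp [hα]
  obtain ⟨r, hr, h1⟩ := exSlope_mul_I (x - α.im)
  refine ⟨(Real.exp (-(2 * Real.pi * α.im)) * r)⁻¹, by positivity, ?_⟩
  rw [exQuot]
  rw [show (x : ℂ) * Complex.I - α = ((x - α.im : ℝ) : ℂ) * Complex.I by
    conv_lhs => rw [h]
    push_cast
    ring, h1]
  conv_lhs => rw [h, ex_mul_I]
  push_cast
  have := Complex.I_ne_zero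
  field_simp

/-- A product over a multiset symmetric under `α ↦ -ᾱ` is positive, when the factors are
compatible with the symmetry. -/
theorem multiset_prod_pos {A : Multiset ℂ} (hA : A.map (fun α => -(starRingEnd ℂ) α) = A)
    {f : ℂ → ℂ} (h0 : ∀ α ∈ A, f α ≠ 0)
    (hconj : ∀ α, f (-(starRingEnd ℂ) α) = (starRingEnd ℂ) (f α))
    (hpos : ∀ α ∈ A, α.re = 0 → ∃ r : ℝ, 0 < r ∧ f α = r) :
    ∃ r : ℝ, 0 < r ∧ (A.map f).prod = r := by
  have hprod : ∀ (B : Multiset ℂ) (g : ℂ → ℂ), (∀ α ∈ B, ∃ r : ℝ, 0 < r ∧ g α = r) →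
      ∃ r : ℝ, 0 < r ∧ (B.map g).prod = r := by
    intro B g
    induction B using Multiset.induction_on with
    | empty => exact fun _ => ⟨1, one_pos, by simp⟩
    | cons b B ih =>
      intro h
      obtain ⟨r, hr, h1⟩ := ih fun α hα => h α (Multiset.mem_cons_of_mem hα)
      obtain ⟨s, hs, h2⟩ := h b (Multiset.mem_cons_self b B)
      exact ⟨s * r, mul_pos hs hr, by simp [h1, h2]⟩
  have hneg : A.filter (fun α => α.re < 0)
      = (A.filter (fun α => 0 < α.re)).map (fun α => -(starRingEnd ℂ) α) := by
    conv_lhs => rw [← hA]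
    rw [Multiset.filter_map]
    congr 1
    refine Multiset.filter_congr fun α _ => ?_
    simp
  have hsplit : A = A.filter (fun α => α.re = 0)
      + (A.filter (fun α => 0 < α.re) + A.filter (fun α => α.re < 0)) := by
    ext α
    simp only [Multiset.count_add, Multiset.count_filter]
    rcases lt_trichotomy α.re 0 with h | h | h
    · simp [h, h.ne, h.le]
    · simp [h]
    · simp [h, h.ne', h.le]
  rw [hsplit, Multiset.map_add, Multiset.map_add, Multiset.prod_add, Multiset.prod_add, hneg,
    Multiset.map_map, ← Multiset.prod_map_mul]
  obtain ⟨r, hr, h1⟩ := hprod (A.filter (fun α => α.re = 0)) f fun α hα =>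
    hpos α (Multiset.mem_filter.mp hα).1 (Multiset.mem_filter.mp hα).2
  -- A root off the imaginary axis and its mirror image together contribute `|f α|²`.
  obtain ⟨s, hs, h2⟩ := hprod (A.filter (fun α => 0 < α.re))
    (fun α => f α * (f ∘ fun α => -(starRingEnd ℂ) α) α) fun α hα => by
      refine ⟨Complex.normSq (f α), Complex.normSq_pos.mpr (h0 α (Multiset.mem_filter.mp hα).1), ?_⟩
      rw [Function.comp_apply, hconj, Complex.mul_conj]
  exact ⟨r * s, mul_pos hr hs, by rw [h1, h2]; push_cast; rfl⟩

/-! ### Weight functions and their decay -/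

/-- The holomorphic function `e^{2πiκz} g(-e^{2πiz}) ∏ (z - α) / (e^{2πiz} - e^{2πiα})`. -/
def wtHol (A : Multiset ℂ) (κ : ℝ) (g : ℂ[X]) (z : ℂ) : ℂ :=
  ex (κ * z) * g.eval (-ex z) * (A.map fun α => exQuot α z).prod

/-- The weight function `e^{2πiκz} g(e^{2πiz}) / ∏ (e^{2πiz} + e^{2πiα})` at `z = ix`. -/
def wt (A : Multiset ℂ) (κ : ℝ) (g : ℂ[X]) (x : ℝ) : ℂ :=
  ex (κ * (x * Complex.I)) * g.eval (ex (x * Complex.I)) /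
    (A.map fun α => ex (x * Complex.I) + ex α).prod

section
variable {A : Multiset ℂ} (hA : ∀ α ∈ A, |α.re| < 1 / 2)
include hA

theorem prod_sub_mul_exQuot {z : ℂ} (hz : |z.re| ≤ 1 / 2) :
    (A.map fun α => z - α).prod
      = (A.map fun α => ex z - ex α).prod * (A.map fun α => exQuot α z).prod := by
  rw [← Multiset.prod_map_mul]
  congr 1
  exact Multiset.map_congr rfl fun α hα => (sub_mul_exQuot (abs_re_sub_lt (hA α hα) hz)).symm

/-- A zero would force `e^{2πi(ix - 1/2)} = e^{2πiα}`, hence `α = ix - 1/2` inside the strip,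
against `|Re α| < 1/2`. Thus the weight has no pole on the line of integration. -/
theorem prod_ex_add_ne_zero (x : ℝ) : (A.map fun α => ex (x * Complex.I) + ex α).prod ≠ 0 := by
  refine Multiset.prod_ne_zero fun h => ?_
  obtain ⟨α, hα, h0⟩ := Multiset.mem_map.mp h
  have h1 := sub_mul_exQuot (z := x * Complex.I - 1 / 2) (abs_re_sub_lt (hA α hα) (by simp))
  rw [ex_sub_half, ← neg_add', h0, neg_zero, zero_mul] at h1
  have h2 := congrArg Complex.re h1
  have h3 := abs_lt.mp (hA α hα)
  simp at h2
  linarith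

/-- Moving by `s = ±1/2` changes the sign of `e^{2πiz}`, so the denominator of the weight becomes,
up to sign, `∏ (e^{2πiz} - e^{2πiα})`, whose zeros in the strip are cancelled by `∏ (z - α)`. This
makes `wtHol` the common continuation of the weight times the product from both edges. -/
theorem wt_mul_prod_aux {x : ℝ} {s : ℂ} (hs : ex s = -1) (hs' : |s.re| ≤ 1 / 2) (κ : ℝ)
    (g : ℂ[X]) : wt A κ g x * (A.map fun α => x * Complex.I + s - α).prod
      = (-1) ^ A.card * ex (-(κ * s)) * wtHol A κ g (x * Complex.I + s) := by
  have hex : ex (x * Complex.I + s) = -ex (x * Complex.I) := by rw [ex_add, hs, mul_neg_one]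
  have h1 : (A.map fun α => ex (x * Complex.I + s) - ex α).prod
      = (-1) ^ A.card * (A.map fun α => ex (x * Complex.I) + ex α).prod := by
    rw [hex, ← Multiset.card_map (fun α => ex (x * Complex.I) + ex α) A, ← Multiset.prod_map_neg,
      Multiset.map_map]
    congr 1
    exact Multiset.map_congr rfl fun α _ => by simp [sub_eq_add_neg, add_comm]
  have h2 : ex (κ * (x * Complex.I)) = ex (-(κ * s)) * ex (κ * (x * Complex.I + s)) := by
    rw [← ex_add]
    congr 1
    ring
  have h0 := prod_ex_add_ne_zero hA x
  rw [prod_sub_mul_exQuot hA (by simpa using hs'), h1, wt, wtHol, hex, neg_neg, h2]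
  field_simp

theorem wt_mul_prod_left (x : ℝ) (κ : ℝ) (g : ℂ[X]) :
    wt A κ g x * (A.map fun α => x * Complex.I - 1 / 2 - α).prod
      = (-1) ^ A.card * ex (κ / 2) * wtHol A κ g (x * Complex.I - 1 / 2) := by
  have h := wt_mul_prod_aux hA (x := x) ex_neg_half (by norm_num) κ g
  rw [← sub_eq_add_neg] at h
  rw [h]
  congr 3
  ring

theorem wt_mul_prod_right (x : ℝ) (κ : ℝ) (g : ℂ[X]) :
    wt A κ g x * (A.map fun α => x * Complex.I + 1 / 2 - α).prod
      = (-1) ^ A.card * ex (-(κ / 2)) * wtHol A κ g (x * Complex.I + 1 / 2) := by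
  rw [wt_mul_prod_aux hA (x := x) ex_half (by norm_num) κ g]
  congr 3
  ring

theorem differentiableOn_wtHol (κ : ℝ) (g : ℂ[X]) :
    DifferentiableOn ℂ (wtHol A κ g) {z | z.re ∈ Set.Icc (-(1 / 2)) (1 / 2)} := by
  intro z hz
  have hz' : |z.re| ≤ 1 / 2 := abs_le.mpr hz
  refine DifferentiableAt.differentiableWithinAt ?_
  have hp : DifferentiableAt ℂ (fun z => (A.map fun α => exQuot α z).prod) z := by
    have hA' : ∀ α ∈ A, DifferentiableAt ℂ (exQuot α) z := fun α hα =>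
      differentiableAt_exQuot (abs_re_sub_lt (hA α hα) hz')
    clear hA
    induction A using Multiset.induction_on with
    | empty => simp
    | cons a A ih =>
      simp only [Multiset.map_cons, Multiset.prod_cons]
      exact (hA' a (Multiset.mem_cons_self a A)).mul
        (ih fun α hα => hA' α (Multiset.mem_cons_of_mem hα))
  refine DifferentiableAt.mul (DifferentiableAt.mul ?_ ?_) hp
  · exact (differentiable_ex.comp (differentiable_id.const_mul _)).differentiableAt
  · exact (g.differentiable.comp differentiable_ex.neg).differentiableAt

theorem exists_norm_prod_exQuot_le : ∃ C, 0 ≤ C ∧ ∀ z : ℂ, |z.re| ≤ 1 / 2 →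
    ‖(A.map fun α => exQuot α z).prod‖
      ≤ C * ((1 + |z.im|) / (1 + Real.exp (-(2 * Real.pi * z.im)))) ^ A.card := by
  induction A using Multiset.induction_on with
  | empty => exact ⟨1, zero_le_one, by simp⟩
  | cons a A ih =>
    obtain ⟨C, hC, h⟩ := ih fun α hα => hA α (Multiset.mem_cons_of_mem hα)
    obtain ⟨D, hD, h'⟩ := exists_norm_exQuot_le (hA a (Multiset.mem_cons_self a A))
    refine ⟨D * C, mul_nonneg hD hC, fun z hz => ?_⟩
    rw [Multiset.map_cons, Multiset.prod_cons, norm_mul, Multiset.card_cons, pow_succ]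
    refine (mul_le_mul (h' z hz) (h z hz) (norm_nonneg _) (by positivity)).trans_eq ?_
    ring

/-- On the left edge the real parts of `z` and `α` differ by at least `1/2 - |Re α|`. This lets
bounds on `wtHol` pass to `wt` by division. -/
theorem exists_le_norm_prod_sub : ∃ c, 0 < c ∧ ∀ x : ℝ,
    c ≤ ‖(A.map fun α => x * Complex.I - 1 / 2 - α).prod‖ := by
  induction A using Multiset.induction_on with
  | empty => exact ⟨1, one_pos, by simp⟩
  | cons a A ih =>
    obtain ⟨C, hC, h⟩ := ih fun α hα => hA α (Multiset.mem_cons_of_mem hα)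
    have ha := hA a (Multiset.mem_cons_self a A)
    refine ⟨(1 / 2 - |a.re|) * C, mul_pos (by linarith) hC, fun x => ?_⟩
    rw [Multiset.map_cons, Multiset.prod_cons, norm_mul]
    refine mul_le_mul ?_ (h x) hC.le (norm_nonneg _)
    refine le_trans ?_ (Complex.abs_re_le_norm _)
    refine le_trans ?_ (neg_le_abs _)
    simp
    linarith [neg_abs_le a.re]

end

theorem exists_norm_eval_le (S : ℂ[X]) {b : ℝ} (hb : 0 < b) : ∃ C, 0 ≤ C ∧ ∀ z : ℂ,
    |z.re| ≤ 1 / 2 → ‖S.eval z‖ ≤ C * Real.exp (b * |z.im|) := by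
  induction S using Polynomial.induction_on' with
  | add p q hp hq =>
    obtain ⟨C, hC, h1⟩ := hp
    obtain ⟨D, hD, h2⟩ := hq
    refine ⟨C + D, add_nonneg hC hD, fun z hz => ?_⟩
    rw [Polynomial.eval_add, add_mul]
    exact (norm_add_le _ _).trans (add_le_add (h1 z hz) (h2 z hz))
  | monomial n a =>
    obtain ⟨C, hC, h⟩ := abs_eval_le_exp ((1 + Polynomial.X) ^ n) hb
    refine ⟨‖a‖ * C, by positivity, fun z hz => ?_⟩
    rw [Polynomial.eval_monomial, norm_mul, norm_pow, mul_assoc]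
    refine mul_le_mul_of_nonneg_left ?_ (norm_nonneg a)
    have h1 := h |z.im|
    rw [abs_abs] at h1
    refine le_trans ?_ ((le_abs_self _).trans h1)
    simp only [Polynomial.eval_pow, Polynomial.eval_add, Polynomial.eval_one, Polynomial.eval_X]
    refine pow_le_pow_left₀ (norm_nonneg z) ?_ n
    have := Complex.norm_le_abs_re_add_abs_im z
    linarith

theorem norm_eval_le_mul_pow (g : ℂ[X]) : ∃ C, 0 ≤ C ∧ ∀ z : ℂ,
    ‖g.eval z‖ ≤ C * (1 + ‖z‖) ^ g.natDegree := by
  refine ⟨∑ i ∈ Finset.range (g.natDegree + 1), ‖g.coeff i‖, by positivity, fun z => ?_⟩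
  rw [Polynomial.eval_eq_sum_range, Finset.sum_mul]
  refine (norm_sum_le _ _).trans (Finset.sum_le_sum fun i hi => ?_)
  rw [norm_mul, norm_pow]
  refine mul_le_mul_of_nonneg_left ?_ (norm_nonneg _)
  have h0 := norm_nonneg z
  calc ‖z‖ ^ i ≤ (1 + ‖z‖) ^ i := pow_le_pow_left₀ h0 (by linarith) i
    _ ≤ _ := pow_le_pow_right₀ (by linarith) (Nat.lt_succ_iff.mp (Finset.mem_range.mp hi))

/-- The decay rate is `κ` as `y → ∞`, where `e^{-2πy}` is negligible, and `n - d - κ` as `y → -∞`,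
where it dominates. Both are positive exactly when `0 < κ < n - d`. -/
theorem exp_mul_pow_div_pow_le {κ : ℝ} {d n : ℕ} (hκ : 0 < κ) (h : κ + d < n) (y : ℝ) :
    Real.exp (-(2 * Real.pi * (κ * y))) * (1 + Real.exp (-(2 * Real.pi * y))) ^ d
        / (1 + Real.exp (-(2 * Real.pi * y))) ^ n
      ≤ Real.exp (-(2 * Real.pi * min κ (n - d - κ) * |y|)) := by
  have hdn : d ≤ n := by
    have : (d : ℝ) < n := by linarith
    exact_mod_cast this.le
  obtain ⟨q, rfl⟩ := Nat.exists_eq_add_of_le hdn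
  set Y := Real.exp (-(2 * Real.pi * y)) with hY
  have hYpos : 0 < Y := Real.exp_pos _
  have hpi := Real.pi_pos
  have e1 : Real.exp (-(2 * Real.pi * (κ * y))) * (1 + Y) ^ d / (1 + Y) ^ (d + q)
      = Real.exp (-(2 * Real.pi * (κ * y))) / (1 + Y) ^ q := by
    rw [pow_add]
    field_simp
  rw [e1, div_le_iff₀ (by positivity)]
  push_cast at h ⊢
  have hm1 := min_le_left κ ((d : ℝ) + q - d - κ)
  have hm2 := min_le_right κ ((d : ℝ) + q - d - κ)
  set μ := min κ ((d : ℝ) + q - d - κ)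
  rcases le_total 0 y with hy | hy
  · rw [abs_of_nonneg hy]
    calc Real.exp (-(2 * Real.pi * (κ * y))) ≤ Real.exp (-(2 * Real.pi * μ * y)) * 1 := by
          rw [mul_one]
          refine Real.exp_le_exp.mpr (neg_le_neg ?_)
          rw [mul_assoc]
          gcongr
      _ ≤ _ := mul_le_mul_of_nonneg_left (one_le_pow₀ (by linarith)) (Real.exp_nonneg _)
  · rw [abs_of_nonpos hy]
    calc Real.exp (-(2 * Real.pi * (κ * y))) ≤ Real.exp (-(2 * Real.pi * μ * -y)) * Y ^ q := by
          rw [hY, ← Real.exp_nat_mul, ← Real.exp_add]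
          refine Real.exp_le_exp.mpr ?_
          nlinarith [mul_nonneg (mul_nonneg hpi.le (neg_nonneg.mpr hy)) (sub_nonneg.mpr hm2)]
      _ ≤ _ := mul_le_mul_of_nonneg_left (pow_le_pow_left₀ hYpos.le (by linarith) q)
          (Real.exp_nonneg _)

section
variable {A : Multiset ℂ} (hA : ∀ α ∈ A, |α.re| < 1 / 2) {κ : ℝ} (hκ : 0 < κ) {m : ℕ}
  (hm : κ + m < A.card + 1)
include hA hκ hm

theorem exists_norm_eval_mul_wtHol_le {g : ℂ[X]} (hg : g.degree < m) (S : ℂ[X]) :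
    ∃ C δ, 0 < δ ∧ ∀ z : ℂ, |z.re| ≤ 1 / 2 →
      ‖S.eval z * wtHol A κ g z‖ ≤ C * Real.exp (-(δ * |z.im|)) := by
  rcases eq_or_ne g 0 with rfl | hg0
  · exact ⟨0, 1, one_pos, by simp [wtHol]⟩
  -- The `+ 1` in `hm` is used up by the strict bound `deg g < m`.
  have hd : κ + g.natDegree < A.card := by
    have h1 := (Polynomial.natDegree_lt_iff_degree_lt hg0).mpr hg
    have h2 : (g.natDegree : ℝ) + 1 ≤ m := by exact_mod_cast h1
    linarith
  obtain ⟨C₁, hC₁, h₁⟩ := exists_norm_prod_exQuot_le hA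
  obtain ⟨C₂, hC₂, h₂⟩ := norm_eval_le_mul_pow g
  set μ := 2 * Real.pi * min κ (A.card - g.natDegree - κ) with hμ
  have hμpos : 0 < μ := by
    have : 0 < min κ (A.card - g.natDegree - κ) := lt_min hκ (by linarith)
    positivity
  obtain ⟨C₃, hC₃, h₃⟩ := exists_norm_eval_le S (show 0 < μ / 4 by positivity)
  obtain ⟨C₄, hC₄, h₄⟩ := abs_eval_le_exp ((1 + Polynomial.X) ^ A.card) (show 0 < μ / 4 by positivity)
  -- Of the decay rate `μ`, a quarter is spent on `S` and a quarter on the powers of `1 + |Im z|`.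
  refine ⟨C₃ * (C₂ * (C₁ * C₄)), μ / 2, by positivity, fun z hz => ?_⟩
  have k1 := h₁ z hz
  have k2 := h₂ (-ex z)
  rw [norm_neg, norm_ex] at k2
  have k3 := h₃ z hz
  have k4 := h₄ |z.im|
  rw [abs_abs] at k4
  have k4' : (1 + |z.im|) ^ A.card ≤ C₄ * Real.exp (μ / 4 * |z.im|) := by
    refine le_trans ?_ ((le_abs_self _).trans k4)
    simp
  have k5 := exp_mul_pow_div_pow_le hκ hd z.im
  rw [← hμ] at k5
  have k6 : ‖ex (κ * z)‖ = Real.exp (-(2 * Real.pi * (κ * z.im))) := by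
    rw [norm_ex]
    simp
  rw [wtHol, norm_mul, norm_mul, norm_mul, k6]
  set Y := Real.exp (-(2 * Real.pi * z.im))
  have hY : 0 < Y := Real.exp_pos _
  calc ‖S.eval z‖ * (Real.exp (-(2 * Real.pi * (κ * z.im))) * ‖g.eval (-ex z)‖ *
        ‖(A.map fun α => exQuot α z).prod‖)
      ≤ (C₃ * Real.exp (μ / 4 * |z.im|)) * (Real.exp (-(2 * Real.pi * (κ * z.im))) *
        (C₂ * (1 + Y) ^ g.natDegree) * (C₁ * ((1 + |z.im|) / (1 + Y)) ^ A.card)) := by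
        gcongr
    _ = C₃ * C₂ * C₁ * Real.exp (μ / 4 * |z.im|) * ((1 + |z.im|) ^ A.card *
        (Real.exp (-(2 * Real.pi * (κ * z.im))) * (1 + Y) ^ g.natDegree / (1 + Y) ^ A.card)) := by
        rw [div_pow]
        field_simp
    _ ≤ C₃ * C₂ * C₁ * Real.exp (μ / 4 * |z.im|) * ((C₄ * Real.exp (μ / 4 * |z.im|)) *
        Real.exp (-(μ * |z.im|))) := by
        gcongr
    _ = C₃ * (C₂ * (C₁ * C₄)) *
        (Real.exp (μ / 4 * |z.im|) * Real.exp (μ / 4 * |z.im|) * Real.exp (-(μ * |z.im|))) := by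
        ring
    _ = _ := by
        rw [← Real.exp_add, ← Real.exp_add]
        congr 2
        ring

omit hκ hm in
theorem continuous_wt (g : ℂ[X]) : Continuous (wt A κ g) := by
  unfold wt
  have h1 : Continuous ex := differentiable_ex.continuous
  refine Continuous.div ?_ ?_ (prod_ex_add_ne_zero hA)
  · exact (h1.comp (by fun_prop)).mul (g.continuous.comp (h1.comp (by fun_prop)))
  · have h2 : ∀ α ∈ A, Continuous fun x : ℝ => ex (x * Complex.I) + ex α := fun α _ =>
      (h1.comp (by fun_prop)).add continuous_const
    exact continuous_multiset_prod A h2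

theorem exists_norm_eval_mul_wt_le {g : ℂ[X]} (hg : g.degree < m) (S : ℂ[X]) :
    ∃ C δ, 0 < δ ∧ ∀ x : ℝ,
      ‖S.eval (x * Complex.I) * wt A κ g x‖ ≤ C * Real.exp (-(δ * |x|)) := by
  obtain ⟨C, δ, hδ, h⟩ := exists_norm_eval_mul_wtHol_le hA hκ hm hg
    (S.comp (Polynomial.X + Polynomial.C (1 / 2)))
  obtain ⟨c, hc, h'⟩ := exists_le_norm_prod_sub hA
  refine ⟨‖ex (κ / 2)‖ * C / c, δ, hδ, fun x => ?_⟩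
  have h1 := h (x * Complex.I - 1 / 2) (by simp)
  have h2 := congrArg norm (wt_mul_prod_left hA x κ g)
  simp only [Polynomial.eval_comp, Polynomial.eval_add, Polynomial.eval_X, Polynomial.eval_C,
    sub_add_cancel] at h1
  rw [norm_mul, norm_mul, norm_mul, norm_pow, norm_neg, norm_one, one_pow, one_mul] at h2
  rw [div_mul_eq_mul_div, le_div_iff₀ hc, norm_mul]
  simp only [norm_mul, Complex.sub_im, Complex.mul_im, Complex.ofReal_re, Complex.I_im,
    Complex.ofReal_im, Complex.I_re] at h1
  norm_num at h1
  calc ‖S.eval (x * Complex.I)‖ * ‖wt A κ g x‖ * c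
      ≤ ‖S.eval (x * Complex.I)‖ * ‖wt A κ g x‖ *
          ‖(A.map fun α => x * Complex.I - 1 / 2 - α).prod‖ := by
        gcongr
        exact h' x
    _ = ‖ex (κ / 2)‖ * (‖S.eval (x * Complex.I)‖ * ‖wtHol A κ g (x * Complex.I - 1 / 2)‖) := by
        rw [mul_assoc, h2]
        ring
    _ ≤ ‖ex (κ / 2)‖ * (C * Real.exp (-(δ * |x|))) := by
        gcongr
    _ = _ := by ring

theorem integrable_eval_mul_wt {g : ℂ[X]} (hg : g.degree < m) (S : ℂ[X]) :
    Integrable fun x : ℝ => S.eval (x * Complex.I) * wt A κ g x := by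
  obtain ⟨C, δ, hδ, h⟩ := exists_norm_eval_mul_wt_le hA hκ hm hg S
  refine ((integrable_exp_neg_mul_abs hδ).const_mul C).mono' ?_ (Filter.Eventually.of_forall h)
  exact (Continuous.mul (S.continuous.comp (by fun_prop))
    (continuous_wt hA g)).aestronglyMeasurable

theorem integrable_eval_mul_wtHol {g : ℂ[X]} (hg : g.degree < m) (S : ℂ[X]) :
    Integrable fun x : ℝ => S.eval (x * Complex.I) * wtHol A κ g (x * Complex.I) := by
  obtain ⟨C, δ, hδ, h⟩ := exists_norm_eval_mul_wtHol_le hA hκ hm hg S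
  refine ((integrable_exp_neg_mul_abs hδ).const_mul C).mono' ?_
    (Filter.Eventually.of_forall fun x => ?_)
  · refine (Continuous.mul (S.continuous.comp (by fun_prop)) ?_).aestronglyMeasurable
    exact (differentiableOn_wtHol hA κ g).continuousOn.comp_continuous (by fun_prop) (by simp)
  · simpa using h (x * Complex.I) (by simp)

end

/-! ### Trace functionals defined by weights -/

theorem wt_add (A : Multiset ℂ) (κ : ℝ) (g h : ℂ[X]) (x : ℝ) :
    wt A κ (g + h) x = wt A κ g x + wt A κ h x := by
  simp only [wt, Polynomial.eval_add]
  ring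

theorem wt_smul (A : Multiset ℂ) (κ : ℝ) (r : ℂ) (g : ℂ[X]) (x : ℝ) :
    wt A κ (r • g) x = r * wt A κ g x := by
  simp only [wt, Polynomial.eval_smul, smul_eq_mul]
  ring

/-- The functional `R ↦ ∫ R(ix) w_g(x) dx`, linear in `g` and `R`. -/
def traceForm {A : Multiset ℂ} (hA : ∀ α ∈ A, |α.re| < 1 / 2) {κ : ℝ} (hκ : 0 < κ) {m : ℕ}
    (hm : κ + m < A.card + 1) : Polynomial.degreeLT ℂ m →ₗ[ℂ] ℂ[X] →ₗ[ℂ] ℂ :=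
  LinearMap.mk₂ ℂ (fun g R => ∫ x : ℝ, R.eval (x * Complex.I) * wt A κ (g : ℂ[X]) x)
    (fun g h R => by
      rw [← integral_add (integrable_eval_mul_wt hA hκ hm (Polynomial.mem_degreeLT.mp g.2) R)
        (integrable_eval_mul_wt hA hκ hm (Polynomial.mem_degreeLT.mp h.2) R)]
      simp only [Submodule.coe_add, wt_add, mul_add])
    (fun c g R => by
      rw [smul_eq_mul, ← integral_const_mul]
      simp only [Submodule.coe_smul, wt_smul, mul_left_comm])
    (fun g R S => by
      rw [← integral_add (integrable_eval_mul_wt hA hκ hm (Polynomial.mem_degreeLT.mp g.2) R)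
        (integrable_eval_mul_wt hA hκ hm (Polynomial.mem_degreeLT.mp g.2) S)]
      simp only [Polynomial.eval_add, add_mul])
    (fun c g R => by
      rw [smul_eq_mul, ← integral_const_mul]
      simp only [Polynomial.eval_smul, smul_eq_mul, mul_assoc])

theorem Monic_eval_eq {P : ℂ[X]} (hP : P.Monic) (z : ℂ) :
    P.eval z = (P.roots.map fun α => z - α).prod :=
  (IsAlgClosed.splits P).eval_eq_prod_roots_of_monic hP z

section
variable {P : ℂ[X]} (hP : P.Monic) (hA : ∀ α ∈ P.roots, |α.re| < 1 / 2) {κ : ℝ} (hκ : 0 < κ)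
  {m : ℕ} (hm : κ + m < P.roots.card + 1)
include hP

/-- The polynomial `P(ix - 1/2)` turns the weight into `wtHol` on the left edge of the strip, and
the contour is moved from there to the imaginary axis. The right edge gives the same integral; only
the prefactor changes, by `e^{2πiκ}`. -/
theorem traceForm_comp_sub (g : Polynomial.degreeLT ℂ m) (S : ℂ[X]) :
    traceForm hA hκ hm g ((P * S).comp (Polynomial.X - Polynomial.C (1 / 2)))
      = (-1) ^ P.roots.card * ex (κ / 2) *
        ∫ x : ℝ, S.eval (x * Complex.I) * wtHol P.roots κ (g : ℂ[X]) (x * Complex.I) := by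
  obtain ⟨C, δ, hδ, hb⟩ := exists_norm_eval_mul_wtHol_le hA hκ hm
    (Polynomial.mem_degreeLT.mp g.2) S
  have hshift := integral_vertical_line_eq (F := fun z => S.eval z * wtHol P.roots κ (g : ℂ[X]) z)
    hδ (S.differentiable.differentiableOn.mul (differentiableOn_wtHol hA κ (g : ℂ[X])))
    (fun z hz => hb z (abs_le.mpr hz)) (a := 0) (b := -(1 / 2)) (by norm_num) (by norm_num)
  simp only [Complex.ofReal_zero, zero_add] at hshift
  rw [hshift, ← integral_const_mul]
  refine integral_congr_ae (Filter.Eventually.of_forall fun x => ?_)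
  have h := wt_mul_prod_left hA x κ (g : ℂ[X])
  rw [← Monic_eval_eq hP] at h
  have e : ((-(1 / 2) : ℝ) : ℂ) + x * Complex.I = x * Complex.I - 1 / 2 := by
    push_cast
    ring
  simp only [Polynomial.eval_comp, Polynomial.eval_sub, Polynomial.eval_X, Polynomial.eval_C,
    Polynomial.eval_mul, e]
  linear_combination S.eval (x * Complex.I - 1 / 2) * h

theorem traceForm_comp_add (g : Polynomial.degreeLT ℂ m) (S : ℂ[X]) :
    traceForm hA hκ hm g ((P * S).comp (Polynomial.X + Polynomial.C (1 / 2)))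
      = (-1) ^ P.roots.card * ex (-(κ / 2)) *
        ∫ x : ℝ, S.eval (x * Complex.I) * wtHol P.roots κ (g : ℂ[X]) (x * Complex.I) := by
  obtain ⟨C, δ, hδ, hb⟩ := exists_norm_eval_mul_wtHol_le hA hκ hm
    (Polynomial.mem_degreeLT.mp g.2) S
  have hshift := integral_vertical_line_eq (F := fun z => S.eval z * wtHol P.roots κ (g : ℂ[X]) z)
    hδ (S.differentiable.differentiableOn.mul (differentiableOn_wtHol hA κ (g : ℂ[X])))
    (fun z hz => hb z (abs_le.mpr hz)) (a := 0) (b := 1 / 2) (by norm_num) (by norm_num)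
  simp only [Complex.ofReal_zero, zero_add] at hshift
  rw [hshift, ← integral_const_mul]
  refine integral_congr_ae (Filter.Eventually.of_forall fun x => ?_)
  have h := wt_mul_prod_right hA x κ (g : ℂ[X])
  rw [← Monic_eval_eq hP] at h
  have e : ((1 / 2 : ℝ) : ℂ) + x * Complex.I = x * Complex.I + 1 / 2 := by
    push_cast
    ring
  simp only [Polynomial.eval_comp, Polynomial.eval_add, Polynomial.eval_X, Polynomial.eval_C,
    Polynomial.eval_mul, e]
  linear_combination S.eval (x * Complex.I + 1 / 2) * h

/-- The trace identity satisfied by the functionals `traceForm`. -/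
theorem traceForm_shift (g : Polynomial.degreeLT ℂ m) (S : ℂ[X]) :
    traceForm hA hκ hm g ((P * S).comp (Polynomial.X - Polynomial.C (1 / 2)))
      = ex κ * traceForm hA hκ hm g ((P * S).comp (Polynomial.X + Polynomial.C (1 / 2))) := by
  rw [traceForm_comp_sub hP, traceForm_comp_add hP]
  have : ex κ * ex (-(κ / 2)) = ex (κ / 2) := by
    rw [← ex_add]
    congr 1
    ring
  rw [← this]
  ring

end

/-! ### Positivity of weights on the imaginary axis -/

/-- The real criterion applies to `Re f`, and to both `Im f` and `-Im f`. -/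
theorem nonneg_of_integral_sq_mul_nonneg_complex {f : ℝ → ℂ} (hc : Continuous f) {C δ : ℝ}
    (hδ : 0 < δ) (hb : ∀ x, ‖f x‖ ≤ C * Real.exp (-(δ * |x|)))
    (h : ∀ p : ℝ[X], 0 ≤ (∫ x, ((p.eval x : ℝ) : ℂ) ^ 2 * f x).re ∧
      (∫ x, ((p.eval x : ℝ) : ℂ) ^ 2 * f x).im = 0) (x : ℝ) : 0 ≤ (f x).re ∧ (f x).im = 0 := by
  have hint : ∀ p : ℝ[X], Integrable fun x => ((p.eval x : ℝ) : ℂ) ^ 2 * f x := by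
    intro p
    obtain ⟨D, hD, h'⟩ := abs_eval_le_exp (p ^ 2) (half_pos hδ)
    refine ((integrable_exp_neg_mul_abs (half_pos hδ)).const_mul (D * C)).mono'
      (Continuous.aestronglyMeasurable (by fun_prop)) (Filter.Eventually.of_forall fun x => ?_)
    have h1 := h' x
    rw [Polynomial.eval_pow, abs_pow] at h1
    rw [norm_mul, norm_pow, Complex.norm_real, Real.norm_eq_abs]
    refine (mul_le_mul h1 (hb x) (norm_nonneg _) (by positivity)).trans_eq ?_
    rw [mul_mul_mul_comm, ← Real.exp_add]
    congr 2
    ring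
  have hre : ∀ p : ℝ[X], ∫ x, p.eval x ^ 2 * (f x).re
      = (∫ x, ((p.eval x : ℝ) : ℂ) ^ 2 * f x).re := by
    intro p
    have := Complex.reCLM.integral_comp_comm (hint p)
    simp only [Complex.reCLM_apply] at this
    rw [← this]
    congr 1
    ext x
    rw [← Complex.ofReal_pow, Complex.re_ofReal_mul]
  have him : ∀ p : ℝ[X], ∫ x, p.eval x ^ 2 * (f x).im
      = (∫ x, ((p.eval x : ℝ) : ℂ) ^ 2 * f x).im := by
    intro p
    have := Complex.imCLM.integral_comp_comm (hint p)
    simp only [Complex.imCLM_apply] at this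
    rw [← this]
    congr 1
    ext x
    rw [← Complex.ofReal_pow, Complex.im_ofReal_mul]
  refine ⟨nonneg_of_integral_sq_mul_nonneg (h := fun x => (f x).re) (by fun_prop) hδ
    (fun x => (Complex.abs_re_le_norm _).trans (hb x)) (fun p => by rw [hre]; exact (h p).1) x,
    le_antisymm ?_ ?_⟩
  · have := nonneg_of_integral_sq_mul_nonneg (h := fun x => -(f x).im) (by fun_prop) hδ
      (fun x => by rw [abs_neg]; exact (Complex.abs_im_le_norm _).trans (hb x))
      (fun p => by simp only [mul_neg]; rw [integral_neg, him, (h p).2, neg_zero]) x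
    linarith
  · exact nonneg_of_integral_sq_mul_nonneg (h := fun x => (f x).im) (by fun_prop) hδ
      (fun x => (Complex.abs_im_le_norm _).trans (hb x)) (fun p => by rw [him, (h p).2]) x

theorem integral_pos_of_zeros_finite {f : ℝ → ℂ} (hc : Continuous f) (hi : Integrable f)
    (h : ∀ x, 0 ≤ (f x).re) (hfin : {x | (f x).re = 0}.Finite) : 0 < (∫ x, f x).re := by
  have hre := Complex.reCLM.integral_comp_comm hi
  simp only [Complex.reCLM_apply] at hre
  rw [← hre]
  have h0 : 0 ≤ ∫ x, (f x).re := integral_nonneg h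
  refine lt_of_le_of_ne h0 fun he => ?_
  have h1 := (integral_eq_zero_iff_of_nonneg h hi.re).mp he.symm
  have hcre : Continuous fun x => (f x).re := by fun_prop
  have h2 := (hcre.ae_eq_iff_eq volume continuous_const).mp h1
  refine Set.infinite_univ (hfin.subset fun x _ => ?_)
  exact congrFun h2 x

/-- The polynomial `R̄(-x)`. -/
def sharp (R : ℂ[X]) : ℂ[X] := (R.map (starRingEnd ℂ)).comp (-Polynomial.X)

theorem sharp_eval (R : ℂ[X]) (z : ℂ) :
    (sharp R).eval z = (starRingEnd ℂ) (R.eval (-(starRingEnd ℂ) z)) := by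
  rw [sharp, Polynomial.eval_comp, Polynomial.eval_neg, Polynomial.eval_X]
  have := Polynomial.eval_map_apply (f := starRingEnd ℂ) (p := R) (-(starRingEnd ℂ) z)
  rw [← this]
  simp

theorem sharp_eval_mul_I (R : ℂ[X]) (x : ℝ) :
    (sharp R).eval (x * Complex.I) = (starRingEnd ℂ) (R.eval (x * Complex.I)) := by
  rw [sharp_eval]
  simp

/-- The imaginary axis is fixed pointwise by `z ↦ -z̄`, so `sharp` conjugates values there. This is
what turns `τ(R · sharp R)` into a weighted integral of `|R|²`. -/
theorem eval_mul_sharp_mul_I (R : ℂ[X]) (x : ℝ) :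
    (R * sharp R).eval (x * Complex.I) = Complex.normSq (R.eval (x * Complex.I)) := by
  rw [Polynomial.eval_mul, sharp_eval_mul_I, Complex.mul_conj]

theorem exists_eval_mul_I (p : ℝ[X]) : ∃ R : ℂ[X], ∀ x : ℝ, R.eval (x * Complex.I) = p.eval x := by
  refine ⟨(p.map Complex.ofRealHom).comp (Polynomial.C (-Complex.I) * Polynomial.X), fun x => ?_⟩
  have h : -Complex.I * (x * Complex.I) = x := by linear_combination -(x : ℂ) * Complex.I_mul_I
  rw [Polynomial.eval_comp, Polynomial.eval_mul, Polynomial.eval_C, Polynomial.eval_X, h]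
  exact Polynomial.eval_map_apply (f := Complex.ofRealHom) x

theorem finite_eval_mul_I_eq_zero {R : ℂ[X]} (hR : R ≠ 0) :
    {x : ℝ | R.eval (x * Complex.I) = 0}.Finite := by
  refine Set.Finite.of_finite_image ((Polynomial.finite_setOfPred_isRoot hR).subset ?_)
    (f := fun x : ℝ => (x : ℂ) * Complex.I) ?_
  · rintro _ ⟨x, hx, rfl⟩
    exact hx
  · intro x _ y _ hxy
    exact_mod_cast mul_right_cancel₀ Complex.I_ne_zero hxy

theorem finite_eval_exp_eq_zero {g : ℂ[X]} (hg : g ≠ 0) {s : ℂ} (hs : s ≠ 0) :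
    {x : ℝ | g.eval (s * (Real.exp (-(2 * Real.pi * x)) : ℝ)) = 0}.Finite := by
  refine Set.Finite.of_finite_image ((Polynomial.finite_setOfPred_isRoot hg).subset ?_)
    (f := fun x : ℝ => s * (Real.exp (-(2 * Real.pi * x)) : ℝ)) ?_
  · rintro _ ⟨x, hx, rfl⟩
    exact hx
  · intro x _ y _ hxy
    have h1 : Real.exp (-(2 * Real.pi * x)) = Real.exp (-(2 * Real.pi * y)) := by
      exact_mod_cast mul_left_cancel₀ hs hxy
    have h2 := Real.exp_injective h1
    have := Real.pi_pos
    nlinarith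

section
variable {A : Multiset ℂ} (hA : ∀ α ∈ A, |α.re| < 1 / 2)
  (hsymm : A.map (fun α => -(starRingEnd ℂ) α) = A)
include hA hsymm

/-- The symmetry of the roots makes the denominator positive, so the sign of the weight is that of
`g` on the positive half-line. The factor `r` does not depend on `g`. -/
theorem exists_wt_eq (κ x : ℝ) : ∃ r : ℝ, 0 < r ∧ ∀ g : ℂ[X],
    wt A κ g x = r * g.eval ((Real.exp (-(2 * Real.pi * x)) : ℝ) : ℂ) := by
  obtain ⟨r, hr, h⟩ := multiset_prod_pos hsymm (f := fun α => ex (x * Complex.I) + ex α)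
    (fun α hα => by
      have := prod_ex_add_ne_zero hA x
      exact fun h0 => this (Multiset.prod_eq_zero (Multiset.mem_map.mpr ⟨α, hα, h0⟩)))
    (fun α => by rw [map_add, ex_neg_conj, ex_mul_I, Complex.conj_ofReal])
    (fun α _ h0 => by
      have h1 : α = α.im * Complex.I := by apply Complex.ext <;> simp [h0]
      rw [h1, ex_mul_I, ex_mul_I]
      exact ⟨Real.exp (-(2 * Real.pi * x)) + Real.exp (-(2 * Real.pi * α.im)), by positivity,
        by push_cast; rfl⟩)
  refine ⟨Real.exp (-(2 * Real.pi * (κ * x))) / r, by positivity, fun g => ?_⟩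
  rw [wt, h, ← mul_assoc, ← Complex.ofReal_mul, ex_mul_I, ex_mul_I]
  push_cast
  ring

/-- Here the argument of `g` is `-e^{2πiz}`, so the sign is governed by `g` on the negative
half-line; `iⁿ` supplies one factor `i` to each `exQuot`. -/
theorem exists_wtHol_eq (κ x : ℝ) : ∃ r : ℝ, 0 < r ∧ ∀ g : ℂ[X],
    Complex.I ^ A.card * wtHol A κ g (x * Complex.I)
      = r * g.eval (-(Real.exp (-(2 * Real.pi * x)) : ℝ) : ℂ) := by
  obtain ⟨r, hr, h⟩ := multiset_prod_pos hsymm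
    (f := fun α => Complex.I * exQuot α (x * Complex.I))
    (fun α hα => mul_ne_zero Complex.I_ne_zero
      (exQuot_ne_zero (abs_re_sub_lt (hA α hα) (by simp))))
    (fun α => exQuot_neg_conj α x) (fun α _ h0 => exQuot_pos h0 x)
  refine ⟨Real.exp (-(2 * Real.pi * (κ * x))) * r, by positivity, fun g => ?_⟩
  rw [Multiset.prod_map_mul, Multiset.map_const', Multiset.prod_replicate] at h
  rw [Complex.ofReal_mul, ← h, wtHol, ← mul_assoc (κ : ℂ), ← Complex.ofReal_mul, ex_mul_I,
    ex_mul_I]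
  ring

end

theorem roots_symm {P : ℂ[X]} (hP : P.Monic) (h : sharp P = (-1) ^ P.natDegree * P) :
    P.roots.map (fun α => -(starRingEnd ℂ) α) = P.roots := by
  have hcard : P.roots.card = P.natDegree := ((IsAlgClosed.splits P).natDegree_eq_card_roots).symm
  have hprod : ((P.roots.map (fun α => -(starRingEnd ℂ) α)).map
      fun α => Polynomial.X - Polynomial.C α).prod = P := by
    refine Polynomial.funext fun z => ?_
    rw [Polynomial.eval_multiset_prod, Multiset.map_map, Multiset.map_map]
    have h1 := congrArg (Polynomial.eval z) h
    rw [sharp_eval, Monic_eval_eq hP, map_multiset_prod, Multiset.map_map] at h1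
    have h2 : (P.roots.map ((starRingEnd ℂ) ∘ fun α => -(starRingEnd ℂ) z - α)).prod
        = (-1) ^ P.natDegree * (P.roots.map fun α => z + (starRingEnd ℂ) α).prod := by
      rw [← hcard, ← Multiset.card_map (fun α => z + (starRingEnd ℂ) α), ← Multiset.prod_map_neg,
        Multiset.map_map]
      congr 1
      exact Multiset.map_congr rfl fun α _ => by simp; ring
    rw [h2, Polynomial.eval_mul] at h1
    have h3 : ((-1 : ℂ[X]) ^ P.natDegree).eval z = (-1) ^ P.natDegree := by simp
    rw [h3] at h1
    rw [← mul_left_cancel₀ (pow_ne_zero _ (neg_ne_zero.mpr one_ne_zero)) h1]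
    congr 1
    exact Multiset.map_congr rfl fun α _ => by simp
  have := congrArg Polynomial.roots hprod
  rwa [Polynomial.roots_multiset_prod_X_sub_C] at this

/-! ### Classification of traces on `ℂ[z]` -/

/-- `Q(x - 1/2) - t Q(x + 1/2)`. -/
def shiftDiff (t : ℂ) (Q : ℂ[X]) : ℂ[X] :=
  Q.comp (Polynomial.X - Polynomial.C (1 / 2)) - t • Q.comp (Polynomial.X + Polynomial.C (1 / 2))

theorem shiftDiff_eq (t : ℂ) (Q : ℂ[X]) :
    shiftDiff t Q = Polynomial.taylor (-(1 / 2)) Q - t • Polynomial.taylor (1 / 2) Q := by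
  rw [shiftDiff, Polynomial.taylor_apply, Polynomial.taylor_apply, Polynomial.C_neg,
    sub_eq_add_neg Polynomial.X]

theorem natDegree_shiftDiff_le (t : ℂ) (Q : ℂ[X]) : (shiftDiff t Q).natDegree ≤ Q.natDegree := by
  rw [shiftDiff_eq]
  refine (Polynomial.natDegree_sub_le _ _).trans (max_le ?_ ?_)
  · rw [Polynomial.natDegree_taylor]
  · exact (Polynomial.natDegree_smul_le _ _).trans (Polynomial.natDegree_taylor _ _).le

theorem coeff_shiftDiff_natDegree (t : ℂ) {Q : ℂ[X]} (hQ : Q.Monic) :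
    (shiftDiff t Q).coeff Q.natDegree = 1 - t := by
  rw [shiftDiff_eq, Polynomial.coeff_sub, Polynomial.coeff_smul, Polynomial.coeff_taylor_natDegree,
    Polynomial.coeff_taylor_natDegree, hQ.leadingCoeff, smul_eq_mul, mul_one]

theorem coeff_taylor_of_natDegree_eq_succ {Q : ℂ[X]} (hQ : Q.Monic) {d : ℕ}
    (hd : Q.natDegree = d + 1) (r : ℂ) :
    (Polynomial.taylor r Q).coeff d = Q.coeff d + (d + 1) * r := by
  rw [Polynomial.taylor_coeff]
  have h1 : (Polynomial.hasseDeriv d Q).natDegree < 2 := by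
    have := Polynomial.natDegree_hasseDeriv_le Q d
    omega
  have h2 : Q.coeff (1 + d) = 1 := by
    rw [add_comm, ← hd]
    exact hQ.coeff_natDegree
  rw [Polynomial.eval_eq_sum_range' h1, Finset.sum_range_succ, Finset.sum_range_one,
    Polynomial.hasseDeriv_coeff, Polynomial.hasseDeriv_coeff, h2, add_comm 1 d]
  simp

theorem coeff_shiftDiff_one {Q : ℂ[X]} (hQ : Q.Monic) {d : ℕ} (hd : Q.natDegree = d + 1) :
    (shiftDiff 1 Q).coeff d = -(d + 1) := by
  rw [shiftDiff_eq, Polynomial.coeff_sub, Polynomial.coeff_smul,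
    coeff_taylor_of_natDegree_eq_succ hQ hd, coeff_taylor_of_natDegree_eq_succ hQ hd, smul_eq_mul]
  ring

/-- The polynomials killed by every trace include one of each exact degree `d ≥ m`, so traces are
determined by the powers below `m`. If `t ≠ 1` the leading coefficient is multiplied by `1 - t`; if
`t = 1` it cancels and the degree drops by exactly one, which is why `m` is then one smaller. -/
theorem exists_natDegree_shiftDiff_eq {P : ℂ[X]} (hP : P.Monic) {t : ℂ} {m : ℕ}
    (hm : (t ≠ 1 ∧ m = P.natDegree) ∨ (t = 1 ∧ m + 1 = P.natDegree)) {d : ℕ} (hd : m ≤ d) :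
    ∃ S : ℂ[X], (shiftDiff t (P * S)).natDegree ≤ d ∧ (shiftDiff t (P * S)).coeff d ≠ 0 := by
  rcases hm with ⟨ht, rfl⟩ | ⟨rfl, hm⟩
  · refine ⟨Polynomial.X ^ (d - P.natDegree), ?_⟩
    have hQ : (P * Polynomial.X ^ (d - P.natDegree)).Monic := hP.mul (Polynomial.monic_X_pow _)
    have hn : (P * Polynomial.X ^ (d - P.natDegree)).natDegree = d := by
      rw [hP.natDegree_mul (Polynomial.monic_X_pow _), Polynomial.natDegree_X_pow]
      omega
    refine ⟨(natDegree_shiftDiff_le _ _).trans hn.le, ?_⟩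
    have := coeff_shiftDiff_natDegree t hQ
    rw [hn] at this
    rw [this]
    exact sub_ne_zero.mpr ht.symm
  · refine ⟨Polynomial.X ^ (d + 1 - P.natDegree), ?_⟩
    have hQ : (P * Polynomial.X ^ (d + 1 - P.natDegree)).Monic := hP.mul (Polynomial.monic_X_pow _)
    have hn : (P * Polynomial.X ^ (d + 1 - P.natDegree)).natDegree = d + 1 := by
      rw [hP.natDegree_mul (Polynomial.monic_X_pow _), Polynomial.natDegree_X_pow]
      omega
    constructor
    · set Q := P * Polynomial.X ^ (d + 1 - P.natDegree)
      have h1 := (natDegree_shiftDiff_le 1 _).trans hn.le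
      have h2 := coeff_shiftDiff_natDegree 1 hQ
      rw [hn, sub_self] at h2
      by_contra! h3
      have h4 := le_antisymm h1 h3
      rw [← h4, Polynomial.coeff_natDegree, Polynomial.leadingCoeff_eq_zero] at h2
      rw [h2] at h4
      simp at h4
    · rw [coeff_shiftDiff_one hQ hn]
      exact neg_ne_zero.mpr (by exact_mod_cast Nat.succ_ne_zero d)

/-- A trace on `ℂ[z]` is determined by its values on small powers of `z`. -/
theorem eq_zero_of_shiftDiff_of_pow {P : ℂ[X]} (hP : P.Monic) {t : ℂ} {m : ℕ}
    (hm : (t ≠ 1 ∧ m = P.natDegree) ∨ (t = 1 ∧ m + 1 = P.natDegree)) {τ : ℂ[X] →ₗ[ℂ] ℂ}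
    (hτ : ∀ S, τ (shiftDiff t (P * S)) = 0) (h0 : ∀ i < m, τ (Polynomial.X ^ i) = 0) : τ = 0 := by
  have hpow : ∀ k, τ (Polynomial.X ^ k) = 0 := by
    intro k
    induction k using Nat.strong_induction_on with
    | _ k ih =>
      rcases lt_or_ge k m with hk | hk
      · exact h0 k hk
      · obtain ⟨S, h1, h2⟩ := exists_natDegree_shiftDiff_eq hP hm hk
        have h3 := hτ S
        rw [Polynomial.as_sum_range_C_mul_X_pow' _ (Nat.lt_succ_of_le h1), map_sum,
          Finset.sum_range_succ, Finset.sum_eq_zero, zero_add, ← Polynomial.smul_eq_C_mul,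
          map_smul, smul_eq_mul] at h3
        · exact (mul_eq_zero.mp h3).resolve_left h2
        · intro i hi
          rw [← Polynomial.smul_eq_C_mul, map_smul, ih i (Finset.mem_range.mp hi), smul_zero]
  ext k
  simp [Polynomial.monomial_one_right_eq_X_pow, hpow k]

section
variable {P : ℂ[X]} (hP : P.Monic) (hA : ∀ α ∈ P.roots, |α.re| < 1 / 2) {κ : ℝ} (hκ : 0 < κ)
  {m : ℕ} (hm : κ + m < P.roots.card + 1)
include hA hκ hm

omit hA hκ hm in
theorem eq_zero_of_wt_eq_zero (hA : ∀ α ∈ P.roots, |α.re| < 1 / 2) {g : ℂ[X]}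
    (h : ∀ x, wt P.roots κ g x = 0) : g = 0 := by
  by_contra hg
  refine Set.infinite_univ ((finite_eval_exp_eq_zero hg one_ne_zero).subset fun x _ => ?_)
  have h1 := h x
  rw [wt, div_eq_zero_iff, or_iff_left (prod_ex_add_ne_zero hA x), mul_eq_zero,
    or_iff_right (ex_ne_zero _), ex_mul_I] at h1
  simpa using h1

theorem wt_nonneg_of_traceForm {g : Polynomial.degreeLT ℂ m}
    (h : ∀ R : ℂ[X], 0 ≤ (traceForm hA hκ hm g (R * sharp R)).re ∧
      (traceForm hA hκ hm g (R * sharp R)).im = 0) (x : ℝ) :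
    0 ≤ (wt P.roots κ (g : ℂ[X]) x).re ∧ (wt P.roots κ (g : ℂ[X]) x).im = 0 := by
  obtain ⟨C, δ, hδ, hb⟩ := exists_norm_eval_mul_wt_le hA hκ hm (Polynomial.mem_degreeLT.mp g.2) 1
  refine nonneg_of_integral_sq_mul_nonneg_complex (continuous_wt hA _) hδ
    (fun x => by simpa using hb x) (fun p => ?_) x
  obtain ⟨R, hR⟩ := exists_eval_mul_I p
  have h1 := h R
  have h2 : traceForm hA hκ hm g (R * sharp R)
      = ∫ x, ((p.eval x : ℝ) : ℂ) ^ 2 * wt P.roots κ (g : ℂ[X]) x := by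
    refine integral_congr_ae (Filter.Eventually.of_forall fun x => ?_)
    simp only [eval_mul_sharp_mul_I, hR, Complex.normSq_ofReal]
    push_cast
    ring
  rwa [h2] at h1

theorem wtHol_nonneg_of_integral {g : Polynomial.degreeLT ℂ m} {s : ℂ}
    (h : ∀ R : ℂ[X], 0 ≤ (s * ∫ x : ℝ, (R * sharp R).eval (x * Complex.I) *
        wtHol P.roots κ (g : ℂ[X]) (x * Complex.I)).re ∧
      (s * ∫ x : ℝ, (R * sharp R).eval (x * Complex.I) *
        wtHol P.roots κ (g : ℂ[X]) (x * Complex.I)).im = 0) (x : ℝ) :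
    0 ≤ (s * wtHol P.roots κ (g : ℂ[X]) (x * Complex.I)).re ∧
      (s * wtHol P.roots κ (g : ℂ[X]) (x * Complex.I)).im = 0 := by
  obtain ⟨C, δ, hδ, hb⟩ :=
    exists_norm_eval_mul_wtHol_le hA hκ hm (Polynomial.mem_degreeLT.mp g.2) (Polynomial.C s)
  refine nonneg_of_integral_sq_mul_nonneg_complex
    (f := fun x : ℝ => s * wtHol P.roots κ (g : ℂ[X]) (x * Complex.I)) ?_ hδ
    (fun x => by simpa using hb (x * Complex.I) (by simp)) (fun p => ?_) x
  · exact continuous_const.mul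
      ((differentiableOn_wtHol hA κ _).continuousOn.comp_continuous (by fun_prop) (by simp))
  obtain ⟨R, hR⟩ := exists_eval_mul_I p
  have h1 := h R
  rw [← integral_const_mul] at h1
  have h2 : (∫ x : ℝ, s * ((R * sharp R).eval (x * Complex.I) *
        wtHol P.roots κ (g : ℂ[X]) (x * Complex.I)))
      = ∫ x : ℝ, ((p.eval x : ℝ) : ℂ) ^ 2 *
        (s * wtHol P.roots κ (g : ℂ[X]) (x * Complex.I)) := by
    refine integral_congr_ae (Filter.Eventually.of_forall fun x => ?_)
    simp only [eval_mul_sharp_mul_I, hR, Complex.normSq_ofReal]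
    push_cast
    ring
  rwa [h2] at h1

/-- If the functional vanishes, then `g` and `-g` both have nonnegative weights, so the weight is
zero. -/
theorem traceForm_injective : Function.Injective (traceForm hA hκ hm) := by
  rw [← LinearMap.ker_eq_bot, LinearMap.ker_eq_bot']
  intro g hg
  have h1 := wt_nonneg_of_traceForm hA hκ hm (g := g) (by simp [hg])
  have h2 := wt_nonneg_of_traceForm hA hκ hm (g := -g) (by simp [hg])
  refine Subtype.ext (eq_zero_of_wt_eq_zero (κ := κ) hA fun x => ?_)
  have h3 := (h2 x).1
  have h4 : wt P.roots κ ((-g : Polynomial.degreeLT ℂ m) : ℂ[X]) x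
      = -wt P.roots κ (g : ℂ[X]) x := by
    have := wt_smul P.roots κ (-1) (g : ℂ[X]) x
    simpa using this
  rw [h4, Complex.neg_re] at h3
  exact Complex.ext (le_antisymm (by simpa using h3) (h1 x).1) (h1 x).2

include hP

/-- Every trace on `ℂ[z]` is given by integration against a weight. -/
theorem exists_traceForm_eq
    (hm' : (ex κ ≠ 1 ∧ m = P.natDegree) ∨ (ex κ = 1 ∧ m + 1 = P.natDegree)) {τ : ℂ[X] →ₗ[ℂ] ℂ}
    (hτ : ∀ S, τ (shiftDiff (ex κ) (P * S)) = 0) : ∃ g, traceForm hA hκ hm g = τ := by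
  have htr : ∀ g S, traceForm hA hκ hm g (shiftDiff (ex κ) (P * S)) = 0 := by
    intro g S
    rw [shiftDiff, map_sub, map_smul, smul_eq_mul, traceForm_shift hP, sub_self]
  -- `M` records the values on `1, z, …, z^{m-1}`. Composed with `traceForm` it is injective between
  -- spaces of dimension `m`, hence onto.
  let M : (ℂ[X] →ₗ[ℂ] ℂ) →ₗ[ℂ] (Fin m → ℂ) :=
    LinearMap.pi fun i => LinearMap.applyₗ (Polynomial.X ^ (i : ℕ))
  have hinj : Function.Injective (M ∘ₗ traceForm hA hκ hm) := by
    rw [← LinearMap.ker_eq_bot, LinearMap.ker_eq_bot']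
    intro g hg
    apply traceForm_injective hA hκ hm
    rw [map_zero]
    exact eq_zero_of_shiftDiff_of_pow hP hm' (htr g) fun i hi => congrFun hg ⟨i, hi⟩
  have : FiniteDimensional ℂ (Polynomial.degreeLT ℂ m) :=
    (Polynomial.degreeLTEquiv ℂ m).symm.finiteDimensional
  have hsurj := (LinearMap.injective_iff_surjective_of_finrank_eq_finrank
    (Polynomial.degreeLTEquiv ℂ m).finrank_eq).mp hinj
  obtain ⟨g, hg⟩ := hsurj (M τ)
  refine ⟨g, sub_eq_zero.mp ?_⟩
  refine eq_zero_of_shiftDiff_of_pow hP hm' (fun S => ?_) fun i hi => ?_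
  · rw [LinearMap.sub_apply, htr, hτ, sub_self]
  · rw [LinearMap.sub_apply, sub_eq_zero]
    exact congrFun hg ⟨i, hi⟩

end

/-! ### Weight decomposition of the algebra -/

theorem alg_induction {P : ℂ[X]} {C : Alg P → Prop} (hs : ∀ r : ℂ, C (algebraMap ℂ (Alg P) r))
    (hg : ∀ g, C (gen P g)) (hm : ∀ a b, C a → C b → C (a * b))
    (ha : ∀ a b, C a → C b → C (a + b)) (a : Alg P) : C a := by
  obtain ⟨x, rfl⟩ := RingQuot.mkAlgHom_surjective ℂ (Rel P) a
  change C (mk P x)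
  induction x using FreeAlgebra.induction with
  | grade0 r => rw [AlgHom.commutes]; exact hs r
  | grade1 g => exact hg g
  | mul a b h1 h2 => rw [map_mul]; exact hm _ _ h1 h2
  | add a b h1 h2 => rw [map_add]; exact ha _ _ h1 h2

/-- Polynomials in `z`. -/
abbrev pz (P f : ℂ[X]) : Alg P := Polynomial.aeval (gen P Gen.z) f

theorem pz_comp_add (P f : ℂ[X]) (r : ℂ) :
    pz P (f.comp (Polynomial.X + Polynomial.C r))
      = Polynomial.aeval (gen P Gen.z + algebraMap ℂ (Alg P) r) f := by
  simp [pz, Polynomial.aeval_comp]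

theorem v_mul_u (P : ℂ[X]) : gen P Gen.v * gen P Gen.u
    = pz P (P.comp (Polynomial.X - Polynomial.C (1 / 2))) := by
  rw [gen_vu, pz, Polynomial.aeval_comp]
  simp

theorem u_mul_v (P : ℂ[X]) : gen P Gen.u * gen P Gen.v
    = pz P (P.comp (Polynomial.X + Polynomial.C (1 / 2))) := by
  rw [gen_uv, pz, Polynomial.aeval_comp]
  simp

/-- The eigenvectors of `ad z`. -/
def HasWeight {P : ℂ[X]} (a : Alg P) (r : ℂ) : Prop :=
  gen P Gen.z * a - a * gen P Gen.z = r • a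

theorem HasWeight.mul {P : ℂ[X]} {a b : Alg P} {r s : ℂ} (ha : HasWeight a r)
    (hb : HasWeight b s) : HasWeight (a * b) (r + s) := by
  unfold HasWeight at *
  rw [add_smul, ← smul_mul_assoc, ← mul_smul_comm, ← ha, ← hb]
  noncomm_ring

theorem hasWeight_one (P : ℂ[X]) : HasWeight (1 : Alg P) 0 := by simp [HasWeight]

theorem HasWeight.pow {P : ℂ[X]} {a : Alg P} {r : ℂ} (ha : HasWeight a r) (k : ℕ) :
    HasWeight (a ^ k) (k * r) := by
  induction k with
  | zero => simpa using hasWeight_one P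
  | succ k ih =>
    rw [pow_succ]
    convert ih.mul ha using 1
    push_cast
    ring

theorem hasWeight_pz (P f : ℂ[X]) : HasWeight (pz P f) 0 := by
  have h : gen P Gen.z = pz P Polynomial.X := by simp [pz]
  rw [HasWeight, zero_smul, sub_eq_zero, h, ← map_mul, ← map_mul, mul_comm]

theorem hasWeight_v (P : ℂ[X]) : HasWeight (gen P Gen.v) 1 := by
  rw [HasWeight, gen_zv, one_smul]

theorem hasWeight_u (P : ℂ[X]) : HasWeight (gen P Gen.u) (-1) := by
  rw [HasWeight, gen_zu, Algebra.smul_def, map_neg, map_one, neg_mul, one_mul]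

theorem HasWeight.pz_mul {P : ℂ[X]} {a : Alg P} {r : ℂ} (ha : HasWeight a r) (f : ℂ[X]) :
    pz P f * a = a * pz P (f.comp (Polynomial.X + Polynomial.C r)) := by
  have h1 : gen P Gen.z * a = a * (gen P Gen.z + algebraMap ℂ (Alg P) r) := by
    rw [mul_add, ← Algebra.commutes, ← Algebra.smul_def, ← ha]
    abel
  rw [pz_comp_add]
  induction f using Polynomial.induction_on' with
  | add p q hp hq => simp only [pz, map_add, add_mul, mul_add] at hp hq ⊢; rw [hp, hq]
  | monomial n c =>
    have h2 : gen P Gen.z ^ n * a = a * (gen P Gen.z + algebraMap ℂ (Alg P) r) ^ n := by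
      have : SemiconjBy a (gen P Gen.z + algebraMap ℂ (Alg P) r) (gen P Gen.z) := h1.symm
      exact (this.pow_right n).eq.symm
    rw [pz, Polynomial.aeval_monomial, Polynomial.aeval_monomial, mul_assoc, h2, ← mul_assoc,
      Algebra.commutes, mul_assoc]

theorem HasWeight.mul_pz {P : ℂ[X]} {a : Alg P} {r : ℂ} (ha : HasWeight a r) (f : ℂ[X]) :
    a * pz P f = pz P (f.comp (Polynomial.X - Polynomial.C r)) * a := by
  rw [ha.pz_mul, Polynomial.comp_assoc]
  simp

/-- The monomials `v ^ k` and `u ^ k` of weights `k` and `-k`. -/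
def mono (P : ℂ[X]) : ℤ → Alg P
  | Int.ofNat k => gen P Gen.v ^ k
  | Int.negSucc k => gen P Gen.u ^ (k + 1)

theorem hasWeight_mono (P : ℂ[X]) (k : ℤ) : HasWeight (mono P k) k := by
  cases k with
  | ofNat k => simpa [mono] using (hasWeight_v P).pow k
  | negSucc k => simpa [mono] using (hasWeight_u P).pow (k + 1)

theorem hasWeight_mono_mul_pz (P : ℂ[X]) (k : ℤ) (f : ℂ[X]) :
    HasWeight (mono P k * pz P f) k := by
  simpa using (hasWeight_mono P k).mul (hasWeight_pz P f)

theorem exists_v_mul_mono (P : ℂ[X]) (k : ℤ) :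
    ∃ l f, gen P Gen.v * mono P k = mono P l * pz P f := by
  cases k with
  | ofNat k => exact ⟨Int.ofNat (k + 1), 1, by simp [mono, pow_succ']⟩
  | negSucc k =>
    have h : gen P Gen.v * mono P (Int.negSucc k)
        = pz P (P.comp (Polynomial.X - Polynomial.C (1 / 2))) * gen P Gen.u ^ k := by
      rw [mono, pow_succ', ← mul_assoc, v_mul_u]
    rw [h, ((hasWeight_u P).pow k).pz_mul]
    cases k with
    | zero => exact ⟨Int.ofNat 0, _, by rw [mono, pow_zero, pow_zero]⟩
    | succ k => exact ⟨Int.negSucc k, _, rfl⟩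

theorem exists_u_mul_mono (P : ℂ[X]) (k : ℤ) :
    ∃ l f, gen P Gen.u * mono P k = mono P l * pz P f := by
  cases k with
  | ofNat k =>
    cases k with
    | zero => exact ⟨Int.negSucc 0, 1, by simp [mono]⟩
    | succ k =>
      have h : gen P Gen.u * mono P (Int.ofNat (k + 1))
          = pz P (P.comp (Polynomial.X + Polynomial.C (1 / 2))) * gen P Gen.v ^ k := by
        rw [mono, pow_succ', ← mul_assoc, u_mul_v]
      rw [h, ((hasWeight_v P).pow k).pz_mul]
      exact ⟨Int.ofNat k, _, rfl⟩
  | negSucc k => exact ⟨Int.negSucc (k + 1), 1, by simp [mono, pow_succ' _ (k + 1)]⟩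

/-- Left multiplication as a linear map. -/
def mulLeftAlg {P : ℂ[X]} (a : Alg P) : Alg P →ₗ[ℂ] Alg P where
  toFun x := a * x
  map_add' x y := mul_add a x y
  map_smul' r x := mul_smul_comm r a x

theorem alg_mul_sum {P : ℂ[X]} {ι : Type*} (s : Finset ι) (f : ι → Alg P) (a : Alg P) :
    a * ∑ i ∈ s, f i = ∑ i ∈ s, a * f i :=
  map_sum (mulLeftAlg a) f s

/-- The algebra is spanned by the elements `mono k * f(z)`. -/
def assemble (P : ℂ[X]) : (ℤ →₀ ℂ[X]) →ₗ[ℂ] Alg P :=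
  Finsupp.lsum ℂ fun k => mulLeftAlg (mono P k) ∘ₗ
    (Polynomial.aeval (gen P Gen.z)).toLinearMap

theorem assemble_apply (P : ℂ[X]) (F : ℤ →₀ ℂ[X]) :
    assemble P F = ∑ k ∈ F.support, mono P k * pz P (F k) := rfl

theorem assemble_single (P : ℂ[X]) (k : ℤ) (f : ℂ[X]) :
    assemble P (Finsupp.single k f) = mono P k * pz P f := by
  simp [assemble, mulLeftAlg]

/-- The range contains `1` and is stable under left multiplication, because each generator sends
`mono P k` to some `mono P l * pz P f`. -/
theorem assemble_surjective (P : ℂ[X]) : Function.Surjective (assemble P) := by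
  have key : ∀ a : Alg P, ∀ b ∈ LinearMap.range (assemble P), a * b ∈ LinearMap.range (assemble P) := by
    intro a
    induction a using alg_induction with
    | hs r =>
      intro b hb
      rw [← Algebra.smul_def]
      exact Submodule.smul_mem _ _ hb
    | hm a b h1 h2 =>
      intro c hc
      rw [mul_assoc]
      exact h1 _ (h2 c hc)
    | ha a b h1 h2 =>
      intro c hc
      rw [add_mul]
      exact Submodule.add_mem _ (h1 c hc) (h2 c hc)
    | hg g =>
      rintro _ ⟨F, rfl⟩
      rw [assemble_apply, alg_mul_sum]
      refine Submodule.sum_mem _ fun k _ => ?_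
      have : ∃ l f, gen P g * mono P k = mono P l * pz P f := by
        cases g with
        | u => exact exists_u_mul_mono P k
        | v => exact exists_v_mul_mono P k
        | z =>
          refine ⟨k, Polynomial.X.comp (Polynomial.X + Polynomial.C (k : ℂ)), ?_⟩
          have h := (hasWeight_mono P k).pz_mul Polynomial.X
          simpa only [pz, Polynomial.aeval_X] using h
      obtain ⟨l, f, h⟩ := this
      rw [← mul_assoc, h, mul_assoc, ← map_mul]
      exact ⟨Finsupp.single l (f * F k), assemble_single P _ _⟩
  intro a
  have h1 : (1 : Alg P) ∈ LinearMap.range (assemble P) :=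
    ⟨Finsupp.single 0 1, by rw [assemble_single]; simp [mono]⟩
  simpa using key a 1 h1

/-- The operators by which the generators act on functions `ℤ → ℂ[X]`. -/
def opGen (P : ℂ[X]) : Gen → Module.End ℂ[X] (ℤ → ℂ[X])
  | Gen.z =>
    { toFun := fun f k => (Polynomial.X + Polynomial.C (k : ℂ)) * f k
      map_add' := fun f g => by ext1 k; simp [mul_add]
      map_smul' := fun c f => by ext1 k; simp [mul_left_comm] }
  | Gen.v =>
    { toFun := fun f k => f (k - 1)
      map_add' := fun f g => rfl
      map_smul' := fun c f => rfl }
  | Gen.u =>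
    { toFun := fun f k => P.comp (Polynomial.X + Polynomial.C ((k : ℂ) + 1 / 2)) * f (k + 1)
      map_add' := fun f g => by ext1 k; simp [mul_add]
      map_smul' := fun c f => by ext1 k; simp [mul_left_comm] }

theorem aeval_opGen_z (P Q : ℂ[X]) (r : ℂ) (f : ℤ → ℂ[X]) (k : ℤ) :
    Polynomial.aeval (opGen P Gen.z + algebraMap ℂ _ r) Q f k
      = Q.comp (Polynomial.X + Polynomial.C ((k : ℂ) + r)) * f k := by
  induction Q using Polynomial.induction_on' generalizing f k with
  | add p q hp hq =>
    rw [map_add, LinearMap.add_apply, Pi.add_apply, hp, hq, Polynomial.add_comp, add_mul]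
  | monomial n c =>
    have h1 : ∀ f k, (opGen P Gen.z + algebraMap ℂ (Module.End ℂ[X] (ℤ → ℂ[X])) r) f k
        = (Polynomial.X + Polynomial.C ((k : ℂ) + r)) * f k := by
      intro f k
      rw [LinearMap.add_apply, Pi.add_apply, Module.algebraMap_end_apply, Pi.smul_apply,
        Polynomial.smul_eq_C_mul, Polynomial.C_add, ← add_assoc, add_mul _ _ (f k)]
      rfl
    have h2 : ∀ n : ℕ, ∀ f k,
        ((opGen P Gen.z + algebraMap ℂ (Module.End ℂ[X] (ℤ → ℂ[X])) r) ^ n) f k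
        = (Polynomial.X + Polynomial.C ((k : ℂ) + r)) ^ n * f k := by
      intro n
      induction n with
      | zero => simp
      | succ n ih =>
        intro f k
        rw [pow_succ, Module.End.mul_apply, ih, h1, pow_succ, mul_assoc]
    rw [Polynomial.aeval_monomial, Module.End.mul_apply, Module.algebraMap_end_apply,
      Pi.smul_apply, h2, Polynomial.monomial_comp, Polynomial.smul_eq_C_mul, mul_assoc]

/-- The representation of `𝒜_P` on functions `ℤ → ℂ[X]`. -/
def rep (P : ℂ[X]) : Alg P →ₐ[ℂ] Module.End ℂ[X] (ℤ → ℂ[X]) :=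
  RingQuot.liftAlgHom ℂ ⟨FreeAlgebra.lift ℂ (opGen P), by
    intro x y h
    cases h with
    | zu =>
      refine LinearMap.ext fun f => funext fun k => ?_
      simp only [map_sub, map_mul, map_neg, FreeAlgebra.lift_ι_apply, LinearMap.sub_apply,
        LinearMap.neg_apply, Module.End.mul_apply, Pi.sub_apply, Pi.neg_apply, opGen,
        LinearMap.coe_mk, AddHom.coe_mk]
      push_cast
      rw [show Polynomial.C ((k : ℂ) + 1) = Polynomial.C (k : ℂ) + 1 by simp]
      ring
    | zv =>
      refine LinearMap.ext fun f => funext fun k => ?_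
      simp only [map_sub, map_mul, FreeAlgebra.lift_ι_apply, LinearMap.sub_apply,
        Module.End.mul_apply, Pi.sub_apply, opGen, LinearMap.coe_mk, AddHom.coe_mk]
      push_cast
      rw [show Polynomial.C ((k : ℂ) - 1) = Polynomial.C (k : ℂ) - 1 by simp]
      ring
    | vu =>
      refine LinearMap.ext fun f => funext fun k => ?_
      rw [← Polynomial.aeval_algHom_apply, map_sub, AlgHom.commutes, map_mul,
        FreeAlgebra.lift_ι_apply, FreeAlgebra.lift_ι_apply, FreeAlgebra.lift_ι_apply,
        sub_eq_add_neg, ← map_neg, aeval_opGen_z]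
      simp only [Module.End.mul_apply, opGen, LinearMap.coe_mk, AddHom.coe_mk]
      rw [sub_add_cancel]
      congr 4
      push_cast
      ring
    | uv =>
      refine LinearMap.ext fun f => funext fun k => ?_
      rw [← Polynomial.aeval_algHom_apply, map_add, AlgHom.commutes, map_mul,
        FreeAlgebra.lift_ι_apply, FreeAlgebra.lift_ι_apply, FreeAlgebra.lift_ι_apply,
        aeval_opGen_z]
      simp only [Module.End.mul_apply, opGen, LinearMap.coe_mk, AddHom.coe_mk]
      rw [add_sub_cancel_right]⟩

theorem rep_gen (P : ℂ[X]) (g : Gen) : rep P (gen P g) = opGen P g := by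
  exact (RingQuot.liftAlgHom_mkAlgHom_apply ℂ _ _ _).trans (FreeAlgebra.lift_ι_apply _ _)

theorem rep_pz (P Q : ℂ[X]) (f : ℤ → ℂ[X]) (k : ℤ) :
    rep P (pz P Q) f k = Q.comp (Polynomial.X + Polynomial.C (k : ℂ)) * f k := by
  rw [pz, ← Polynomial.aeval_algHom_apply, rep_gen]
  have := aeval_opGen_z P Q 0 f k
  rwa [map_zero, add_zero, add_zero] at this

/-- The projection of `𝒜_P` onto its weight zero part `ℂ[z]`. -/
def weightZero (P : ℂ[X]) : Alg P →ₗ[ℂ] ℂ[X] where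
  toFun a := rep P a (Pi.single 0 1) 0
  map_add' a b := by simp
  map_smul' r a := by simp

theorem weightZero_pz_mul (P f : ℂ[X]) (a : Alg P) :
    weightZero P (pz P f * a) = f * weightZero P a := by
  change rep P (pz P f * a) _ _ = _ * rep P a _ _
  rw [map_mul, Module.End.mul_apply, rep_pz]
  simp

theorem weightZero_mul_pz (P f : ℂ[X]) (a : Alg P) :
    weightZero P (a * pz P f) = f * weightZero P a := by
  change rep P (a * pz P f) _ _ = _ * rep P a _ _
  have h : rep P (pz P f) (Pi.single 0 1) = f • (Pi.single 0 1 : ℤ → ℂ[X]) := by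
    funext k
    rw [rep_pz, Pi.smul_apply, smul_eq_mul]
    rcases eq_or_ne k 0 with rfl | hk
    · simp
    · simp [hk]
  rw [map_mul, Module.End.mul_apply, h, map_smul, Pi.smul_apply, smul_eq_mul]

theorem weightZero_pz (P f : ℂ[X]) : weightZero P (pz P f) = f := by
  rw [← mul_one (pz P f), weightZero_pz_mul]
  change f * rep P 1 _ _ = f
  simp

/-- Left and right multiplication by `z` have the same effect on the projection, so `ad z` acts on
it both by `0` and by `r`. -/
theorem weightZero_eq_zero {P : ℂ[X]} {a : Alg P} {r : ℂ} (ha : HasWeight a r) (hr : r ≠ 0) :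
    weightZero P a = 0 := by
  have h := congrArg (weightZero P) ha
  have hz : gen P Gen.z = pz P Polynomial.X := by simp [pz]
  rw [map_sub, hz, weightZero_pz_mul, weightZero_mul_pz, sub_self, map_smul] at h
  exact (smul_eq_zero.mp h.symm).resolve_left hr

theorem alg_span_induction {P : ℂ[X]} {C : Alg P → Prop} (h : ∀ k f, C (mono P k * pz P f))
    (h0 : C 0) (ha : ∀ a b, C a → C b → C (a + b)) (a : Alg P) : C a := by
  obtain ⟨F, rfl⟩ := assemble_surjective P a
  induction F using Finsupp.induction_linear with
  | zero => rwa [map_zero]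
  | add F G h1 h2 => rw [map_add]; exact ha _ _ h1 h2
  | single k f => rw [assemble_single]; exact h k f

theorem comp_X_add_C_ne_zero {f : ℂ[X]} (hf : f ≠ 0) (r : ℂ) :
    f.comp (Polynomial.X + Polynomial.C r) ≠ 0 := by
  rw [← Polynomial.taylor_apply]
  exact fun h => hf ((Polynomial.taylor_eq_zero r f).mp h)

theorem comp_X_sub_C_ne_zero {f : ℂ[X]} (hf : f ≠ 0) (r : ℂ) :
    f.comp (Polynomial.X - Polynomial.C r) ≠ 0 := by
  have := comp_X_add_C_ne_zero hf (-r)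
  rwa [Polynomial.C_neg, ← sub_eq_add_neg] at this

theorem comp_add_comp_sub (f : ℂ[X]) (r s : ℂ) :
    (f.comp (Polynomial.X + Polynomial.C r)).comp (Polynomial.X - Polynomial.C s)
      = f.comp (Polynomial.X + Polynomial.C (r - s)) := by
  rw [Polynomial.comp_assoc]
  congr 1
  simp only [Polynomial.add_comp, Polynomial.X_comp, Polynomial.C_comp, Polynomial.C_sub]
  ring

/-! ### Invariant forms and twisted traces -/

section
variable {P : ℂ[X]} {lm lm' : ℂ}
    {h : (P.map (starRingEnd ℂ)).comp (-Polynomial.X) = Polynomial.C (lm * lm') * P}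

theorem conjugation_algebraMap (r : ℂ) : conjugation P lm lm' h (algebraMap ℂ (Alg P) r)
    = algebraMap ℂ (Alg P) ((starRingEnd ℂ) r) := by
  rw [Algebra.algebraMap_eq_smul_one, conjugation_smul, map_one, Algebra.algebraMap_eq_smul_one]

theorem conjugation_mul (a b : Alg P) : conjugation P lm lm' h (a * b)
    = conjugation P lm lm' h a * conjugation P lm lm' h b := map_mul _ a b

theorem conjugation_pz (f : ℂ[X]) : conjugation P lm lm' h (pz P f) = pz P (sharp f) := by
  have h1 : pz P f = mk P (Polynomial.aeval (FreeAlgebra.ι ℂ Gen.z) f) := by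
    rw [← Polynomial.aeval_algHom_apply]
    rfl
  rw [h1, conjugation_mk, conjFree_aeval, conjFree_gen, conjGen, pz, sharp, Polynomial.aeval_comp]
  simp

theorem HasWeight.conjugation {a : Alg P} {k : ℤ} (ha : HasWeight a k) :
    HasWeight (conjugation P lm lm' h a) (-k) := by
  have h1 := congrArg (Kleinian.conjugation P lm lm' h) ha
  rw [map_sub, map_mul, map_mul, conjugation_z, conjugation_smul] at h1
  rw [HasWeight, Algebra.smul_def, map_neg, neg_mul, ← Algebra.smul_def]
  simp only [map_intCast] at h1
  rw [← h1]
  noncomm_ring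

/-- The form `(a, b) = τ₀(a ρ(b))`, where `τ₀` is the extension of `τ` by zero outside of the
weight zero part. -/
def formOf (h : (P.map (starRingEnd ℂ)).comp (-Polynomial.X) = Polynomial.C (lm * lm') * P)
    (τ : ℂ[X] →ₗ[ℂ] ℂ) : SesqForm P :=
  LinearMap.mk₂'ₛₗ (RingHom.id ℂ) (starRingEnd ℂ)
    (fun a b => τ (weightZero P (a * conjugation P lm lm' h b)))
    (fun a b c => by rw [add_mul, map_add, map_add])
    (fun r a b => by rw [smul_mul_assoc, map_smul, map_smul, RingHom.id_apply])
    (fun a b c => by rw [map_add, mul_add, map_add, map_add])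
    (fun r a b => by rw [conjugation_smul, mul_smul_comm, map_smul, map_smul])

theorem formOf_apply (τ : ℂ[X] →ₗ[ℂ] ℂ) (a b : Alg P) :
    formOf h τ a b = τ (weightZero P (a * conjugation P lm lm' h b)) := rfl

theorem formOf_invariant (τ : ℂ[X] →ₗ[ℂ] ℂ) (a y b : Alg P) :
    formOf h τ (a * conjugation P lm lm' h y) b = formOf h τ a (y * b) := by
  rw [formOf_apply, formOf_apply, conjugation_mul, mul_assoc]

theorem formOf_eq_zero_of_weight (τ : ℂ[X] →ₗ[ℂ] ℂ) {a b : Alg P} {k l : ℤ} (ha : HasWeight a k)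
    (hb : HasWeight b l) (hkl : k ≠ l) : formOf h τ a b = 0 := by
  rw [formOf_apply, weightZero_eq_zero (ha.mul (hb.conjugation)) (by
    rw [← sub_eq_add_neg, sub_ne_zero]
    exact_mod_cast hkl), map_zero]

variable {t : ℂ} (ht : (starRingEnd ℂ) lm * lm' = t) (ht' : (starRingEnd ℂ) lm' * lm = t⁻¹)
  (ht0 : t ≠ 0) {τ : ℂ[X] →ₗ[ℂ] ℂ}
  (hτ : ∀ S, τ ((P * S).comp (Polynomial.X - Polynomial.C (1 / 2)))
    = t * τ ((P * S).comp (Polynomial.X + Polynomial.C (1 / 2))))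

include ht in
theorem conjugation_conjugation_v :
    conjugation P lm lm' h (conjugation P lm lm' h (gen P Gen.v)) = t • gen P Gen.v := by
  rw [conjugation_v, conjugation_smul, conjugation_u, smul_smul, ht]

include ht' in
theorem conjugation_conjugation_u :
    conjugation P lm lm' h (conjugation P lm lm' h (gen P Gen.u)) = t⁻¹ • gen P Gen.u := by
  rw [conjugation_u, conjugation_smul, conjugation_v, smul_smul, ht']

include hτ in
-- This is the hypothesis on `τ` for `S(x) = f(x + 1/2)`: one has `v u f(z) = P(z - 1/2) f(z)` and
-- `u f(z) v = P(z + 1/2) f(z + 1)`.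
theorem trace_v_mul (f : ℂ[X]) :
    τ (weightZero P (gen P Gen.v * (gen P Gen.u * pz P f)))
      = t * τ (weightZero P (gen P Gen.u * pz P f * gen P Gen.v)) := by
  have h1 := hτ (f.comp (Polynomial.X + Polynomial.C (1 / 2)))
  rw [← mul_assoc, v_mul_u, ← map_mul, weightZero_pz, mul_assoc, (hasWeight_v P).pz_mul,
    ← mul_assoc, u_mul_v, ← map_mul, weightZero_pz]
  rw [Polynomial.mul_comp, Polynomial.mul_comp, comp_add_comp_sub, Polynomial.comp_assoc f] at h1
  have e : (Polynomial.X + Polynomial.C (1 / 2 : ℂ)).comp (Polynomial.X + Polynomial.C (1 / 2))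
      = Polynomial.X + Polynomial.C 1 := by
    simp only [Polynomial.add_comp, Polynomial.X_comp, Polynomial.C_comp]
    rw [add_assoc, ← Polynomial.C_add]
    norm_num
  rw [e, sub_self, Polynomial.C_0, add_zero, Polynomial.comp_X] at h1
  exact h1

include hτ ht0 in
theorem trace_u_mul (f : ℂ[X]) :
    τ (weightZero P (gen P Gen.u * (gen P Gen.v * pz P f)))
      = t⁻¹ * τ (weightZero P (gen P Gen.v * pz P f * gen P Gen.u)) := by
  have h1 := trace_v_mul hτ (f.comp (Polynomial.X + Polynomial.C (-1)))
  rw [eq_inv_mul_iff_mul_eq₀ ht0, mul_assoc (gen P Gen.v), (hasWeight_u P).pz_mul, h1]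
  congr 3
  rw [mul_assoc, (hasWeight_v P).mul_pz, Polynomial.C_neg, sub_eq_add_neg]

include ht ht' ht0 hτ in
-- The identity passes to products and sums in `a`, so generators suffice. Against an element of
-- weight `k`, both sides vanish for `u` and `v` unless the total weight is `0`, which leaves
-- `trace_v_mul` and `trace_u_mul`.
theorem trace_mul_comm (a b : Alg P) : τ (weightZero P (a * b))
    = τ (weightZero P (b * conjugation P lm lm' h (conjugation P lm lm' h a))) := by
  induction a using alg_induction generalizing b with
  | hs r =>
    rw [conjugation_algebraMap, conjugation_algebraMap, Complex.conj_conj, Algebra.commutes]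
  | hm a a' h1 h2 =>
    rw [mul_assoc, h1, mul_assoc, h2, conjugation_mul, conjugation_mul, mul_assoc]
  | ha a a' h1 h2 =>
    rw [add_mul, map_add, map_add, h1, h2, map_add, map_add, mul_add, map_add, map_add]
  | hg g =>
    induction b using alg_span_induction with
    | h0 => simp
    | ha b b' h1 h2 => rw [mul_add, map_add, map_add, h1, h2, add_mul, map_add, map_add]
    | h k f =>
      have hw := hasWeight_mono_mul_pz P k f
      cases g with
      | z =>
        rw [conjugation_z, map_neg, conjugation_z, neg_neg]
        have hz : gen P Gen.z = pz P Polynomial.X := by simp [pz]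
        rw [hz, weightZero_pz_mul, weightZero_mul_pz P Polynomial.X]
      | v =>
        rw [conjugation_conjugation_v ht, mul_smul_comm, map_smul, map_smul, smul_eq_mul]
        rcases eq_or_ne k (-1) with rfl | hk
        · have e : mono P (-1) = gen P Gen.u := pow_one _
          rw [e]
          exact trace_v_mul hτ f
        · have hk' : (1 : ℂ) + k ≠ 0 := by
            intro h0
            apply hk
            have : (1 : ℤ) + k = 0 := by exact_mod_cast h0
            omega
          rw [weightZero_eq_zero ((hasWeight_v P).mul hw) hk',
            weightZero_eq_zero (hw.mul (hasWeight_v P)) (by rwa [add_comm]), map_zero, mul_zero]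
      | u =>
        rw [conjugation_conjugation_u ht', mul_smul_comm, map_smul, map_smul, smul_eq_mul]
        rcases eq_or_ne k 1 with rfl | hk
        · have e : mono P 1 = gen P Gen.v := pow_one _
          rw [e]
          exact trace_u_mul ht0 hτ f
        · have hk' : (-1 : ℂ) + k ≠ 0 := by
            intro h0
            apply hk
            have : (-1 : ℤ) + k = 0 := by exact_mod_cast h0
            omega
          rw [weightZero_eq_zero ((hasWeight_u P).mul hw) hk',
            weightZero_eq_zero (hw.mul (hasWeight_u P)) (by rwa [add_comm]), map_zero, mul_zero]

theorem trace_conjugation (hreal : ∀ f, τ (sharp f) = (starRingEnd ℂ) (τ f)) (a : Alg P) :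
    τ (weightZero P (conjugation P lm lm' h a)) = (starRingEnd ℂ) (τ (weightZero P a)) := by
  induction a using alg_span_induction with
  | h0 => simp
  | ha a b h1 h2 => rw [map_add, map_add, map_add, h1, h2, map_add, map_add, map_add]
  | h k f =>
    have hw := hasWeight_mono_mul_pz P k f
    rcases eq_or_ne k 0 with rfl | hk
    · have e : mono P 0 = 1 := pow_zero _
      rw [e, one_mul, conjugation_pz, weightZero_pz, weightZero_pz, hreal]
    · rw [weightZero_eq_zero hw (by exact_mod_cast hk),
        weightZero_eq_zero hw.conjugation (neg_ne_zero.mpr (by exact_mod_cast hk)), map_zero,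
        map_zero]

include ht ht' ht0 hτ in
theorem formOf_hermitian (hreal : ∀ f, τ (sharp f) = (starRingEnd ℂ) (τ f)) (a b : Alg P) :
    formOf h τ b a = (starRingEnd ℂ) (formOf h τ a b) := by
  rw [formOf_apply, formOf_apply, ← trace_conjugation (h := h) hreal, conjugation_mul,
    trace_mul_comm (h := h) ht ht' ht0 hτ b]

include ht ht' ht0 hτ in
/-- Moving a palindromic factor inside the form. -/
theorem formOf_palindrome (w x : Alg P) :
    formOf h τ (w * x * w) (w * x * w)
      = formOf h τ (x * (w * conjugation P lm lm' h w)) (x * (w * conjugation P lm lm' h w)) := by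
  rw [formOf_apply, formOf_apply, mul_assoc w, mul_assoc w,
    trace_mul_comm (h := h) ht ht' ht0 hτ w]
  simp only [map_mul, mul_assoc]

end

section
variable {P : ℂ[X]} {lm lm' : ℂ}
    {h : (P.map (starRingEnd ℂ)).comp (-Polynomial.X) = Polynomial.C (lm * lm') * P}
    {t : ℂ} (ht : (starRingEnd ℂ) lm * lm' = t) (ht' : (starRingEnd ℂ) lm' * lm = t⁻¹)
    (ht0 : t ≠ 0) {τ : ℂ[X] →ₗ[ℂ] ℂ}
    (hτ : ∀ S, τ ((P * S).comp (Polynomial.X - Polynomial.C (1 / 2)))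
      = t * τ ((P * S).comp (Polynomial.X + Polynomial.C (1 / 2))))

theorem formOf_pz (f : ℂ[X]) : formOf h τ (pz P f) (pz P f) = τ (f * sharp f) := by
  rw [formOf_apply, conjugation_pz, ← map_mul, weightZero_pz]

theorem v_mul_pz_mul_u (f : ℂ[X]) : gen P Gen.v * pz P f * gen P Gen.u
    = pz P (P.comp (Polynomial.X - Polynomial.C (1 / 2)) *
        f.comp (Polynomial.X + Polynomial.C (-1))) := by
  rw [mul_assoc, (hasWeight_u P).pz_mul, ← mul_assoc, v_mul_u, ← map_mul]

theorem u_mul_pz_mul_v (f : ℂ[X]) : gen P Gen.u * pz P f * gen P Gen.v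
    = pz P (P.comp (Polynomial.X + Polynomial.C (1 / 2)) *
        f.comp (Polynomial.X + Polynomial.C 1)) := by
  rw [mul_assoc, (hasWeight_v P).pz_mul, ← mul_assoc, u_mul_v, ← map_mul]

/-- Moving `v` and `u` together shifts `f` by `1` and leaves `sharp f` alone; recentring at `R = f(x
- 1/2)` restores the symmetric shape `R · sharp R`. -/
theorem formOf_v_mul_pz (f : ℂ[X]) :
    formOf h τ (gen P Gen.v * pz P f) (gen P Gen.v * pz P f)
      = lm * τ ((P * (f.comp (Polynomial.X - Polynomial.C (1 / 2)) *
          sharp (f.comp (Polynomial.X - Polynomial.C (1 / 2))))).comp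
            (Polynomial.X - Polynomial.C (1 / 2))) := by
  rw [formOf_apply, conjugation_mul, conjugation_v, conjugation_pz, smul_mul_assoc,
    mul_smul_comm, map_smul, map_smul, smul_eq_mul, ← mul_assoc, v_mul_pz_mul_u, ← map_mul,
    weightZero_pz]
  congr 2
  refine Polynomial.funext fun z => ?_
  simp only [Polynomial.eval_mul, Polynomial.eval_comp, Polynomial.eval_add, Polynomial.eval_sub,
    Polynomial.eval_X, Polynomial.eval_C, sharp_eval, mul_assoc]
  congr 3
  · ring
  · congr 1
    simp [map_ofNat (starRingEnd ℂ) 2]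

theorem formOf_u_mul_pz (f : ℂ[X]) :
    formOf h τ (gen P Gen.u * pz P f) (gen P Gen.u * pz P f)
      = lm' * τ ((P * (f.comp (Polynomial.X + Polynomial.C (1 / 2)) *
          sharp (f.comp (Polynomial.X + Polynomial.C (1 / 2))))).comp
            (Polynomial.X + Polynomial.C (1 / 2))) := by
  rw [formOf_apply, conjugation_mul, conjugation_u, conjugation_pz, smul_mul_assoc,
    mul_smul_comm, map_smul, map_smul, smul_eq_mul, ← mul_assoc, u_mul_pz_mul_v, ← map_mul,
    weightZero_pz]
  congr 2
  refine Polynomial.funext fun z => ?_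
  simp only [Polynomial.eval_mul, Polynomial.eval_comp, Polynomial.eval_add,
    Polynomial.eval_X, Polynomial.eval_C, sharp_eval, mul_assoc]
  congr 3
  · ring
  · congr 1
    simp [map_ofNat (starRingEnd ℂ) 2]

include ht ht' ht0 hτ in
-- By commuting polynomials past `w`, `w^{2j} f = w^j f' w^j` and `w^{2j+1} f = w^j (w f') w^j`. The
-- palindrome identity replaces the outer factors by `w^j ρ(w^j)`, a nonzero polynomial in `z`, so
-- only the exponents `0` and `1` need to be tested.
theorem formOf_pow_mul_pz_pos {w : Alg P} {r : ℂ} (hw : HasWeight w r)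
    (hF : ∀ f : ℂ[X], f ≠ 0 → ∃ G : ℂ[X], G ≠ 0 ∧
      w * pz P f * conjugation P lm lm' h w = pz P G)
    (h0 : ∀ f : ℂ[X], f ≠ 0 → 0 < (formOf h τ (pz P f) (pz P f)).re)
    (h1 : ∀ f : ℂ[X], f ≠ 0 → 0 < (formOf h τ (w * pz P f) (w * pz P f)).re) (k : ℕ)
    {f : ℂ[X]} (hf : f ≠ 0) : 0 < (formOf h τ (w ^ k * pz P f) (w ^ k * pz P f)).re := by
  have hpow : ∀ j : ℕ, ∃ G : ℂ[X], G ≠ 0 ∧ w ^ j * conjugation P lm lm' h (w ^ j) = pz P G := by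
    intro j
    induction j with
    | zero => exact ⟨1, one_ne_zero, by simp⟩
    | succ j ih =>
      obtain ⟨G, hG, h2⟩ := ih
      obtain ⟨G', hG', h3⟩ := hF G hG
      refine ⟨G', hG', ?_⟩
      rw [← h3, ← h2]
      -- `w^{j+1} ρ(w^{j+1})` is `w^j ρ(w^j)` enclosed between `w` and `ρ(w)`, the shape covered by
      -- `hF`.
      conv_lhs => rw [pow_succ', ← pow_succ', pow_succ w j, conjugation_mul, ← pow_succ, pow_succ']
      simp only [mul_assoc]
  obtain ⟨j, hj⟩ := Nat.even_or_odd' k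
  obtain ⟨G, hG, h2⟩ := hpow j
  have hf' := comp_X_sub_C_ne_zero hf (j * r)
  have h3 := (hw.pow j).mul_pz f
  rcases hj with rfl | rfl
  · have e : w ^ (2 * j) * pz P f
        = w ^ j * pz P (f.comp (Polynomial.X - Polynomial.C (j * r))) * w ^ j := by
      rw [two_mul, pow_add, mul_assoc, h3, mul_assoc]
    rw [e, formOf_palindrome ht ht' ht0 hτ, h2, ← map_mul]
    exact h0 _ (mul_ne_zero hf' hG)
  · have e : w ^ (2 * j + 1) * pz P f
        = w ^ j * (w * pz P (f.comp (Polynomial.X - Polynomial.C (j * r)))) * w ^ j := by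
      rw [two_mul, add_assoc, add_comm j 1, pow_add, pow_add, pow_one, mul_assoc, mul_assoc, h3,
        mul_assoc, mul_assoc]
    rw [e, formOf_palindrome ht ht' ht0 hτ, h2, mul_assoc w, ← map_mul]
    exact h1 _ (mul_ne_zero hf' hG)

include ht ht' ht0 hτ in
-- Distinct weights are orthogonal, so positivity is checked on each `mono P k * pz P f`. Weights
-- `0` and `1` are the hypotheses, and weight `-1` follows from weight `1` through the trace
-- identity.
theorem formOf_mem_posCone (hP : P ≠ 0) (hlm : lm * (starRingEnd ℂ) lm = 1)
    (hreal : ∀ f, τ (sharp f) = (starRingEnd ℂ) (τ f))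
    (hpos : ∀ R : ℂ[X], R ≠ 0 → 0 < (τ (R * sharp R)).re)
    (hpos' : ∀ R : ℂ[X], R ≠ 0 →
      0 < (lm * τ ((P * (R * sharp R)).comp (Polynomial.X - Polynomial.C (1 / 2)))).re) :
    formOf h τ ∈ posCone P (conjugation P lm lm' h) := by
  refine ⟨formOf_hermitian ht ht' ht0 hτ hreal, formOf_invariant τ, fun a ha => ?_⟩
  have hlm0 : lm ≠ 0 := left_ne_zero_of_mul_eq_one hlm
  have hlm0' : lm' ≠ 0 := fun h0 => ht0 (by rw [← ht, h0, mul_zero])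
  have hV0 : ∀ f : ℂ[X], f ≠ 0 → 0 < (formOf h τ (pz P f) (pz P f)).re := fun f hf => by
    rw [formOf_pz]
    exact hpos f hf
  have hsmul : ∀ (r : ℂ) (f : ℂ[X]), r • pz P f = pz P (r • f) := fun r f => (map_smul _ r f).symm
  have hmono : ∀ (k : ℤ) (f : ℂ[X]), f ≠ 0 →
      0 < (formOf h τ (mono P k * pz P f) (mono P k * pz P f)).re := by
    intro k f hf
    cases k with
    | ofNat k =>
      refine formOf_pow_mul_pz_pos ht ht' ht0 hτ (hasWeight_v P) (fun f hf => ?_) hV0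
        (fun f hf => ?_) k hf
      · rw [conjugation_v, mul_smul_comm, v_mul_pz_mul_u, hsmul]
        exact ⟨_, smul_ne_zero hlm0 (mul_ne_zero (comp_X_sub_C_ne_zero hP _)
          (comp_X_add_C_ne_zero hf _)), rfl⟩
      · rw [formOf_v_mul_pz]
        exact hpos' _ (comp_X_sub_C_ne_zero hf _)
    | negSucc k =>
      refine formOf_pow_mul_pz_pos ht ht' ht0 hτ (hasWeight_u P) (fun f hf => ?_) hV0
        (fun f hf => ?_) (k + 1) hf
      · rw [conjugation_u, mul_smul_comm, u_mul_pz_mul_v, hsmul]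
        exact ⟨_, smul_ne_zero hlm0' (mul_ne_zero (comp_X_add_C_ne_zero hP _)
          (comp_X_add_C_ne_zero hf _)), rfl⟩
      · have e : lm' = lm * t := by
          rw [← ht, ← mul_assoc, hlm, one_mul]
        rw [formOf_u_mul_pz, e, mul_assoc, ← hτ]
        exact hpos' _ (comp_X_add_C_ne_zero hf _)
  obtain ⟨F, rfl⟩ := assemble_surjective P a
  have hF : F ≠ 0 := fun h0 => ha (by rw [h0, map_zero])
  have hsum : formOf h τ (assemble P F) (assemble P F)
      = ∑ k ∈ F.support, formOf h τ (mono P k * pz P (F k)) (mono P k * pz P (F k)) := by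
    rw [assemble_apply, map_sum]
    refine Finset.sum_congr rfl fun k hk => ?_
    rw [map_sum (formOf h τ), LinearMap.sum_apply]
    refine Finset.sum_eq_single_of_mem k hk fun l _ hlk => ?_
    exact formOf_eq_zero_of_weight τ (hasWeight_mono_mul_pz P l _) (hasWeight_mono_mul_pz P k _)
      hlk
  rw [hsum, Complex.re_sum]
  exact Finset.sum_pos (fun k hk => hmono k _ (Finsupp.mem_support_iff.mp hk))
    (Finsupp.support_nonempty_iff.mpr hF)

theorem conjugation_surjective (hlm : lm ≠ 0) (hlm' : lm' ≠ 0) :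
    Function.Surjective (conjugation P lm lm' h) := by
  intro a
  induction a using alg_induction with
  | hs r => exact ⟨algebraMap ℂ (Alg P) ((starRingEnd ℂ) r), by
      rw [conjugation_algebraMap, Complex.conj_conj]⟩
  | hm a b h1 h2 =>
    obtain ⟨x, rfl⟩ := h1
    obtain ⟨y, rfl⟩ := h2
    exact ⟨x * y, conjugation_mul x y⟩
  | ha a b h1 h2 =>
    obtain ⟨x, rfl⟩ := h1
    obtain ⟨y, rfl⟩ := h2
    exact ⟨x + y, map_add _ x y⟩
  | hg g =>
    cases g with
    | z => exact ⟨-gen P Gen.z, by rw [map_neg, conjugation_z, neg_neg]⟩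
    | v =>
      refine ⟨(starRingEnd ℂ) lm'⁻¹ • gen P Gen.u, ?_⟩
      rw [conjugation_smul, conjugation_u, Complex.conj_conj, smul_smul, inv_mul_cancel₀ hlm',
        one_smul]
    | u =>
      refine ⟨(starRingEnd ℂ) lm⁻¹ • gen P Gen.v, ?_⟩
      rw [conjugation_smul, conjugation_v, Complex.conj_conj, smul_smul, inv_mul_cancel₀ hlm,
        one_smul]

include ht in
/-- Positive definite invariant Hermitian forms come from traces on `ℂ[z]`. -/
theorem exists_eq_formOf (hlm : lm ≠ 0) (hlm' : lm' ≠ 0) {B : SesqForm P}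
    (hB : B ∈ posCone P (conjugation P lm lm' h)) :
    ∃ τ : ℂ[X] →ₗ[ℂ] ℂ, B = formOf h τ ∧
      (∀ S, τ ((P * S).comp (Polynomial.X - Polynomial.C (1 / 2)))
        = t * τ ((P * S).comp (Polynomial.X + Polynomial.C (1 / 2)))) ∧
      (∀ R, 0 ≤ (τ (R * sharp R)).re ∧ (τ (R * sharp R)).im = 0) ∧
      (∀ R, 0 ≤ (lm * τ ((P * (R * sharp R)).comp (Polynomial.X - Polynomial.C (1 / 2)))).re ∧
        (lm * τ ((P * (R * sharp R)).comp (Polynomial.X - Polynomial.C (1 / 2)))).im = 0) := by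
  obtain ⟨hherm, hinv, hpos⟩ := hB
  set T : Alg P →ₗ[ℂ] ℂ := B.flip 1 with hT
  have hBT : ∀ a b, B a b = T (a * conjugation P lm lm' h b) := by
    intro a b
    rw [hT, LinearMap.flip_apply, hinv, mul_one]
  have hTconj : ∀ a, T (conjugation P lm lm' h a) = (starRingEnd ℂ) (T a) := by
    intro a
    have := hherm a 1
    rwa [hBT, one_mul] at this
  -- As `ρ` is onto, `x = ρ(y)`, and the twisted trace property is the Hermitian symmetry of `B(a,
  -- y)`.
  have htr : ∀ a x, T (a * x)
      = T (x * conjugation P lm lm' h (conjugation P lm lm' h a)) := by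
    intro a x
    obtain ⟨y, rfl⟩ := conjugation_surjective (h := h) hlm hlm' x
    rw [← hBT, hherm, hBT, ← hTconj, conjugation_mul]
  -- `ρ²` fixes `z`, so `T` vanishes on commutators with `z` and hence on all nonzero weights.
  have hz : ∀ a, T (gen P Gen.z * a) = T (a * gen P Gen.z) := by
    intro a
    rw [htr, conjugation_z, map_neg, conjugation_z, neg_neg]
  set τ : ℂ[X] →ₗ[ℂ] ℂ := T ∘ₗ (Polynomial.aeval (gen P Gen.z)).toLinearMap with hτdef
  have hτ : ∀ f, τ f = T (pz P f) := fun f => rfl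
  have hTτ : ∀ a, T a = τ (weightZero P a) := by
    intro a
    induction a using alg_span_induction with
    | h0 => simp
    | ha a b h1 h2 => rw [map_add, h1, h2, map_add, map_add]
    | h k f =>
      rcases eq_or_ne k 0 with rfl | hk
      · have e : mono P 0 = 1 := pow_zero _
        rw [e, one_mul, weightZero_pz, hτ]
      · have hk' : (k : ℂ) ≠ 0 := by exact_mod_cast hk
        have hw := hasWeight_mono_mul_pz P k f
        rw [weightZero_eq_zero hw hk', map_zero]
        have h1 := congrArg T hw
        rw [map_sub, hz, sub_self, map_smul] at h1
        exact (smul_eq_zero.mp h1.symm).resolve_left hk'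
  have hBf : B = formOf h τ := by
    refine LinearMap.ext fun a => LinearMap.ext fun b => ?_
    rw [hBT, hTτ, formOf_apply]
  have him : ∀ a, (B a a).im = 0 := fun a => Complex.conj_eq_iff_im.mp (hherm a a).symm
  have hre : ∀ a, 0 ≤ (B a a).re := by
    intro a
    rcases eq_or_ne a 0 with rfl | ha
    · simp
    · exact (hpos a ha).le
  refine ⟨τ, hBf, fun S => ?_, fun R => ?_, fun R => ?_⟩
  -- The trace identity for `τ` is the twisted trace property for `v` against `u S(z - 1/2)`.
  · have h1 := htr (gen P Gen.v)
      (gen P Gen.u * pz P (S.comp (Polynomial.X - Polynomial.C (1 / 2))))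
    rw [conjugation_conjugation_v ht, mul_smul_comm, map_smul, smul_eq_mul, ← mul_assoc, v_mul_u,
      ← map_mul, u_mul_pz_mul_v, ← hτ, ← hτ, ← Polynomial.mul_comp] at h1
    rw [h1]
    congr 2
    refine Polynomial.funext fun z => ?_
    simp only [Polynomial.eval_mul, Polynomial.eval_comp, Polynomial.eval_add, Polynomial.eval_sub,
      Polynomial.eval_X, Polynomial.eval_C]
    congr 2
    ring
  · rw [← formOf_pz (h := h), ← hBf]
    exact ⟨hre _, him _⟩
  · have h1 := formOf_v_mul_pz (h := h) (τ := τ) (R.comp (Polynomial.X + Polynomial.C (1 / 2)))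
    rw [comp_add_comp_sub, sub_self, Polynomial.C_0, add_zero, Polynomial.comp_X] at h1
    rw [← h1, ← hBf]
    exact ⟨hre _, him _⟩

end

/-! ### Cones of nonnegative real polynomials -/

theorem leadingCoeff_nonneg_of_eval_nonneg {h : ℝ[X]} (hh : ∀ x, 0 ≤ h.eval x) :
    0 ≤ h.leadingCoeff := by
  by_contra! hlc
  by_cases hd : 0 < h.degree
  · have h1 := h.tendsto_atBot_of_leadingCoeff_nonpos hd hlc.le
    obtain ⟨x, hx⟩ := (h1.eventually_lt_atBot 0).exists
    exact absurd (hh x) (not_le.mpr hx)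
  · rw [Polynomial.eq_C_of_degree_le_zero (not_lt.mp hd)] at hlc hh
    have := hh 0
    simp only [Polynomial.eval_C, Polynomial.leadingCoeff_C] at this hlc
    linarith

theorem even_natDegree_of_eval_nonneg {h : ℝ[X]} (h0 : h ≠ 0) (hh : ∀ x, 0 ≤ h.eval x) :
    Even h.natDegree := by
  by_contra hodd
  rw [Nat.not_even_iff_odd] at hodd
  have h1 := leadingCoeff_nonneg_of_eval_nonneg hh
  have h2 := leadingCoeff_nonneg_of_eval_nonneg (h := h.comp (-Polynomial.X))
    (fun x => by simpa using hh (-x))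
  rw [Polynomial.leadingCoeff_comp (by simp), Polynomial.leadingCoeff_neg,
    Polynomial.leadingCoeff_X, hodd.neg_one_pow] at h2
  have h3 : h.leadingCoeff ≠ 0 := Polynomial.leadingCoeff_ne_zero.mpr h0
  exact h3 (le_antisymm (by linarith) h1)

/-- The nonzero nonnegative real polynomials of degree less than `N`. -/
def nonnegPoly (N : ℕ) : Set (Polynomial.degreeLT ℝ N) :=
  {h | h ≠ 0 ∧ ∀ x : ℝ, 0 ≤ (h : ℝ[X]).eval x}

theorem coe_image_nonnegPoly (N : ℕ) : (Polynomial.degreeLT ℝ N).subtype '' nonnegPoly N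
    = {h : ℝ[X] | h.degree < N ∧ h ≠ 0 ∧ ∀ x : ℝ, 0 ≤ h.eval x} := by
  ext h
  constructor
  · rintro ⟨h, ⟨h0, h1⟩, rfl⟩
    exact ⟨Polynomial.mem_degreeLT.mp h.2, fun h2 => h0 (Subtype.ext h2), h1⟩
  · rintro ⟨h1, h2, h3⟩
    exact ⟨⟨h, Polynomial.mem_degreeLT.mpr h1⟩, ⟨fun h0 => h2 (congrArg Subtype.val h0), h3⟩, rfl⟩

/-- Even powers are nonnegative, and `x^{2l+1}` is half of `(x^{l+1} + x^l)² - x^{2l+2} - x^{2l}`.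
Oddness of the bound `2j + 1` leaves room for the term `x^{2l+2}`. -/
theorem span_nonneg_odd (j : ℕ) : Submodule.span ℝ
    {h : ℝ[X] | h.degree < (2 * j + 1 : ℕ) ∧ h ≠ 0 ∧ ∀ x : ℝ, 0 ≤ h.eval x}
      = Polynomial.degreeLT ℝ (2 * j + 1) := by
  refine le_antisymm (Submodule.span_le.mpr fun h hh => Polynomial.mem_degreeLT.mpr hh.1) ?_
  rw [Polynomial.degreeLT_eq_span_X_pow, Submodule.span_le]
  intro p hp
  simp only [Finset.coe_image, Set.mem_image, Finset.mem_coe, Finset.mem_range] at hp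
  obtain ⟨i, hi, rfl⟩ := hp
  have heven : ∀ l, l ≤ j → (Polynomial.X ^ (2 * l) : ℝ[X]) ∈ Submodule.span ℝ
      {h : ℝ[X] | h.degree < (2 * j + 1 : ℕ) ∧ h ≠ 0 ∧ ∀ x : ℝ, 0 ≤ h.eval x} := by
    intro l hl
    refine Submodule.subset_span ⟨?_, pow_ne_zero _ Polynomial.X_ne_zero, fun x => ?_⟩
    · rw [Polynomial.degree_X_pow]
      exact_mod_cast (by omega : 2 * l < 2 * j + 1)
    · rw [Polynomial.eval_pow, Polynomial.eval_X, pow_mul]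
      positivity
  obtain ⟨l, rfl | rfl⟩ := Nat.even_or_odd' i
  · exact heven l (by omega)
  · have hsq : ((Polynomial.X ^ (l + 1) + Polynomial.X ^ l) ^ 2 : ℝ[X]) ∈ Submodule.span ℝ
        {h : ℝ[X] | h.degree < (2 * j + 1 : ℕ) ∧ h ≠ 0 ∧ ∀ x : ℝ, 0 ≤ h.eval x} := by
      refine Submodule.subset_span ⟨?_, fun h0 => ?_, fun x => ?_⟩
      · refine (Polynomial.degree_pow_le _ _).trans_lt ?_
        have h1 : (Polynomial.X ^ (l + 1) + Polynomial.X ^ l : ℝ[X]).degree ≤ (l + 1 : ℕ) := by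
          refine (Polynomial.degree_add_le _ _).trans (max_le ?_ ?_)
          · rw [Polynomial.degree_X_pow]
          · rw [Polynomial.degree_X_pow]
            exact_mod_cast Nat.le_succ l
        refine (nsmul_le_nsmul_right h1 2).trans_lt ?_
        rw [two_nsmul]
        exact_mod_cast (by omega : (l + 1) + (l + 1) < 2 * j + 1)
      · have := congrArg (Polynomial.eval 1) h0
        norm_num at this
      · rw [Polynomial.eval_pow]
        positivity
    have e : (Polynomial.X ^ (2 * l + 1) : ℝ[X]) = (1 / 2 : ℝ) •
        ((Polynomial.X ^ (l + 1) + Polynomial.X ^ l) ^ 2 - Polynomial.X ^ (2 * (l + 1))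
          - Polynomial.X ^ (2 * l)) := by
      have e2 : ((Polynomial.X ^ (l + 1) + Polynomial.X ^ l) ^ 2 - Polynomial.X ^ (2 * (l + 1))
          - Polynomial.X ^ (2 * l) : ℝ[X]) = (2 : ℝ) • Polynomial.X ^ (2 * l + 1) := by
        rw [Polynomial.smul_eq_C_mul, map_ofNat]
        ring
      rw [e2, smul_smul]
      norm_num
    rw [e]
    exact Submodule.smul_mem _ _ (Submodule.sub_mem _ (Submodule.sub_mem _ hsq
      (heven (l + 1) (by omega))) (heven l (by omega)))

/-- A nonnegative polynomial has even degree, so for even `N` the bound `N` may be replaced by `N -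
1`. -/
theorem finrank_span_nonnegPoly {N : ℕ} (hN : 0 < N) :
    Module.finrank ℝ (Submodule.span ℝ (nonnegPoly N)) = if Even N then N - 1 else N := by
  have hfin : ∀ k, Module.finrank ℝ (Polynomial.degreeLT ℝ k) = k := fun k => by
    rw [(Polynomial.degreeLTEquiv ℝ k).finrank_eq, Module.finrank_fin_fun]
  rw [(Submodule.equivMapOfInjective _ (Submodule.subtype_injective _) _).finrank_eq,
    Submodule.map_span, coe_image_nonnegPoly]
  obtain ⟨j, rfl | rfl⟩ := Nat.even_or_odd' N
  · obtain ⟨i, rfl⟩ : ∃ i, j = i + 1 := ⟨j - 1, by omega⟩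
    have e : {h : ℝ[X] | h.degree < (2 * (i + 1) : ℕ) ∧ h ≠ 0 ∧ ∀ x : ℝ, 0 ≤ h.eval x}
        = {h : ℝ[X] | h.degree < (2 * i + 1 : ℕ) ∧ h ≠ 0 ∧ ∀ x : ℝ, 0 ≤ h.eval x} := by
      ext h
      refine and_congr_left fun ⟨h0, hh⟩ => ?_
      rw [← Polynomial.natDegree_lt_iff_degree_lt h0, ← Polynomial.natDegree_lt_iff_degree_lt h0]
      obtain ⟨k, hk⟩ := even_natDegree_of_eval_nonneg h0 hh
      omega
    rw [e, span_nonneg_odd, hfin, if_pos (even_two_mul _)]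
    omega
  · rw [span_nonneg_odd, hfin, if_neg (by simp)]

theorem nonnegPoly_zero : nonnegPoly 0 = ∅ := by
  ext h
  simp only [nonnegPoly, Set.mem_ofPred_eq, Set.mem_empty_iff_false, iff_false, not_and]
  intro h0
  have h1 := (Polynomial.degree_lt_iff_coeff_zero _ _).mp (Polynomial.mem_degreeLT.mp h.2)
  exact absurd (Subtype.ext (Polynomial.ext fun k => by simpa using h1 k (Nat.zero_le k))) h0

theorem nonnegPoly_nonempty {N : ℕ} (hN : 0 < N) : (nonnegPoly N).Nonempty := by
  refine ⟨⟨1, Polynomial.mem_degreeLT.mpr ?_⟩, fun h0 => ?_, fun x => by simp⟩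
  · rw [Polynomial.degree_one]
    exact_mod_cast hN
  · exact one_ne_zero (congrArg Subtype.val h0)

theorem ofReal_map_eval (h : ℝ[X]) (x : ℝ) :
    (h.map Complex.ofRealHom).eval (x : ℂ) = (h.eval x : ℝ) :=
  Polynomial.eval_map_apply (f := Complex.ofRealHom) x

theorem exists_real_polynomial {g : ℂ[X]} (hg : ∀ x : ℝ, 0 < x → (g.eval (x : ℂ)).im = 0) :
    ∃ h : ℝ[X], h.map Complex.ofRealHom = g := by
  have h1 : g.map (starRingEnd ℂ) = g := by
    refine Polynomial.eq_of_infinite_eval_eq _ _ ?_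
    refine Set.Infinite.mono (s := (fun x : ℝ => (x : ℂ)) '' Set.Ioi 0) ?_
      ((Set.Ioi_infinite 0).image Complex.ofReal_injective.injOn)
    rintro _ ⟨x, hx, rfl⟩
    have h2 := Polynomial.eval_map_apply (f := starRingEnd ℂ) (p := g) (x : ℂ)
    rw [Complex.conj_ofReal] at h2
    change Polynomial.eval (x : ℂ) _ = _
    rw [h2]
    exact Complex.conj_eq_iff_im.mpr (hg x hx)
  have h3 : g ∈ Polynomial.lifts Complex.ofRealHom := by
    rw [Polynomial.lifts_iff_coeff_lifts]
    intro k
    have h4 := congrArg (fun p => Polynomial.coeff p k) h1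
    simp only [Polynomial.coeff_map] at h4
    exact ⟨(g.coeff k).re, Complex.conj_eq_iff_re.mp h4⟩
  exact (Polynomial.mem_lifts _).mp h3

theorem eval_nonneg_of_ne_zero {h : ℝ[X]} (hh : ∀ x, x ≠ 0 → 0 ≤ h.eval x) (x : ℝ) :
    0 ≤ h.eval x := by
  have hc : IsClosed {x : ℝ | 0 ≤ h.eval x} := isClosed_le continuous_const h.continuous
  have hd : Dense ({0}ᶜ : Set ℝ) := dense_compl_singleton 0
  exact hc.closure_subset_iff.mpr (fun x hx => hh x hx) (hd x)

/-- Continuity forces a zero at the origin; the quotient by `x` is nonnegative off `0`, hence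
everywhere. -/
theorem eq_X_mul_of_sign_change {g : ℝ[X]} (h1 : ∀ x, 0 < x → 0 ≤ g.eval x)
    (h2 : ∀ x, x < 0 → g.eval x ≤ 0) :
    ∃ h : ℝ[X], g = Polynomial.X * h ∧ ∀ x, 0 ≤ h.eval x := by
  have hp : 0 ≤ g.eval 0 := by
    have hc : IsClosed {x : ℝ | 0 ≤ g.eval x} := isClosed_le continuous_const g.continuous
    have := hc.closure_subset_iff.mpr (fun x (hx : x ∈ Set.Ioi (0 : ℝ)) => h1 x hx)
    rw [closure_Ioi] at this
    exact this (Set.self_mem_Ici)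
  have hn : g.eval 0 ≤ 0 := by
    have hc : IsClosed {x : ℝ | g.eval x ≤ 0} := isClosed_le g.continuous continuous_const
    have := hc.closure_subset_iff.mpr (fun x (hx : x ∈ Set.Iio (0 : ℝ)) => h2 x hx)
    rw [closure_Iio] at this
    exact this (Set.self_mem_Iic)
  obtain ⟨h, rfl⟩ := Polynomial.X_dvd_iff.mpr
    ((Polynomial.coeff_zero_eq_eval_zero g).trans (le_antisymm hn hp))
  refine ⟨h, rfl, eval_nonneg_of_ne_zero fun x hx => ?_⟩
  simp only [Polynomial.eval_mul, Polynomial.eval_X] at h1 h2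
  rcases lt_or_gt_of_ne hx with hx | hx
  · exact nonneg_of_mul_nonpos_right (h2 x hx) hx
  · exact nonneg_of_mul_nonneg_right (h1 x hx) hx

theorem exists_exp_eq {y : ℝ} (hy : 0 < y) : ∃ x : ℝ, Real.exp (-(2 * Real.pi * x)) = y := by
  refine ⟨-Real.log y / (2 * Real.pi), ?_⟩
  have : -(2 * Real.pi * (-Real.log y / (2 * Real.pi))) = Real.log y := by
    have := Real.pi_pos
    field_simp
  rw [this, Real.exp_log hy]

theorem re_im_of_real_mul {r : ℝ} (hr : 0 < r) {z : ℂ} (h : 0 ≤ (r * z).re ∧ (r * z).im = 0) :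
    0 ≤ z.re ∧ z.im = 0 := by
  rw [Complex.re_ofReal_mul, Complex.im_ofReal_mul] at h
  exact ⟨nonneg_of_mul_nonneg_right h.1 hr, (mul_eq_zero.mp h.2).resolve_left hr.ne'⟩

/-! ### The positive cone in terms of polynomials -/

section
variable {P : ℂ[X]} (hP : P.Monic) (hA : ∀ α ∈ P.roots, |α.re| < 1 / 2)
  (hsymm : P.roots.map (fun α => -(starRingEnd ℂ) α) = P.roots) {κ : ℝ} (hκ : 0 < κ)
  {m : ℕ} (hm : κ + m < P.roots.card + 1) {g : Polynomial.degreeLT ℂ m}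
include hsymm

theorem traceForm_sharp (hreal : ∀ y : ℝ, 0 < y → ((g : ℂ[X]).eval (y : ℂ)).im = 0) (f : ℂ[X]) :
    traceForm hA hκ hm g (sharp f) = (starRingEnd ℂ) (traceForm hA hκ hm g f) := by
  change (∫ x : ℝ, _) = (starRingEnd ℂ) (∫ x : ℝ, _)
  rw [← integral_conj]
  refine integral_congr_ae (Filter.Eventually.of_forall fun x => ?_)
  obtain ⟨r, hr, h⟩ := exists_wt_eq hA hsymm κ x
  simp only [sharp_eval_mul_I, map_mul]
  congr 1
  rw [h, map_mul, Complex.conj_ofReal, Complex.conj_eq_iff_im.mpr (hreal _ (Real.exp_pos _))]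

/-- The integrand is `|R(ix)|²` times a positive factor times `g(e^{-2πx})`: nonnegative, with
finitely many zeros. -/
theorem traceForm_mul_sharp_pos (hg : (g : ℂ[X]) ≠ 0)
    (hpos : ∀ y : ℝ, 0 < y → 0 ≤ ((g : ℂ[X]).eval (y : ℂ)).re ∧ ((g : ℂ[X]).eval (y : ℂ)).im = 0)
    {R : ℂ[X]} (hR : R ≠ 0) : 0 < (traceForm hA hκ hm g (R * sharp R)).re := by
  refine integral_pos_of_zeros_finite (f := fun x : ℝ => (R * sharp R).eval (x * Complex.I) *
    wt P.roots κ (g : ℂ[X]) x) ((R * sharp R).continuous.comp (by fun_prop) |>.mul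
      (continuous_wt hA _)) (integrable_eval_mul_wt hA hκ hm (Polynomial.mem_degreeLT.mp g.2) _)
    (fun x => ?_) (((finite_eval_mul_I_eq_zero hR).union
      (finite_eval_exp_eq_zero hg one_ne_zero)).subset fun x hx => ?_)
  · obtain ⟨r, hr, h⟩ := exists_wt_eq hA hsymm κ x
    rw [eval_mul_sharp_mul_I, Complex.re_ofReal_mul, h, Complex.re_ofReal_mul]
    exact mul_nonneg (Complex.normSq_nonneg _) (mul_nonneg hr.le (hpos _ (Real.exp_pos _)).1)
  · obtain ⟨r, hr, h⟩ := exists_wt_eq hA hsymm κ x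
    have hx' : ((R * sharp R).eval (x * Complex.I) * wt P.roots κ (g : ℂ[X]) x).re = 0 := hx
    rw [eval_mul_sharp_mul_I, Complex.re_ofReal_mul, h, Complex.re_ofReal_mul, mul_eq_zero,
      mul_eq_zero, or_iff_right hr.ne', Complex.normSq_eq_zero] at hx'
    refine hx'.imp id fun h0 => ?_
    rw [Set.mem_ofPred_eq, one_mul]
    exact Complex.ext h0 (hpos _ (Real.exp_pos _)).2

include hA hκ hm in
theorem integral_mul_sharp_wtHol_pos {σ : ℝ} (hσ : σ ≠ 0) (hg : (g : ℂ[X]) ≠ 0)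
    (hpos : ∀ y : ℝ, 0 < y → 0 ≤ (σ * (g : ℂ[X]).eval (-(y : ℂ))).re ∧
      (σ * (g : ℂ[X]).eval (-(y : ℂ))).im = 0) {R : ℂ[X]} (hR : R ≠ 0) :
    0 < (σ * Complex.I ^ P.roots.card * ∫ x : ℝ, (R * sharp R).eval (x * Complex.I) *
      wtHol P.roots κ (g : ℂ[X]) (x * Complex.I)).re := by
  have hf : ∀ x : ℝ, ∃ r : ℝ, 0 < r ∧ σ * Complex.I ^ P.roots.card *
      ((R * sharp R).eval (x * Complex.I) * wtHol P.roots κ (g : ℂ[X]) (x * Complex.I))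
      = (Complex.normSq (R.eval (x * Complex.I)) : ℝ) * ((r : ℝ) *
        (σ * (g : ℂ[X]).eval (-(Real.exp (-(2 * Real.pi * x)) : ℝ) : ℂ))) := by
    intro x
    obtain ⟨r, hr, h⟩ := exists_wtHol_eq hA hsymm κ x
    refine ⟨r, hr, ?_⟩
    rw [eval_mul_sharp_mul_I]
    linear_combination (σ : ℂ) * (Complex.normSq (R.eval (x * Complex.I)) : ℝ) * h (g : ℂ[X])
  rw [← integral_const_mul]
  refine integral_pos_of_zeros_finite ?_ ((integrable_eval_mul_wtHol hA hκ hm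
      (Polynomial.mem_degreeLT.mp g.2) _).const_mul _)
    (fun x => ?_) (((finite_eval_mul_I_eq_zero hR).union
      (finite_eval_exp_eq_zero hg (neg_ne_zero.mpr one_ne_zero))).subset fun x hx => ?_)
  · refine continuous_const.mul (((R * sharp R).continuous.comp (by fun_prop)).mul ?_)
    exact (differentiableOn_wtHol hA κ _).continuousOn.comp_continuous (by fun_prop) (by simp)
  · obtain ⟨r, hr, h⟩ := hf x
    rw [h, Complex.re_ofReal_mul, Complex.re_ofReal_mul]
    exact mul_nonneg (Complex.normSq_nonneg _) (mul_nonneg hr.le (hpos _ (Real.exp_pos _)).1)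
  · obtain ⟨r, hr, h⟩ := hf x
    have hx' := hx
    rw [Set.mem_ofPred_eq, h, Complex.re_ofReal_mul, Complex.re_ofReal_mul, mul_eq_zero,
      mul_eq_zero, or_iff_right hr.ne', Complex.normSq_eq_zero] at hx'
    refine hx'.imp id fun h0 => ?_
    rw [Set.mem_ofPred_eq, neg_one_mul]
    have h1 : (σ * (g : ℂ[X]).eval (-(Real.exp (-(2 * Real.pi * x)) : ℝ) : ℂ)) = 0 :=
      Complex.ext h0 (hpos _ (Real.exp_pos _)).2
    exact (mul_eq_zero.mp h1).resolve_left (by exact_mod_cast hσ)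

variable {lm lm' : ℂ}
    {h : (P.map (starRingEnd ℂ)).comp (-Polynomial.X) = Polynomial.C (lm * lm') * P}
    (ht : (starRingEnd ℂ) lm * lm' = ex κ) (ht' : (starRingEnd ℂ) lm' * lm = (ex κ)⁻¹)
    (hlm : lm * (starRingEnd ℂ) lm = 1) {σ : ℝ} (hσ : σ ≠ 0)
    (hs : lm * ((-1) ^ P.roots.card * ex (κ / 2)) = σ * Complex.I ^ P.roots.card)

include hP ht ht' hlm hσ hs in
/-- The description of the positive cone by weights. -/
theorem mem_posCone_iff
    (hm' : (ex κ ≠ 1 ∧ m = P.natDegree) ∨ (ex κ = 1 ∧ m + 1 = P.natDegree)) (B : SesqForm P) :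
    B ∈ posCone P (conjugation P lm lm' h) ↔ ∃ g : Polynomial.degreeLT ℂ m, (g : ℂ[X]) ≠ 0 ∧
      (∀ y : ℝ, 0 < y → 0 ≤ ((g : ℂ[X]).eval (y : ℂ)).re ∧
        ((g : ℂ[X]).eval (y : ℂ)).im = 0) ∧
      (∀ y : ℝ, 0 < y → 0 ≤ (σ * (g : ℂ[X]).eval (-(y : ℂ))).re ∧
        (σ * (g : ℂ[X]).eval (-(y : ℂ))).im = 0) ∧
      B = formOf h (traceForm hA hκ hm g) := by
  have hlm0 : lm ≠ 0 := left_ne_zero_of_mul_eq_one hlm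
  have hlm0' : lm' ≠ 0 := fun h0 => ex_ne_zero κ (by rw [← ht, h0, mul_zero])
  constructor
  · intro hB
    obtain ⟨τ, rfl, hτ, hpos, hpos'⟩ := exists_eq_formOf ht hlm0 hlm0' hB
    obtain ⟨g, rfl⟩ := exists_traceForm_eq hP hA hκ hm hm' (τ := τ) fun S => by
      rw [shiftDiff, map_sub, map_smul, hτ, smul_eq_mul, sub_self]
    refine ⟨g, fun hg => ?_, fun y hy => ?_, fun y hy => ?_, rfl⟩
    -- For `g = 0` the form would vanish on the nonzero vector `1`.
    · have hg' : g = 0 := Subtype.ext hg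
      have h1 := hB.2.2 (pz P 1) fun h0 => by
        have := weightZero_pz P 1
        rw [h0, map_zero] at this
        exact zero_ne_one this
      rw [formOf_pz, hg', map_zero] at h1
      simp at h1
    · obtain ⟨x, rfl⟩ := exists_exp_eq hy
      obtain ⟨r, hr, h1⟩ := exists_wt_eq hA hsymm κ x
      have h2 := wt_nonneg_of_traceForm hA hκ hm hpos x
      rw [h1] at h2
      exact re_im_of_real_mul hr h2
    · obtain ⟨x, rfl⟩ := exists_exp_eq hy
      obtain ⟨r, hr, h1⟩ := exists_wtHol_eq hA hsymm κ x
      have h2 := wtHol_nonneg_of_integral hA hκ hm (g := g) (s := σ * Complex.I ^ P.roots.card)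
        (fun R => by
          have h3 := hpos' R
          rwa [traceForm_comp_sub hP, ← mul_assoc, hs] at h3) x
      rw [mul_assoc, h1, mul_left_comm] at h2
      exact re_im_of_real_mul hr h2
  · rintro ⟨g, hg, h1, h2, rfl⟩
    refine formOf_mem_posCone ht ht' (ex_ne_zero κ) (traceForm_shift hP hA hκ hm g) hP.ne_zero hlm
      (traceForm_sharp hA hsymm hκ hm fun y hy => (h1 y hy).2)
      (fun R hR => traceForm_mul_sharp_pos hA hsymm hκ hm hg h1 hR) (fun R hR => ?_)
    -- After the contour shift the constant is `λ (-1)ⁿ e^{πiκ}`, which `hs` identifies as `σ iⁿ`.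
    rw [traceForm_comp_sub hP, ← mul_assoc, hs]
    exact integral_mul_sharp_wtHol_pos hA hsymm hκ hm hσ hg h2 hR

end

/-- The complex polynomial `xˢ h(x)`. -/
def mulXPow (s : ℕ) {N m : ℕ} (hN : ∀ h : ℝ[X], h.degree < (N : WithBot ℕ) →
      (Polynomial.X ^ s * h : ℝ[X]).degree < (m : WithBot ℕ)) :
    Polynomial.degreeLT ℝ N →ₗ[ℝ] Polynomial.degreeLT ℂ m where
  toFun h := ⟨(Polynomial.X ^ s * (h : ℝ[X])).map Complex.ofRealHom, Polynomial.mem_degreeLT.mpr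
    (Polynomial.degree_map_le.trans_lt (hN h (Polynomial.mem_degreeLT.mp h.2)))⟩
  map_add' f g := Subtype.ext (by simp [mul_add])
  map_smul' r f := Subtype.ext (by
    ext k
    simp)

theorem mulXPow_injective (s : ℕ) {N m : ℕ}
    (hN : ∀ h : ℝ[X], h.degree < (N : WithBot ℕ) →
      (Polynomial.X ^ s * h : ℝ[X]).degree < (m : WithBot ℕ)) :
    Function.Injective (mulXPow s hN) := by
  intro f g hfg
  have h1 := Polynomial.map_injective _ Complex.ofRealHom.injective (congrArg Subtype.val hfg)
  exact Subtype.ext (mul_left_cancel₀ (pow_ne_zero s Polynomial.X_ne_zero) h1)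

/-- The form attached to a functional, as a real linear map. -/
def formOfLinear {P : ℂ[X]} {lm lm' : ℂ}
    (h : (P.map (starRingEnd ℂ)).comp (-Polynomial.X) = Polynomial.C (lm * lm') * P) :
    (ℂ[X] →ₗ[ℂ] ℂ) →ₗ[ℝ] SesqForm P where
  toFun τ := formOf h τ
  map_add' _ _ := rfl
  map_smul' _ _ := rfl

theorem formOfLinear_injective {P : ℂ[X]} {lm lm' : ℂ}
    (h : (P.map (starRingEnd ℂ)).comp (-Polynomial.X) = Polynomial.C (lm * lm') * P) :
    Function.Injective (formOfLinear h) := by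
  intro τ τ' hττ
  refine LinearMap.ext fun f => ?_
  have h1 := congrArg (fun B : SesqForm P => B (pz P f) 1) hττ
  change formOf h τ _ _ = formOf h τ' _ _ at h1
  rwa [formOf_apply, formOf_apply, map_one, mul_one, weightZero_pz] at h1

/-- An injective linear map preserves the dimension of the span. For `N = 0` the cone is empty and
`d = -2`; a positive even `N` is at least `2`, so `d ≥ 0`. -/
theorem hasDimModScaling_of_image {V : Type*} [AddCommGroup V] [Module ℝ V] {C : ConvexCone ℝ V}
    {N : ℕ} {Φ : Polynomial.degreeLT ℝ N →ₗ[ℝ] V} (hΦ : Function.Injective Φ)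
    (hC : (C : Set V) = Φ '' nonnegPoly N) {d : ℤ}
    (hd : d = if Even N then (N : ℤ) - 2 else (N : ℤ) - 1) : HasDimModScaling C d := by
  rcases Nat.eq_zero_or_pos N with rfl | hN
  · left
    rw [hC, nonnegPoly_zero, Set.image_empty]
    exact ⟨by rw [hd]; norm_num, rfl⟩
  · right
    have : FiniteDimensional ℝ (Polynomial.degreeLT ℝ N) :=
      (Polynomial.degreeLTEquiv ℝ N).symm.finiteDimensional
    rw [hC, ← Submodule.map_span]
    refine ⟨?_, (nonnegPoly_nonempty hN).image _, inferInstance, ?_⟩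
    · rw [hd]
      split_ifs with he
      · obtain ⟨k, rfl⟩ := he
        push_cast
        omega
      · omega
    · rw [← (Submodule.equivMapOfInjective Φ hΦ _).finrank_eq, finrank_span_nonnegPoly hN, hd]
      split_ifs <;> omega

/-- The cone is the image of the nonnegative polynomials under the injection `f ↦ g = xˢ f`,
followed by weight, trace and form; `hreal` converts the two sign conditions on `g` into
nonnegativity of `f`. -/
theorem hasDimModScaling_posCone {P : ℂ[X]} (hP : P.Monic) (hA : ∀ α ∈ P.roots, |α.re| < 1 / 2)
    (hsymm : P.roots.map (fun α => -(starRingEnd ℂ) α) = P.roots) {κ : ℝ} (hκ : 0 < κ)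
    {m : ℕ} (hm : κ + m < P.roots.card + 1) {lm lm' : ℂ}
    {h : (P.map (starRingEnd ℂ)).comp (-Polynomial.X) = Polynomial.C (lm * lm') * P}
    (ht : (starRingEnd ℂ) lm * lm' = ex κ) (ht' : (starRingEnd ℂ) lm' * lm = (ex κ)⁻¹)
    (hlm : lm * (starRingEnd ℂ) lm = 1) {σ : ℝ} (hσ : σ ≠ 0)
    (hs : lm * ((-1) ^ P.roots.card * ex (κ / 2)) = σ * Complex.I ^ P.roots.card)
    (hm' : (ex κ ≠ 1 ∧ m = P.natDegree) ∨ (ex κ = 1 ∧ m + 1 = P.natDegree)) {s N : ℕ}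
    (hN : ∀ h : ℝ[X], h.degree < (N : WithBot ℕ) →
      (Polynomial.X ^ s * h : ℝ[X]).degree < (m : WithBot ℕ))
    (hreal : ∀ g : ℝ[X], g.degree < (m : WithBot ℕ) → ((∀ y, 0 < y → 0 ≤ g.eval y) ∧
      (∀ y, 0 < y → 0 ≤ σ * g.eval (-y)) ↔
      ∃ f : ℝ[X], f.degree < (N : WithBot ℕ) ∧ g = Polynomial.X ^ s * f ∧ ∀ x, 0 ≤ f.eval x)) {d : ℤ}
    (hd : d = if Even N then (N : ℤ) - 2 else (N : ℤ) - 1) :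
    HasDimModScaling (posCone P (conjugation P lm lm' h)) d := by
  refine hasDimModScaling_of_image (N := N)
    (Φ := formOfLinear h ∘ₗ (traceForm hA hκ hm).restrictScalars ℝ ∘ₗ mulXPow s hN)
    ((formOfLinear_injective h).comp ((traceForm_injective hA hκ hm).comp
      (mulXPow_injective s hN))) ?_ hd
  ext B
  rw [SetLike.mem_coe, mem_posCone_iff hP hA hsymm hκ hm ht ht' hlm hσ hs hm']
  have hev : ∀ (g : ℝ[X]) (y : ℝ), σ * (g.map Complex.ofRealHom).eval (-(y : ℂ))
      = ((σ * g.eval (-y) : ℝ) : ℂ) := by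
    intro g y
    rw [← Complex.ofReal_neg, ofReal_map_eval, Complex.ofReal_mul]
  constructor
  · rintro ⟨g, hg0, h1, h2, rfl⟩
    obtain ⟨g', hg'⟩ := exists_real_polynomial fun y hy => (h1 y hy).2
    have hdeg : g'.degree < m := by
      have := Polynomial.mem_degreeLT.mp g.2
      rwa [← hg', Polynomial.degree_map] at this
    obtain ⟨f, hf, h3, h4⟩ := (hreal g' hdeg).mp ⟨fun y hy => by
      have := (h1 y hy).1
      rwa [← hg', ofReal_map_eval, Complex.ofReal_re] at this, fun y hy => by
      have := (h2 y hy).1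
      rwa [← hg', hev, Complex.ofReal_re] at this⟩
    have hgf : mulXPow s hN ⟨f, Polynomial.mem_degreeLT.mpr hf⟩ = g := by
      refine Subtype.ext ?_
      rw [← hg', h3]
      rfl
    refine ⟨⟨f, Polynomial.mem_degreeLT.mpr hf⟩, ⟨fun h0 => hg0 ?_, h4⟩, ?_⟩
    · rw [← hgf, h0, map_zero]
      rfl
    · rw [← hgf]
      rfl
  · rintro ⟨f, ⟨hf0, hf⟩, rfl⟩
    have hfd := Polynomial.mem_degreeLT.mp f.2
    obtain ⟨h1, h2⟩ := (hreal (Polynomial.X ^ s * (f : ℝ[X])) (hN f hfd)).mpr ⟨f, hfd, rfl, hf⟩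
    refine ⟨mulXPow s hN f, fun h0 => hf0 ?_, fun y hy => ?_, fun y hy => ?_, rfl⟩
    · apply mulXPow_injective s hN
      rw [map_zero]
      exact Subtype.ext h0
    · change 0 ≤ (((Polynomial.X ^ s * (f : ℝ[X])).map Complex.ofRealHom).eval (y : ℂ)).re ∧
        (((Polynomial.X ^ s * (f : ℝ[X])).map Complex.ofRealHom).eval (y : ℂ)).im = 0
      rw [ofReal_map_eval]
      exact ⟨h1 y hy, Complex.ofReal_im _⟩
    · change 0 ≤ ((σ : ℂ) * ((Polynomial.X ^ s * (f : ℝ[X])).map Complex.ofRealHom).eval (-(y : ℂ))).re ∧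
        ((σ : ℂ) * ((Polynomial.X ^ s * (f : ℝ[X])).map Complex.ofRealHom).eval (-(y : ℂ))).im = 0
      rw [hev]
      exact ⟨h2 y hy, Complex.ofReal_im _⟩

/-! ### The constants `λ`, `κ`, `σ` and the case distinction -/

theorem units_cast_mul_self (ε : ℤˣ) : ((ε : ℤ) : ℂ) * ((ε : ℤ) : ℂ) = 1 := by
  rcases Int.units_eq_one_or ε with rfl | rfl <;> simp

theorem conj_lam (n : ℕ) (c : ℝ) (ε : ℤˣ) : (starRingEnd ℂ) (lam n c ε)
    = ((ε : ℤ) : ℂ) * Complex.I ^ n * Complex.exp (Real.pi * Complex.I * c) := by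
  rw [lam, map_mul, map_mul, map_zpow₀, Complex.conj_I, ← Complex.exp_conj, zpow_neg, ← inv_zpow,
    inv_neg, Complex.inv_I, neg_neg, zpow_natCast]
  simp

theorem lam_mul_conj (n : ℕ) (c : ℝ) (ε : ℤˣ) :
    lam n c ε * (starRingEnd ℂ) (lam n c ε) = 1 := by
  have h1 : Complex.I ^ (-(n : ℤ)) * Complex.I ^ n = 1 := by
    rw [zpow_neg, zpow_natCast, inv_mul_cancel₀ (pow_ne_zero _ Complex.I_ne_zero)]
  have h2 : Complex.exp (-(Real.pi * Complex.I * c)) * Complex.exp (Real.pi * Complex.I * c) = 1 := by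
    rw [← Complex.exp_add, neg_add_cancel, Complex.exp_zero]
  rw [conj_lam, lam]
  linear_combination (units_cast_mul_self ε) * (Complex.I ^ (-(n : ℤ)) * Complex.I ^ n) *
    (Complex.exp (-(Real.pi * Complex.I * c)) * Complex.exp (Real.pi * Complex.I * c)) +
    h1 * (Complex.exp (-(Real.pi * Complex.I * c)) * Complex.exp (Real.pi * Complex.I * c)) + h2

theorem lamStar_eq (n : ℕ) (c : ℝ) (ε : ℤˣ) :
    lamStar n c ε = (-1) ^ n * (starRingEnd ℂ) (lam n c ε) := by
  rw [lamStar, inv_eq_of_mul_eq_one_right (lam_mul_conj n c ε)]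

/-- This is the scalar by which `ρ²` acts on `v`, the twist `t`; the sign `ε` enters squared and
drops out. -/
theorem conj_lam_mul_lamStar (n : ℕ) (c : ℝ) (ε : ℤˣ) :
    (starRingEnd ℂ) (lam n c ε) * lamStar n c ε = ex c := by
  have h1 : Complex.I ^ n * Complex.I ^ n * (-1) ^ n = 1 := by
    rw [← mul_pow, ← mul_pow, Complex.I_mul_I]
    norm_num
  have h2 : Complex.exp (Real.pi * Complex.I * c) * Complex.exp (Real.pi * Complex.I * c) = ex c := by
    rw [← Complex.exp_add, ex]
    ring_nf
  rw [lamStar_eq, conj_lam, ← h2]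
  linear_combination (units_cast_mul_self ε) * (Complex.I ^ n * Complex.I ^ n * (-1) ^ n) *
    (Complex.exp (Real.pi * Complex.I * c) * Complex.exp (Real.pi * Complex.I * c)) +
    h1 * (Complex.exp (Real.pi * Complex.I * c) * Complex.exp (Real.pi * Complex.I * c))

theorem conj_lamStar_mul_lam (n : ℕ) (c : ℝ) (ε : ℤˣ) :
    (starRingEnd ℂ) (lamStar n c ε) * lam n c ε = (ex c)⁻¹ := by
  have h := congrArg (starRingEnd ℂ) (conj_lam_mul_lamStar n c ε)
  rw [map_mul, Complex.conj_conj, mul_comm, ← ex_neg_conj, Complex.conj_ofReal] at h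
  rw [h]
  refine eq_inv_of_mul_eq_one_left ?_
  rw [← ex_add, neg_add_cancel, ex, mul_zero, Complex.exp_zero]

/-- The point is `i^{-n} (-1)ⁿ = iⁿ`. The leftover `δ` is `1` when `κ = c` and `-1` when `c = 0`, `κ
= 1`, so `σ = εδ` decides between equal and opposite signs on the half-lines. -/
theorem lam_mul_ex_half (n : ℕ) (c κ : ℝ) (ε : ℤˣ) {δ : ℝ}
    (hδ : Complex.exp (-(Real.pi * Complex.I * c)) * ex (κ / 2) = δ) :
    lam n c ε * ((-1) ^ n * ex (κ / 2)) = ((ε : ℤ) * δ : ℝ) * Complex.I ^ n := by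
  have h1 : Complex.I ^ (-(n : ℤ)) * (-1) ^ n = Complex.I ^ n := by
    rw [zpow_neg, zpow_natCast, ← inv_pow, ← mul_pow, Complex.inv_I]
    norm_num
  rw [lam]
  push_cast
  rw [← hδ]
  linear_combination ((ε : ℤ) : ℂ) * Complex.exp (-(Real.pi * Complex.I * c)) * ex (κ / 2) * h1

theorem ex_real_ne_one {c : ℝ} (h0 : 0 < c) (h1 : c < 1) : ex c ≠ 1 := by
  intro h
  rw [ex, Complex.exp_eq_one_iff] at h
  obtain ⟨k, hk⟩ := h
  have h2 : (c : ℂ) = (k : ℂ) := by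
    have := Complex.two_pi_I_ne_zero
    apply mul_left_cancel₀ this
    rw [hk]
    ring
  have h3 : c = (k : ℝ) := by exact_mod_cast h2
  rw [h3] at h0 h1
  have h4 : 0 < k := by exact_mod_cast h0
  have h5 : k < 1 := by exact_mod_cast h1
  omega

theorem ex_one : ex ((1 : ℝ) : ℂ) = 1 := by
  rw [ex, Complex.ofReal_one, mul_one, Complex.exp_two_pi_mul_I]

/-- The reality and sign conditions on a polynomial weight whose two signs agree. -/
theorem nonneg_iff_of_same_sign {m : ℕ} (g : ℝ[X]) (hg : g.degree < (m : WithBot ℕ)) :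
    ((∀ y, 0 < y → 0 ≤ g.eval y) ∧ (∀ y, 0 < y → 0 ≤ (1 : ℝ) * g.eval (-y)) ↔
      ∃ f : ℝ[X], f.degree < (m : WithBot ℕ) ∧ g = Polynomial.X ^ 0 * f ∧ ∀ x, 0 ≤ f.eval x) := by
  constructor
  · rintro ⟨h1, h2⟩
    refine ⟨g, hg, by rw [pow_zero, one_mul], eval_nonneg_of_ne_zero fun x hx => ?_⟩
    rcases lt_or_gt_of_ne hx with hx | hx
    · have := h2 (-x) (neg_pos.mpr hx)
      rwa [neg_neg, one_mul] at this
    · exact h1 x hx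
  · rintro ⟨f, -, rfl, hf⟩
    simp [hf]

/-- Truncated subtraction is harmless at `m = 0`: both sides then say `f = 0`. -/
theorem degree_X_mul_lt_iff {m : ℕ} (f : ℝ[X]) :
    (Polynomial.X ^ 1 * f).degree < (m : WithBot ℕ) ↔ f.degree < ((m - 1 : ℕ) : WithBot ℕ) := by
  rw [pow_one]
  rcases eq_or_ne f 0 with rfl | hf
  · simp
  · rw [← Polynomial.natDegree_lt_iff_degree_lt hf, ← Polynomial.natDegree_lt_iff_degree_lt
      (mul_ne_zero Polynomial.X_ne_zero hf), Polynomial.natDegree_X_mul hf]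
    omega

/-- The reality and sign conditions on a polynomial weight whose two signs are opposite. -/
theorem nonneg_iff_of_opposite_sign {m : ℕ} (g : ℝ[X]) (hg : g.degree < (m : WithBot ℕ)) :
    ((∀ y, 0 < y → 0 ≤ g.eval y) ∧ (∀ y, 0 < y → 0 ≤ (-1 : ℝ) * g.eval (-y)) ↔
      ∃ f : ℝ[X], f.degree < ((m - 1 : ℕ) : WithBot ℕ) ∧ g = Polynomial.X ^ 1 * f ∧
        ∀ x, 0 ≤ f.eval x) := by
  constructor
  · rintro ⟨h1, h2⟩
    obtain ⟨f, rfl, hf⟩ := eq_X_mul_of_sign_change h1 fun x hx => by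
      have := h2 (-x) (neg_pos.mpr hx)
      rw [neg_neg] at this
      linarith
    refine ⟨f, (degree_X_mul_lt_iff f).mp (by rwa [pow_one]), by rw [pow_one], hf⟩
  · rintro ⟨f, -, rfl, hf⟩
    simp only [pow_one, Polynomial.eval_mul, Polynomial.eval_X]
    refine ⟨fun y hy => mul_nonneg hy.le (hf y), fun y hy => ?_⟩
    rw [neg_one_mul, neg_mul, neg_neg]
    exact mul_nonneg hy.le (hf _)

section
variable {P : ℂ[X]} (hP : P.Monic)
  (hconj : (P.map (starRingEnd ℂ)).comp (-Polynomial.X) = (-1) ^ P.natDegree * P)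
  (hA : ∀ α ∈ P.roots, |α.re| < 1 / 2) {c κ : ℝ} (hκ : 0 < κ) {m : ℕ}
  (hm : κ + m < P.natDegree + 1) (hex : ex c = ex κ) {δ : ℝ}
  (hδ : Complex.exp (-(Real.pi * Complex.I * c)) * ex (κ / 2) = δ)
  (hm' : (ex κ ≠ 1 ∧ m = P.natDegree) ∨ (ex κ = 1 ∧ m + 1 = P.natDegree)) {ε : ℤˣ}
include hP hA hκ hm hex hδ hm'

theorem hasDimModScaling_rho {s N : ℕ} {σ : ℝ} (hσ : ((ε : ℤ) * δ : ℝ) = σ) (hσ0 : σ ≠ 0)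
    (hN : ∀ h : ℝ[X], h.degree < (N : WithBot ℕ) →
      (Polynomial.X ^ s * h : ℝ[X]).degree < (m : WithBot ℕ))
    (hreal : ∀ g : ℝ[X], g.degree < (m : WithBot ℕ) → ((∀ y, 0 < y → 0 ≤ g.eval y) ∧
      (∀ y, 0 < y → 0 ≤ σ * g.eval (-y)) ↔
      ∃ f : ℝ[X], f.degree < (N : WithBot ℕ) ∧ g = Polynomial.X ^ s * f ∧ ∀ x, 0 ≤ f.eval x))
    {d : ℤ} (hd : d = if Even N then (N : ℤ) - 2 else (N : ℤ) - 1) :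
    HasDimModScaling (posCone P (rho P c ε hconj)) d := by
  have hcard : P.roots.card = P.natDegree := ((IsAlgClosed.splits P).natDegree_eq_card_roots).symm
  refine hasDimModScaling_posCone hP hA (roots_symm hP hconj) hκ (by rwa [hcard])
    ((conj_lam_mul_lamStar _ c ε).trans hex) ((conj_lamStar_mul_lam _ c ε).trans (by rw [hex]))
    (lam_mul_conj _ c ε) hσ0 ?_ hm' hN hreal hd
  rw [hcard, ← hσ]
  exact lam_mul_ex_half _ c κ ε hδ

theorem hasDimModScaling_rho_same_sign (hσ : ((ε : ℤ) * δ : ℝ) = 1) {d : ℤ}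
    (hd : d = if Even m then (m : ℤ) - 2 else (m : ℤ) - 1) :
    HasDimModScaling (posCone P (rho P c ε hconj)) d :=
  hasDimModScaling_rho hP hconj hA hκ hm hex hδ hm' (s := 0) hσ one_ne_zero
    (fun f hf => by rwa [pow_zero, one_mul]) nonneg_iff_of_same_sign hd

theorem hasDimModScaling_rho_opposite_sign (hσ : ((ε : ℤ) * δ : ℝ) = -1) {d : ℤ}
    (hd : d = if Even (m - 1) then ((m - 1 : ℕ) : ℤ) - 2 else ((m - 1 : ℕ) : ℤ) - 1) :
    HasDimModScaling (posCone P (rho P c ε hconj)) d :=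
  hasDimModScaling_rho hP hconj hA hκ hm hex hδ hm' (s := 1) hσ (neg_ne_zero.mpr one_ne_zero)
    (fun f hf => (degree_X_mul_lt_iff f).mpr hf) nonneg_iff_of_opposite_sign hd

end

theorem exp_mul_ex_half_self (c : ℝ) :
    Complex.exp (-(Real.pi * Complex.I * c)) * ex (c / 2) = (1 : ℝ) := by
  rw [ex, ← Complex.exp_add, Complex.ofReal_one, ← Complex.exp_zero]
  ring_nf

theorem exp_mul_ex_half_one :
    Complex.exp (-(Real.pi * Complex.I * (0 : ℝ))) * ex ((1 : ℝ) / 2) = (-1 : ℝ) := by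
  rw [Complex.ofReal_one, ex_half]
  simp

end Kleinian

end

theorem mainTheorem12 (n : ℕ) (hn : 1 ≤ n) (P : ℂ[X]) (hmonic : P.Monic) (hdeg : P.natDegree = n)
    (hconj : (P.map (starRingEnd ℂ)).comp (-Polynomial.X) = (-1) ^ P.natDegree * P)
    (hstrip : ∀ α ∈ P.roots, |α.re| < 1 / 2)
    (c : ℝ) (hc0 : 0 ≤ c) (hc1 : c < 1) :
    Kleinian.HasDimModScaling (Kleinian.posCone P (Kleinian.rho P c (-1) hconj))
      (if Even n then (n : ℤ) - 2 else (n : ℤ) - 3) ∧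
    (c ≠ 0 → Kleinian.HasDimModScaling (Kleinian.posCone P (Kleinian.rho P c 1 hconj))
      (if Even n then (n : ℤ) - 2 else (n : ℤ) - 1)) ∧
    (c = 0 → Kleinian.HasDimModScaling (Kleinian.posCone P (Kleinian.rho P c 1 hconj))
      (if Even n then (n : ℤ) - 4 else (n : ℤ) - 3)) := by
  open Kleinian in
  rcases hc0.eq_or_lt with rfl | hc
  -- Decay requires `κ > 0`, so `c = 0` is treated with `κ = 1`, which has the same `e^{2πiκ}`, and
  -- `m = n - 1`. Then `δ = -1`, so `ρ₋` is the equal-sign case and `ρ₊` the opposite one.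
  · have hm : (1 : ℝ) + ((n - 1 : ℕ) : ℝ) < P.natDegree + 1 := by
      rw [hdeg, Nat.cast_sub hn]
      push_cast
      linarith
    have hex : ex ((0 : ℝ) : ℂ) = ex ((1 : ℝ) : ℂ) := by
      rw [ex_one, ex, Complex.ofReal_zero, mul_zero, Complex.exp_zero]
    refine ⟨hasDimModScaling_rho_same_sign hmonic hconj hstrip one_pos hm hex
      exp_mul_ex_half_one (Or.inr ⟨ex_one, by omega⟩) (by simp) ?_, fun h => absurd rfl h,
      fun _ => hasDimModScaling_rho_opposite_sign hmonic hconj hstrip one_pos hm hex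
      exp_mul_ex_half_one (Or.inr ⟨ex_one, by omega⟩) (by simp) ?_⟩
    · split_ifs <;> grind
    · split_ifs <;> grind
  -- For `c > 0` take `κ = c` and `m = n`. Then `δ = 1` and the roles of `ρ₊` and `ρ₋` are
  -- exchanged.
  · have hm : c + (n : ℝ) < P.natDegree + 1 := by
      rw [hdeg]
      linarith
    refine ⟨hasDimModScaling_rho_opposite_sign hmonic hconj hstrip hc hm rfl
      (exp_mul_ex_half_self c) (Or.inl ⟨ex_real_ne_one hc hc1, hdeg.symm⟩) (by simp) ?_,
      fun _ => hasDimModScaling_rho_same_sign hmonic hconj hstrip hc hm rfl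
      (exp_mul_ex_half_self c) (Or.inl ⟨ex_real_ne_one hc hc1, hdeg.symm⟩) (by simp) rfl,
      fun h => absurd h hc.ne'⟩
    split_ifs <;> grind
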